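/- **Notation.** Let $Y(2)$ be the Yangian of $\mathfrak{gl}_2$: the complex unital algebra with generators $t_{ij}^{(r)}$ ($i,j\in\{-1,1\}$, $r\ge 0$), $t^{(0)}_{ij}=\delta_{ij}$, and relations $[t^{(r+1)}_{ij},t^{(s)}_{kl}]-[t^{(r)}_{ij},t^{(s+1)}_{kl}]=t^{(r)}_{kj}t^{(s)}_{il}-t^{(s)}_{kj}t^{(r)}_{il}$. Put $t_{ij}(u)=\sum_r t^{(r)}_{ij}u^{-r}$; the coproduct is $\Delta(t_{ij}(u))=\sum_a t_{ia}(u)\otimes t_{aj}(u)$. Put $\theta_{ij}=ij$ in the symplectic case ("$-$") and $\theta_{ij}=1$ in the orthogonal case ("$+$"), $E_{ij}^t=\theta_{ij}E_{-j,-i}$, and $S(u)=T(u)T^t(-u)$, i.e. $s_{ij}(u)=\sum_a\theta_{aj}t_{ia}(u)t_{-j,-a}(-u)$. The twisted Yangian $Y^{\mp}(2)\subset Y(2)$ is the subalgebra generated by the coefficients of all $s_{ij}(u)$; it is a left coideal for $\Delta$. With $A_2=\frac12\bigl(1-\sum E_{ij}\otimes E_{ji}\bigr)$, $R^t(v)=1-v^{-1}\sum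 E_{ij}^t\otimes E_{ji}$ and $C=F_{11}=E_{11}-E_{-1,-1}$, the Bethe subalgebra $\mathcal B^{\mp}\subset Y^{\mp}(2)$ is the subalgebra generated by the coefficients of $$\sigma_1(u)=\operatorname{tr}\bigl(A_2S_1(u)R^t(3-2u)C_2\bigr),\qquad \sigma_2(u)=\operatorname{tr}\bigl(A_2S_1(u)R^t(1-2u)S_2(u-1)\bigr).$$ For $\alpha-\beta\in\mathbb Z_{\ge0}$ let $L(\alpha,\beta)$ be the irreducible $\mathfrak{gl}_2$-module of highest weight $(\alpha,\beta)$, made into a $Y(2)$-module by $t_{ij}(u)\mapsto\delta_{ij}+E_{ij}u^{-1}$. As a vector space it is identified with the irreducible $\mathfrak{sl}_2$-module $V_{\alpha-\beta}$ of dimension $\alpha-\beta+1$, where $E_{1,-1}=e$, $E_{-1,1}=f$, $E_{11}=\frac{\alpha+\beta}2+\frac h2$, $E_{-1,-1}=\frac{\alpha+\beta}2-\frac h2$. For $\delta\in\mathbb C$ let $W(\delta)$ be the one-dimensional $Y^+(2)$-module on which $s_{11}(u)$, $s_{-1,-1}(u)$ act by $\frac{u+\delta}{u+1/2}$, $\frac{u-\delta+1}{u+1/2}$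 and $s_{1,-1}(u),s_{-1,1}(u)$ act by $0$. **Statement.** Let $k\ge0$, let $\alpha_i,\beta_i\in\mathbb C$ with $\alpha_i-\beta_i\in\mathbb Z_{\ge0}$ ($1\le i\le k$), and let $u_1,\dots,u_k\in\mathbb C$ satisfy $u_i^2\ne u_j^2$ for $i\ne j$. Put $z_i=tu_i$ and $L=V_{\alpha_1-\beta_1}\otimes\cdots\otimes V_{\alpha_k-\beta_k}$. Let $\mathcal B^-(tu_1,\dots,tu_k)\subset\operatorname{End}(L)$ be the image of $\mathcal B^-$ acting on $\bigotimes_iL(z_i+\alpha_i,z_i+\beta_i)$, and let $\mathcal B^+(tu_1,\dots,tu_k)\subset\operatorname{End}(L)$ be the image of $\mathcal B^+$ acting on $\bigotimes_iL(z_i+\alpha_i,z_i+\beta_i)\otimes W(\delta)$. Let $h^{(i)}=1^{\otimes(i-1)}\otimes h\otimes1^{\otimes(k-i)}$. Then, as $t\in\mathbb C$, $|t|\to\infty$, in the sense of convergence of subspaces in the Grassmannian of $\operatorname{End}(L)$: 1. $\lim_{t\to\infty}\mathcal B^-(tu_1,\dots,tu_k)$ is the unital subalgebra generated by $h^{(1)},\dots,h^{(k)}$;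 2. for every $\delta\in\mathbb C$, $\lim_{t\to\infty}\mathcal B^+(tu_1,\dots,tu_k)$ is the unital subalgebra generated by $h^{(i)}+(\delta-\tfrac12)\cdot\mathrm{id}$, $i=1,\dots,k$. -/

import Mathlib

open scoped Kronecker

namespace TwistedBethe

noncomputable section

/-! ### Power series in `u⁻¹`

A formal series `∑ aₙ u⁻ⁿ` with coefficients in a (possibly noncommutative) algebra is the
power series `∑ aₙ Xⁿ`, i.e. the variable `X` stands for `u⁻¹`. -/

section Series

variable {A : Type*} [Ring A]

/-- `f(u) ↦ f(-u)`. -/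
def negU (f : PowerSeries A) : PowerSeries A :=
  PowerSeries.mk fun n => (-1) ^ n * PowerSeries.coeff n f

/-- `f(u) ↦ f(u - 1)`, using `(u - 1)⁻¹ = X / (1 - X)`. -/
def shiftU [Algebra ℂ A] (f : PowerSeries A) : PowerSeries A :=
  PowerSeries.mk fun n => ∑ r ∈ Finset.range (n + 1),
    PowerSeries.coeff n ((PowerSeries.X * (1 - PowerSeries.X)⁻¹ : PowerSeries ℂ) ^ r) •
      PowerSeries.coeff r f

/-- Scalar series regarded as series with coefficients in the algebra `A`. -/
def scalarSeries (A : Type*) [Ring A] [Algebra ℂ A] : PowerSeries ℂ →+* PowerSeries A :=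
  PowerSeries.map (algebraMap ℂ A)

lemma negU_add (f g : PowerSeries A) : negU (f + g) = negU f + negU g := by
  ext n; simp [negU, mul_add]

lemma negU_zero : negU (0 : PowerSeries A) = 0 := by
  ext n; simp [negU]

lemma negU_mul (f g : PowerSeries A) : negU (f * g) = negU f * negU g := by
  ext n
  simp only [negU, PowerSeries.coeff_mk, PowerSeries.coeff_mul, Finset.mul_sum]
  refine Finset.sum_congr rfl fun p hp => ?_
  rw [← Finset.HasAntidiagonal.mem_antidiagonal.1 hp, pow_add]
  have h : Commute ((-1 : A) ^ p.2) (PowerSeries.coeff p.1 f) :=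
    ((Commute.one_left _).neg_left).pow_left _
  simp only [mul_assoc]
  rw [← mul_assoc (PowerSeries.coeff p.1 f), ← h.eq, mul_assoc]

lemma negU_sum {ι : Type*} (s : Finset ι) (f : ι → PowerSeries A) :
    negU (∑ i ∈ s, f i) = ∑ i ∈ s, negU (f i) := by
  classical
  induction s using Finset.induction_on with
  | empty => simp [negU_zero]
  | insert a s ha ih => rw [Finset.sum_insert ha, Finset.sum_insert ha, negU_add, ih]

end Series

/-! ### The Yangian -/

section Yangian

variable {I : Type} [DecidableEq I]

/-- The generator symbol `t_{ij}^{(r)}` in the free algebra. -/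
def freeT (r : ℕ) (i j : I) : FreeAlgebra ℂ (ℕ × I × I) := FreeAlgebra.ι ℂ (r, i, j)

/-- Defining relations of the Yangian of `gl_N` (`N` is the number of elements of `I`). -/
inductive YangianRel (I : Type) [DecidableEq I] :
    FreeAlgebra ℂ (ℕ × I × I) → FreeAlgebra ℂ (ℕ × I × I) → Prop
  | zero (i j : I) : YangianRel I (freeT 0 i j) (if i = j then 1 else 0)
  | comm (r s : ℕ) (i j k l : I) : YangianRel I
      ((freeT (r + 1) i j * freeT s k l - freeT s k l * freeT (r + 1) i j)
        - (freeT r i j * freeT (s + 1) k l - freeT (s + 1) k l * freeT r i j))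
      (freeT r k j * freeT s i l - freeT s k j * freeT r i l)

/-- The Yangian `Y(N)`: the complex unital algebra with generators `t_{ij}^{(r)}`, `r ≥ 0`. -/
def Yangian (I : Type) [DecidableEq I] : Type := RingQuot (YangianRel I)

instance : Ring (Yangian I) := inferInstanceAs (Ring (RingQuot (YangianRel I)))

instance : Algebra ℂ (Yangian I) := inferInstanceAs (Algebra ℂ (RingQuot (YangianRel I)))

/-- The generator `t_{ij}^{(r)}` of the Yangian. -/
def genT (r : ℕ) (i j : I) : Yangian I := RingQuot.mkAlgHom ℂ (YangianRel I) (freeT r i j)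

/-- The `T`-matrix `T(u)` of the Yangian. -/
def matT (I : Type) [DecidableEq I] : Matrix I I (PowerSeries (Yangian I)) :=
  Matrix.of fun i j => PowerSeries.mk fun r => genT r i j

/-- A matrix of series over an algebra `A` whose coefficients satisfy the relations of the
Yangian; such matrices are the same thing as algebra homomorphisms from the Yangian to `A`. -/
structure IsYangianMatrix {A : Type*} [Ring A] (T : Matrix I I (PowerSeries A)) : Prop where
  zero (i j : I) : PowerSeries.coeff 0 (T i j) = if i = j then 1 else 0
  comm (r s : ℕ) (i j k l : I) :
    ((PowerSeries.coeff (r + 1) (T i j) * PowerSeries.coeff s (T k l)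
        - PowerSeries.coeff s (T k l) * PowerSeries.coeff (r + 1) (T i j))
      - (PowerSeries.coeff r (T i j) * PowerSeries.coeff (s + 1) (T k l)
        - PowerSeries.coeff (s + 1) (T k l) * PowerSeries.coeff r (T i j)))
    = PowerSeries.coeff r (T k j) * PowerSeries.coeff s (T i l)
        - PowerSeries.coeff s (T k j) * PowerSeries.coeff r (T i l)

lemma isYangianMatrix_matT : IsYangianMatrix (matT I) where
  zero i j := by
    have h := RingQuot.mkAlgHom_rel ℂ (YangianRel.zero i j)
    simp only [matT, Matrix.of_apply, PowerSeries.coeff_mk]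
    refine h.trans ?_
    split_ifs
    · exact map_one _
    · exact map_zero _
  comm r s i j k l := by
    have h := RingQuot.mkAlgHom_rel ℂ (YangianRel.comm r s i j k l)
    simp only [map_sub, map_mul] at h
    simp only [matT, Matrix.of_apply, PowerSeries.coeff_mk]
    exact h

/-- The algebra homomorphism from the Yangian with `T(u) ↦ T`. -/
def Yangian.lift {A : Type*} [Ring A] [Algebra ℂ A] (T : Matrix I I (PowerSeries A))
    (hT : IsYangianMatrix T) : Yangian I →ₐ[ℂ] A :=
  RingQuot.liftAlgHom ℂ (s := YangianRel I)
    ⟨FreeAlgebra.lift ℂ fun x => PowerSeries.coeff x.1 (T x.2.1 x.2.2), by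
      intro x y h
      induction h with
      | zero i j =>
        simp only [freeT, FreeAlgebra.lift_ι_apply, hT.zero]
        split_ifs <;> simp
      | comm r s i j k l =>
        simp only [freeT, map_sub, map_mul, FreeAlgebra.lift_ι_apply]
        exact hT.comm r s i j k l⟩

lemma Yangian.lift_genT {A : Type*} [Ring A] [Algebra ℂ A] (T : Matrix I I (PowerSeries A))
    (hT : IsYangianMatrix T) (r : ℕ) (i j : I) :
    Yangian.lift T hT (genT r i j) = PowerSeries.coeff r (T i j) := by
  unfold Yangian.lift genT
  erw [RingQuot.liftAlgHom_mkAlgHom_apply]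
  simp [freeT]

end Yangian

section Product

variable {A : Type*} [Ring A]

/-- The two copies of the series ring inside the ring of series in two variables. -/
def inU : PowerSeries A →+* PowerSeries (PowerSeries A) := PowerSeries.C

/-- See `inU`. -/
def inV : PowerSeries A →+* PowerSeries (PowerSeries A) := PowerSeries.map PowerSeries.C

/-- The first of the two variables. -/
def varX : PowerSeries (PowerSeries A) := PowerSeries.C PowerSeries.X

lemma coeff_UV (f g : PowerSeries A) (r s : ℕ) :
    PowerSeries.coeff r (PowerSeries.coeff s (inU f * inV g))
      = PowerSeries.coeff r f * PowerSeries.coeff s g := by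
  simp [inU, inV, PowerSeries.coeff_C_mul, PowerSeries.coeff_mul_C]

lemma coeff_VU (f g : PowerSeries A) (r s : ℕ) :
    PowerSeries.coeff r (PowerSeries.coeff s (inV g * inU f))
      = PowerSeries.coeff s g * PowerSeries.coeff r f := by
  simp [inU, inV, PowerSeries.coeff_C_mul, PowerSeries.coeff_mul_C]

lemma commute_varX (F : PowerSeries (PowerSeries A)) : Commute varX F := by
  show _ = _
  ext n : 1
  simp only [varX, PowerSeries.coeff_C_mul, PowerSeries.coeff_mul_C]
  exact (PowerSeries.commute_X _).symm

/-- The relations of the Yangian in generating form. -/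
lemma isYangianMatrix_iff {I : Type} [DecidableEq I] (T : Matrix I I (PowerSeries A)) :
    IsYangianMatrix T ↔
      (∀ i j, PowerSeries.coeff 0 (T i j) = if i = j then 1 else 0) ∧
      ∀ i j k l, (PowerSeries.X - varX) * (inU (T i j) * inV (T k l) - inV (T k l) * inU (T i j))
        = PowerSeries.X * varX * (inU (T k j) * inV (T i l) - inV (T k j) * inU (T i l)) := by
  constructor
  · rintro ⟨h0, h⟩
    refine ⟨h0, fun i j k l => ?_⟩
    have hc : ∀ (i j : I) (a : A),
        PowerSeries.coeff 0 (T i j) * a = a * PowerSeries.coeff 0 (T i j) := by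
      intro i j a
      rw [h0]
      split_ifs <;> simp
    have hX : ∀ F : PowerSeries (PowerSeries A),
        PowerSeries.coeff 0 (PowerSeries.X * F) = 0 := fun F => by simp
    have hX' : ∀ F : PowerSeries A, PowerSeries.coeff 0 (PowerSeries.X * F) = 0 :=
      fun F => by simp
    ext s r
    simp only [sub_mul, mul_sub, mul_assoc, map_sub]
    rcases s with _ | s <;> rcases r with _ | r
    · simp only [varX, PowerSeries.coeff_C_mul, hX, hX', map_zero, sub_self]
    · simp only [varX, PowerSeries.coeff_C_mul, hX, map_zero, PowerSeries.coeff_succ_X_mul,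
        coeff_UV, coeff_VU, hc, sub_self]
    · simp only [varX, PowerSeries.coeff_C_mul, hX', PowerSeries.coeff_succ_X_mul,
        coeff_UV, coeff_VU, hc, sub_self]
    · simp only [varX, PowerSeries.coeff_C_mul, PowerSeries.coeff_succ_X_mul,
        coeff_UV, coeff_VU]
      rw [← h r s i j k l]
      abel
  · rintro ⟨h0, h⟩
    refine ⟨h0, fun r s i j k l => ?_⟩
    have := congrArg (fun F => PowerSeries.coeff (r + 1) (PowerSeries.coeff (s + 1) F)) (h i j k l)
    simp only [sub_mul, mul_sub, mul_assoc, map_sub, PowerSeries.coeff_succ_X_mul] at this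
    simp only [varX, PowerSeries.coeff_C_mul, PowerSeries.coeff_succ_X_mul, coeff_UV, coeff_VU] at this
    rw [← this]
    abel

lemma product_relation {R I : Type*} [Ring R] [Fintype I] (D P : R) (aU aV bU bV : I → I → R)
    (hD : ∀ F, D * F = F * D) (hP : ∀ F, P * F = F * P)
    (cUV : ∀ i j k l, bU i j * aV k l = aV k l * bU i j)
    (cVU : ∀ i j k l, bV i j * aU k l = aU k l * bV i j)
    (ha : ∀ i j k l, D * (aU i j * aV k l - aV k l * aU i j)
      = P * (aU k j * aV i l - aV k j * aU i l))
    (hb : ∀ i j k l, D * (bU i j * bV k l - bV k l * bU i j)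
      = P * (bU k j * bV i l - bV k j * bU i l)) (i j k l : I) :
    D * ((∑ p, aU i p * bU p j) * (∑ q, aV k q * bV q l)
        - (∑ q, aV k q * bV q l) * (∑ p, aU i p * bU p j))
      = P * ((∑ p, aU k p * bU p j) * (∑ q, aV i q * bV q l)
        - (∑ p, aV k p * bV p j) * (∑ q, aU i q * bU q l)) := by
  have m1 : ∀ i p j k q l, aU i p * bU p j * (aV k q * bV q l)
      = aU i p * aV k q * (bU p j * bV q l) := by
    intro i p j k q l
    rw [mul_assoc, ← mul_assoc (bU p j), cUV]
    simp only [mul_assoc]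
  have m2 : ∀ i p j k q l, aV k q * bV q l * (aU i p * bU p j)
      = aV k q * aU i p * (bV q l * bU p j) := by
    intro i p j k q l
    rw [mul_assoc, ← mul_assoc (bV q l), cVU]
    simp only [mul_assoc]
  have key : ∀ p q, D * (aU i p * bU p j * (aV k q * bV q l) - aV k q * bV q l * (aU i p * bU p j))
      = P * ((aU k p * aV i q - aV k p * aU i q) * (bU p j * bV q l))
        + P * (aV k q * aU i p * (bU q j * bV p l - bV q j * bU p l)) := by
    intro p q
    rw [m1, m2]
    have e : aU i p * aV k q * (bU p j * bV q l) - aV k q * aU i p * (bV q l * bU p j)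
        = (aU i p * aV k q - aV k q * aU i p) * (bU p j * bV q l)
          + aV k q * aU i p * (bU p j * bV q l - bV q l * bU p j) := by
      noncomm_ring
    rw [e, mul_add, ← mul_assoc D, ha, ← mul_assoc D, hD, mul_assoc _ D, hb, ← mul_assoc _ P,
      ← hP]
    simp only [mul_assoc]
  have hL : (∑ p, aU i p * bU p j) * (∑ q, aV k q * bV q l)
        - (∑ q, aV k q * bV q l) * (∑ p, aU i p * bU p j)
      = ∑ p, ∑ q, (aU i p * bU p j * (aV k q * bV q l) - aV k q * bV q l * (aU i p * bU p j)) := by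
    simp only [Finset.sum_sub_distrib]
    rw [Finset.sum_mul_sum, Finset.sum_mul_sum]
    congr 1
    exact Finset.sum_comm
  have hR : (∑ p, aU k p * bU p j) * (∑ q, aV i q * bV q l)
        - (∑ p, aV k p * bV p j) * (∑ q, aU i q * bU q l)
      = ∑ p, ∑ q, (aU k p * bU p j * (aV i q * bV q l) - aV k p * bV p j * (aU i q * bU q l)) := by
    simp only [Finset.sum_sub_distrib]
    rw [Finset.sum_mul_sum, Finset.sum_mul_sum]
  rw [hL, hR]
  simp only [Finset.mul_sum, key, Finset.sum_add_distrib]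
  rw [Finset.sum_comm (f := fun p q => P * (aV k q * aU i p * (bU q j * bV p l - bV q j * bU p l)))]
  simp only [← Finset.sum_add_distrib, ← mul_add]
  refine Finset.sum_congr rfl fun p _ => Finset.sum_congr rfl fun q _ => ?_
  rw [m1, m2]
  congr 1
  noncomm_ring

/-- The product of two Yangian matrices with mutually commuting coefficients is again one:
this is the coproduct `Δ(t_{ij}(u)) = ∑ₐ t_{ia}(u) ⊗ t_{aj}(u)` of the Yangian. -/
lemma IsYangianMatrix.mul {I : Type} [DecidableEq I] [Fintype I]
    {S T : Matrix I I (PowerSeries A)} (hS : IsYangianMatrix S) (hT : IsYangianMatrix T)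
    (hST : ∀ (r s : ℕ) (i j k l : I),
      Commute (PowerSeries.coeff r (S i j)) (PowerSeries.coeff s (T k l))) :
    IsYangianMatrix (S * T) := by
  obtain ⟨hS0, hS1⟩ := (isYangianMatrix_iff S).1 hS
  obtain ⟨hT0, hT1⟩ := (isYangianMatrix_iff T).1 hT
  refine (isYangianMatrix_iff _).2 ⟨fun i j => ?_, fun i j k l => ?_⟩
  · have h : ∀ x, PowerSeries.coeff 0 (S i x * T x j)
        = PowerSeries.coeff 0 (S i x) * PowerSeries.coeff 0 (T x j) := fun x => by simp
    simp only [Matrix.mul_apply, map_sum, h, hS0, hT0]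
    simp
  · simp only [Matrix.mul_apply, map_sum, map_mul]
    refine product_relation _ _ (fun i j => inU (S i j)) (fun i j => inV (S i j))
      (fun i j => inU (T i j)) (fun i j => inV (T i j)) ?_ ?_ ?_ ?_ hS1 hT1 i j k l
    · intro F
      rw [sub_mul, mul_sub, (PowerSeries.commute_X F).eq, (commute_varX F).eq]
    · intro F
      rw [mul_assoc, (commute_varX F).eq, ← mul_assoc, ← mul_assoc, (PowerSeries.commute_X F).eq]
    · intro i j k l
      ext s r
      rw [coeff_UV, coeff_VU, (hST _ _ _ _ _ _).eq]
    · intro i j k l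
      ext s r
      rw [coeff_UV, coeff_VU, (hST _ _ _ _ _ _).eq]

end Product

/-! ### The modules `L(α₁,β₁) ⊗ ⋯ ⊗ L(α_k,β_k)` over `Y(2)`

The index set `{-1, 1}` is `ℤˣ`. -/

section Evaluation

variable {A : Type*} [Ring A]

lemma IsYangianMatrix.map {B : Type*} [Ring B] {I : Type} [DecidableEq I]
    {T : Matrix I I (PowerSeries A)} (hT : IsYangianMatrix T) (φ : A →+* B) :
    IsYangianMatrix (T.map (PowerSeries.map φ)) where
  zero i j := by
    rw [Matrix.map_apply, PowerSeries.coeff_map, hT.zero]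
    split_ifs <;> simp
  comm r s i j k l := by
    simp only [Matrix.map_apply, PowerSeries.coeff_map, ← map_mul, ← map_sub, hT.comm]

/-- The matrix `(δ_{ij} + E_{ij} u⁻¹)`. -/
def evalMatrix {I : Type} [DecidableEq I] (E : Matrix I I A) : Matrix I I (PowerSeries A) :=
  Matrix.of fun i j =>
    PowerSeries.C (if i = j then 1 else 0) + PowerSeries.C (E i j) * PowerSeries.X

lemma coeff_evalMatrix {I : Type} [DecidableEq I] (E : Matrix I I A) (r : ℕ) (i j : I) :
    PowerSeries.coeff r (evalMatrix E i j)
      = if r = 0 then (if i = j then 1 else 0) else if r = 1 then E i j else 0 := by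
  simp only [evalMatrix, Matrix.of_apply, map_add, PowerSeries.coeff_C_mul, PowerSeries.coeff_X,
    PowerSeries.coeff_C]
  rcases r with _ | _ | r <;> simp

/-- The evaluation homomorphism `t_{ij}(u) ↦ δ_{ij} + E_{ij} u⁻¹`, for elements `E_{ij}` that
satisfy the commutation relations of `gl_N`. -/
lemma isYangianMatrix_evalMatrix {I : Type} [DecidableEq I] (E : Matrix I I A)
    (hE : ∀ i j k l, E i j * E k l - E k l * E i j
      = (if k = j then E i l else 0) - (if i = l then E k j else 0)) :
    IsYangianMatrix (evalMatrix E) where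
  zero i j := by simp [coeff_evalMatrix]
  comm r s i j k l := by
    simp only [coeff_evalMatrix]
    rcases r with _ | _ | r <;> rcases s with _ | _ | s <;>
      simp [hE]

/-- The matrix with rows `(b, f)`, `(e, a)`, that is `E₁₁ = a`, `E_{1,-1} = e`, `E_{-1,1} = f`,
`E_{-1,-1} = b`. -/
def glMatrix (a e f b : A) : Matrix ℤˣ ℤˣ A :=
  Matrix.of fun i j => if i = 1 then (if j = 1 then a else e) else (if j = 1 then f else b)

lemma units_cases (i : ℤˣ) : i = 1 ∨ i = -1 := Int.units_eq_one_or i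

lemma isYangianMatrix_glMatrix (a e f b : A) (hef : e * f - f * e = a - b)
    (hae : a * e - e * a = e) (haf : a * f - f * a = -f) (hbe : b * e - e * b = -e)
    (hbf : b * f - f * b = f) (hab : a * b = b * a) :
    IsYangianMatrix (evalMatrix (glMatrix a e f b)) := by
  refine isYangianMatrix_evalMatrix _ ?_
  have hea : e * a - a * e = -e := by rw [← neg_sub, hae]
  have hfa : f * a - a * f = f := by rw [← neg_sub, haf, neg_neg]
  have heb : e * b - b * e = e := by rw [← neg_sub, hbe, neg_neg]
  have hfb : f * b - b * f = -f := by rw [← neg_sub, hbf]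
  have hfe : f * e - e * f = b - a := by rw [← neg_sub, hef, neg_sub]
  intro i j k l
  rcases units_cases i with rfl | rfl <;> rcases units_cases j with rfl | rfl <;>
    rcases units_cases k with rfl | rfl <;> rcases units_cases l with rfl | rfl <;>
    simp [glMatrix, *]

end Evaluation

section Module

/-- The action of `e` on the `(d+1)`-dimensional irreducible `sl₂`-module with weight basis
`v₀, …, v_d`: `e v_j = j (d - j + 1) v_{j-1}`. -/
def sl2E (d : ℕ) : Matrix (Fin (d + 1)) (Fin (d + 1)) ℂ :=
  Matrix.of fun p q => if (p : ℕ) + 1 = q then (q : ℂ) * ((d : ℂ) - q + 1) else 0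

/-- The action of `f`: `f v_j = v_{j+1}`, with `f v_d = 0`. -/
def sl2F (d : ℕ) : Matrix (Fin (d + 1)) (Fin (d + 1)) ℂ :=
  Matrix.of fun p q => if (p : ℕ) = q + 1 then 1 else 0

/-- The action of `h`: `h v_j = (d - 2 j) v_j`. -/
def sl2H (d : ℕ) : Matrix (Fin (d + 1)) (Fin (d + 1)) ℂ :=
  Matrix.diagonal fun j => (d : ℂ) - 2 * (j : ℕ)

lemma sl2_ef_apply (d : ℕ) (p q : Fin (d + 1)) :
    (sl2E d * sl2F d) p q = if p = q then ((p : ℂ) + 1) * ((d : ℂ) - p) else 0 := by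
  simp only [sl2E, sl2F, Matrix.mul_apply, Matrix.of_apply]
  by_cases hp : (p : ℕ) + 1 < d + 1
  · rw [Finset.sum_eq_single ⟨(p : ℕ) + 1, hp⟩]
    · by_cases h : p = q
      · subst h
        simp only [if_true]
        push_cast
        ring
      · have : ¬ (p : ℕ) = q := fun h' => h (Fin.ext h')
        simp [h, this]
    · intro b _ hb
      have : ¬ (p : ℕ) + 1 = b := fun h' => hb (Fin.ext h'.symm)
      simp [this]
    · simp
  · have hd : (p : ℕ) = d := by have := p.2; omega
    rw [Finset.sum_eq_zero]
    · simp [hd]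
    · intro b _
      have : ¬ (p : ℕ) + 1 = b := by have := b.2; omega
      simp [this]

lemma sl2_fe_apply (d : ℕ) (p q : Fin (d + 1)) :
    (sl2F d * sl2E d) p q = if p = q then (p : ℂ) * ((d : ℂ) - p + 1) else 0 := by
  simp only [sl2E, sl2F, Matrix.mul_apply, Matrix.of_apply]
  by_cases hp : (p : ℕ) = 0
  · rw [Finset.sum_eq_zero]
    · simp [hp]
    · intro b _
      simp [hp]
  · have hlt : (p : ℕ) - 1 < d + 1 := by have := p.2; omega
    rw [Finset.sum_eq_single ⟨(p : ℕ) - 1, hlt⟩]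
    · have h1 : (p : ℕ) - 1 + 1 = p := by omega
      by_cases h : p = q
      · subst h; simp [h1]
      · have : ¬ (p : ℕ) = q := fun h' => h (Fin.ext h')
        simp [h, h1, this]
    · intro b _ hb
      have : ¬ (p : ℕ) = b + 1 := fun h' => hb (Fin.ext (by simp; omega))
      simp [this]
    · simp

lemma sl2_ef (d : ℕ) : sl2E d * sl2F d - sl2F d * sl2E d = sl2H d := by
  ext p q
  rw [Matrix.sub_apply, sl2_ef_apply, sl2_fe_apply, sl2H, Matrix.diagonal_apply]
  split_ifs
  · ring
  · ring

lemma sl2_he (d : ℕ) : sl2H d * sl2E d - sl2E d * sl2H d = (2 : ℂ) • sl2E d := by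
  ext p q
  simp only [sl2H, Matrix.sub_apply, Matrix.diagonal_mul, Matrix.mul_diagonal, Matrix.smul_apply,
    sl2E, Matrix.of_apply, smul_eq_mul]
  split_ifs with h
  · rw [← h]; push_cast; ring
  · simp

lemma sl2_hf (d : ℕ) : sl2H d * sl2F d - sl2F d * sl2H d = (-2 : ℂ) • sl2F d := by
  ext p q
  simp only [sl2H, Matrix.sub_apply, Matrix.diagonal_mul, Matrix.mul_diagonal, Matrix.smul_apply,
    sl2F, Matrix.of_apply, smul_eq_mul]
  split_ifs with h
  · rw [h]; push_cast; ring
  · simp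

variable {k : ℕ}

/-- Indices of the weight basis `v_{j₁} ⊗ ⋯ ⊗ v_{j_k}` of `V_{d₁} ⊗ ⋯ ⊗ V_{d_k}`. -/
abbrev TensorIndex (d : Fin k → ℕ) : Type := (i : Fin k) → Fin (d i + 1)

/-- `End (V_{d₁} ⊗ ⋯ ⊗ V_{d_k})`, written in the weight basis. -/
abbrev EndTensor (d : Fin k → ℕ) : Type := Matrix (TensorIndex d) (TensorIndex d) ℂ

/-- The operator `a₁ ⊗ ⋯ ⊗ a_k`. -/
def pureTensor (d : Fin k → ℕ) (a : (i : Fin k) → Matrix (Fin (d i + 1)) (Fin (d i + 1)) ℂ) :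
    EndTensor d :=
  Matrix.of fun p q => ∏ i, a i (p i) (q i)

/-- The operator `1^{⊗(i-1)} ⊗ a ⊗ 1^{⊗(k-i)}`. -/
def site (d : Fin k → ℕ) (i : Fin k) (a : Matrix (Fin (d i + 1)) (Fin (d i + 1)) ℂ) :
    EndTensor d :=
  pureTensor d (Function.update (fun _ => 1) i a)

lemma pureTensor_mul (d : Fin k → ℕ)
    (a b : (i : Fin k) → Matrix (Fin (d i + 1)) (Fin (d i + 1)) ℂ) :
    pureTensor d a * pureTensor d b = pureTensor d (fun i => a i * b i) := by
  ext p q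
  simp only [pureTensor, Matrix.mul_apply, Matrix.of_apply, Fintype.prod_sum,
    Finset.prod_mul_distrib]

lemma pureTensor_one (d : Fin k → ℕ) : pureTensor d (fun _ => 1) = 1 := by
  ext p q
  simp only [pureTensor, Matrix.of_apply, Matrix.one_apply]
  rw [Finset.prod_ite_zero]
  simp [funext_iff]

lemma site_mul (d : Fin k → ℕ) (i : Fin k) (a b : Matrix (Fin (d i + 1)) (Fin (d i + 1)) ℂ) :
    site d i (a * b) = site d i a * site d i b := by
  rw [site, site, site, pureTensor_mul]
  congr 1
  funext j
  by_cases h : j = i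
  · subst h; simp
  · simp [h]

lemma site_one (d : Fin k → ℕ) (i : Fin k) : site d i 1 = 1 := by
  rw [site, Function.update_eq_self_iff.2 rfl, pureTensor_one]

lemma site_apply (d : Fin k → ℕ) (i : Fin k) (a : Matrix (Fin (d i + 1)) (Fin (d i + 1)) ℂ)
    (p q : TensorIndex d) :
    site d i a p q = a (p i) (q i) *
      ∏ j ∈ Finset.univ.erase i, (1 : Matrix (Fin (d j + 1)) (Fin (d j + 1)) ℂ) (p j) (q j) := by
  rw [site, pureTensor, Matrix.of_apply, ← Finset.mul_prod_erase _ _ (Finset.mem_univ i)]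
  congr 1
  · simp
  · refine Finset.prod_congr rfl fun j hj => ?_
    rw [Function.update_of_ne (Finset.ne_of_mem_erase hj)]

lemma site_add (d : Fin k → ℕ) (i : Fin k) (a b : Matrix (Fin (d i + 1)) (Fin (d i + 1)) ℂ) :
    site d i (a + b) = site d i a + site d i b := by
  ext p q; simp only [site_apply, Matrix.add_apply, add_mul]

lemma site_sub (d : Fin k → ℕ) (i : Fin k) (a b : Matrix (Fin (d i + 1)) (Fin (d i + 1)) ℂ) :
    site d i (a - b) = site d i a - site d i b := by
  ext p q; simp only [site_apply, Matrix.sub_apply, sub_mul]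

lemma site_neg (d : Fin k → ℕ) (i : Fin k) (a : Matrix (Fin (d i + 1)) (Fin (d i + 1)) ℂ) :
    site d i (-a) = -site d i a := by
  ext p q; simp only [site_apply, Matrix.neg_apply, neg_mul]

lemma site_commute (d : Fin k → ℕ) {i j : Fin k} (hij : i ≠ j)
    (a : Matrix (Fin (d i + 1)) (Fin (d i + 1)) ℂ)
    (b : Matrix (Fin (d j + 1)) (Fin (d j + 1)) ℂ) :
    Commute (site d i a) (site d j b) := by
  show _ = _
  rw [site, site, pureTensor_mul, pureTensor_mul]
  congr 1
  funext l
  by_cases h : l = i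
  · subst h; simp [hij]
  · simp [h]

/-- The action of `E₁₁` on the irreducible `gl₂`-module `L(α, β)` (where `α - β = d`):
`E₁₁ v_j = (α - j) v_j`, written as `(α + β) / 2 + h / 2`. -/
def glA (d : ℕ) (α β : ℂ) : Matrix (Fin (d + 1)) (Fin (d + 1)) ℂ :=
  ((α + β) / 2) • (1 : Matrix (Fin (d + 1)) (Fin (d + 1)) ℂ) + (1 / 2 : ℂ) • sl2H d

/-- The action of `E_{-1,-1}` on `L(α, β)`: `E_{-1,-1} v_j = (β + j) v_j`. -/
def glB (d : ℕ) (α β : ℂ) : Matrix (Fin (d + 1)) (Fin (d + 1)) ℂ :=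
  ((α + β) / 2) • (1 : Matrix (Fin (d + 1)) (Fin (d + 1)) ℂ) - (1 / 2 : ℂ) • sl2H d

/-- The matrix by which `T(u)` acts on the `i`-th factor `L(α_i, β_i)` of the tensor product. -/
def factorT (d : Fin k → ℕ) (α β : Fin k → ℂ) (i : Fin k) :
    Matrix ℤˣ ℤˣ (PowerSeries (EndTensor d)) :=
  evalMatrix (glMatrix (site d i (glA (d i) (α i) (β i))) (site d i (sl2E (d i)))
    (site d i (sl2F (d i))) (site d i (glB (d i) (α i) (β i))))

/-- The matrix by which `T(u)` acts on `L(α₁,β₁) ⊗ ⋯ ⊗ L(α_k,β_k)`; by the formula for the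
coproduct, `t_{ij}(u)` acts as `∑ t_{i,i₁}(u) ⊗ t_{i₁,i₂}(u) ⊗ ⋯ ⊗ t_{i_{k-1},j}(u)`. -/
def tensorT (d : Fin k → ℕ) (α β : Fin k → ℂ) : Matrix ℤˣ ℤˣ (PowerSeries (EndTensor d)) :=
  ((List.finRange k).map (factorT d α β)).prod

lemma isYangianMatrix_factorT (d : Fin k → ℕ) (α β : Fin k → ℂ) (i : Fin k) :
    IsYangianMatrix (factorT d α β i) := by
  have he := sl2_he (d i)
  have hf := sl2_hf (d i)
  have hef := sl2_ef (d i)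
  refine isYangianMatrix_glMatrix _ _ _ _ ?_ ?_ ?_ ?_ ?_ ?_ <;>
    simp only [← site_mul, ← site_sub, ← site_neg] <;> congr 1 <;> simp only [glA, glB]
  · rw [hef]; module
  · simp only [add_mul, mul_add, smul_mul_assoc, mul_smul_comm, one_mul, mul_one]
    refine Eq.trans ?_ (congrArg (fun x => (1 / 2 : ℂ) • x) he) |>.trans ?_ <;> module
  · simp only [add_mul, mul_add, smul_mul_assoc, mul_smul_comm, one_mul, mul_one]
    refine Eq.trans ?_ (congrArg (fun x => (1 / 2 : ℂ) • x) hf) |>.trans ?_ <;> module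
  · simp only [sub_mul, mul_sub, smul_mul_assoc, mul_smul_comm, one_mul, mul_one]
    refine Eq.trans ?_ (congrArg (fun x => (-1 / 2 : ℂ) • x) he) |>.trans ?_ <;> module
  · simp only [sub_mul, mul_sub, smul_mul_assoc, mul_smul_comm, one_mul, mul_one]
    refine Eq.trans ?_ (congrArg (fun x => (-1 / 2 : ℂ) • x) hf) |>.trans ?_ <;> module
  · simp only [add_mul, mul_add, sub_mul, mul_sub, smul_mul_assoc, mul_smul_comm, one_mul, mul_one]
    module

lemma commute_coeff_mul {A : Type*} [Ring A] {I : Type} [Fintype I] (x : A)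
    {S T : Matrix I I (PowerSeries A)} (hS : ∀ r i j, Commute x (PowerSeries.coeff r (S i j)))
    (hT : ∀ r i j, Commute x (PowerSeries.coeff r (T i j))) (r : ℕ) (i j : I) :
    Commute x (PowerSeries.coeff r ((S * T) i j)) := by
  simp only [Matrix.mul_apply, map_sum, PowerSeries.coeff_mul]
  exact Commute.sum_right _ _ _ fun a _ => Commute.sum_right _ _ _ fun p _ =>
    (hS _ _ _).mul_right (hT _ _ _)

lemma exists_coeff_factorT (d : Fin k → ℕ) (α β : Fin k → ℂ) (i : Fin k) (r : ℕ) (a b : ℤˣ) :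
    ∃ x, PowerSeries.coeff r (factorT d α β i a b) = site d i x := by
  have h0 : site d i 0 = 0 := by simpa using site_sub d i 0 0
  rw [factorT, coeff_evalMatrix, glMatrix, Matrix.of_apply]
  split_ifs
  · exact ⟨1, (site_one d i).symm⟩
  · exact ⟨0, h0.symm⟩
  · exact ⟨_, rfl⟩
  · exact ⟨_, rfl⟩
  · exact ⟨_, rfl⟩
  · exact ⟨_, rfl⟩
  · exact ⟨0, h0.symm⟩

lemma commute_factorT (d : Fin k → ℕ) (α β : Fin k → ℂ) {i j : Fin k} (hij : i ≠ j)
    (r s : ℕ) (a b c e : ℤˣ) :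
    Commute (PowerSeries.coeff r (factorT d α β i a b))
      (PowerSeries.coeff s (factorT d α β j c e)) := by
  obtain ⟨x, hx⟩ := exists_coeff_factorT d α β i r a b
  obtain ⟨y, hy⟩ := exists_coeff_factorT d α β j s c e
  rw [hx, hy]
  exact site_commute d hij x y

lemma isYangianMatrix_one {A : Type*} [Ring A] {I : Type} [DecidableEq I] :
    IsYangianMatrix (1 : Matrix I I (PowerSeries A)) := by
  have : (1 : Matrix I I (PowerSeries A)) = evalMatrix 0 := by
    ext i j : 2
    simp only [evalMatrix, Matrix.of_apply, Matrix.zero_apply, map_zero, zero_mul, add_zero,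
      Matrix.one_apply]
    split_ifs <;> simp
  rw [this]
  exact isYangianMatrix_evalMatrix 0 (by simp)

lemma isYangianMatrix_list (d : Fin k → ℕ) (α β : Fin k → ℂ) (l : List (Fin k)) (hl : l.Nodup) :
    IsYangianMatrix (l.map (factorT d α β)).prod ∧
      ∀ i ∉ l, ∀ (r s : ℕ) (a b c e : ℤˣ),
        Commute (PowerSeries.coeff r (factorT d α β i a b))
          (PowerSeries.coeff s ((l.map (factorT d α β)).prod c e)) := by
  induction l with
  | nil =>
    refine ⟨isYangianMatrix_one, fun i _ r s a b c e => ?_⟩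
    simp only [List.map_nil, List.prod_nil, Matrix.one_apply]
    split_ifs
    · rw [PowerSeries.coeff_one]
      split_ifs
      · exact Commute.one_right _
      · exact Commute.zero_right _
    · rw [map_zero]; exact Commute.zero_right _
  | cons j l ih =>
    obtain ⟨hj, hl⟩ := List.nodup_cons.1 hl
    obtain ⟨h1, h2⟩ := ih hl
    rw [List.map_cons, List.prod_cons]
    refine ⟨(isYangianMatrix_factorT d α β j).mul h1 fun r s a b c e => h2 j hj r s a b c e,
      fun i hi r s a b c e => ?_⟩
    rw [List.mem_cons, not_or] at hi
    exact commute_coeff_mul _ (fun s c e => commute_factorT d α β hi.1 r s a b c e)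
      (fun s c e => h2 i hi.2 r s a b c e) s c e

lemma isYangianMatrix_tensorT (d : Fin k → ℕ) (α β : Fin k → ℂ) :
    IsYangianMatrix (tensorT d α β) :=
  (isYangianMatrix_list d α β _ (List.nodup_finRange k)).1

/-- The `Y(2)`-module `L(α₁,β₁) ⊗ ⋯ ⊗ L(α_k,β_k)`, where `α_i - β_i = d_i`, on the vector space
`V_{d₁} ⊗ ⋯ ⊗ V_{d_k}`. -/
def tensorRep (d : Fin k → ℕ) (α β : Fin k → ℂ) : Yangian ℤˣ →ₐ[ℂ] EndTensor d :=
  Yangian.lift (tensorT d α β) (isYangianMatrix_tensorT d α β)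

/-- The operator `h^{(i)} = 1^{⊗(i-1)} ⊗ h ⊗ 1^{⊗(k-i)}`. -/
def cartanH (d : Fin k → ℕ) (i : Fin k) : EndTensor d := site d i (sl2H (d i))

end Module

/-! ### Twisted Yangians `Y⁻(2)` and `Y⁺(2)` -/

section Twisted

/-- `minus` is the symplectic case `Y⁻(2)`, `plus` is the orthogonal case `Y⁺(2)`. -/
inductive Kind
  | minus
  | plus

/-- The sign `θ_{ij}`: `sgn(i) sgn(j)` in the symplectic case, `1` in the orthogonal case. -/
def theta : Kind → ℤˣ → ℤˣ → ℤˣ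
  | Kind.minus, i, j => i * j
  | Kind.plus, _, _ => 1

variable {A : Type*} [Ring A]

/-- `T^t(-u)`, whose `(i,j)` entry is `θ_{ij} t_{-j,-i}(-u)`. -/
def transposeNeg (κ : Kind) (T : Matrix ℤˣ ℤˣ (PowerSeries A)) :
    Matrix ℤˣ ℤˣ (PowerSeries A) :=
  Matrix.of fun i j => (theta κ i j : ℤ) • negU (T (-j) (-i))

/-- The `S`-matrix `S(u) = T(u) T^t(-u)`. -/
def matS (κ : Kind) (T : Matrix ℤˣ ℤˣ (PowerSeries A)) : Matrix ℤˣ ℤˣ (PowerSeries A) :=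
  T * transposeNeg κ T

/-- The element `s_{ij}^{(M)}` of the Yangian `Y(2)`. -/
def genS (κ : Kind) (M : ℕ) (i j : ℤˣ) : Yangian ℤˣ :=
  PowerSeries.coeff M (matS κ (matT ℤˣ) i j)

/-- The twisted Yangian `Y^∓(2)`: the subalgebra of `Y(2)` generated by all `s_{ij}^{(M)}`. -/
def twistedYangian (κ : Kind) : Subalgebra ℂ (Yangian ℤˣ) :=
  Algebra.adjoin ℂ (Set.range fun x : ℕ × ℤˣ × ℤˣ => genS κ x.1 x.2.1 x.2.2)

/-- The generator `s_{ij}^{(M)}` as an element of the twisted Yangian. -/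
def twGen (κ : Kind) (M : ℕ) (i j : ℤˣ) : twistedYangian κ :=
  ⟨genS κ M i j, Algebra.subset_adjoin ⟨(M, i, j), rfl⟩⟩

/-- The `S`-matrix with coefficients in the twisted Yangian. -/
def twS (κ : Kind) : Matrix ℤˣ ℤˣ (PowerSeries (twistedYangian κ)) :=
  Matrix.of fun i j => PowerSeries.mk fun M => twGen κ M i j

/-! ### Bethe subalgebras

Operators on `W ⊗ W`, `W = ℂ²`, are matrices indexed by `ℤˣ × ℤˣ`. -/

/-- The permutation operator `P = ∑ E_{ij} ⊗ E_{ji}`. -/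
def opP : Matrix (ℤˣ × ℤˣ) (ℤˣ × ℤˣ) ℂ :=
  ∑ i : ℤˣ, ∑ j : ℤˣ, Matrix.single i j (1 : ℂ) ⊗ₖ Matrix.single j i (1 : ℂ)

/-- The operator `Q = ∑ E_{ij}^t ⊗ E_{ji}`, where `E_{ij}^t = θ_{ij} E_{-j,-i}`. -/
def opQ (κ : Kind) : Matrix (ℤˣ × ℤˣ) (ℤˣ × ℤˣ) ℂ :=
  ∑ i : ℤˣ, ∑ j : ℤˣ,
    Matrix.single (-j) (-i) (((theta κ i j : ℤˣ) : ℤ) : ℂ) ⊗ₖ Matrix.single j i (1 : ℂ)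

/-- The normalised antisymmetrizer `A₂ = (1 - P) / 2`. -/
def antisym : Matrix (ℤˣ × ℤˣ) (ℤˣ × ℤˣ) ℂ := (1 / 2 : ℂ) • (1 - opP)

/-- The operator `R^t(c - 2u) = 1 - Q / (c - 2u)`; note `1 / (c - 2u) = X / (c X - 2)`. -/
def matRt (κ : Kind) (c : ℂ) : Matrix (ℤˣ × ℤˣ) (ℤˣ × ℤˣ) (PowerSeries ℂ) :=
  1 - (PowerSeries.X * (PowerSeries.C c * PowerSeries.X - 2)⁻¹ : PowerSeries ℂ) •
    (opQ κ).map PowerSeries.C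

/-- The diagonal matrix `F₁₁ = E₁₁ - E_{-1,-1}`. -/
def matF11 : Matrix ℤˣ ℤˣ ℂ := Matrix.single 1 1 1 - Matrix.single (-1) (-1) 1

/-- Constant matrices as matrices of series over `A`. -/
def constMat [Algebra ℂ A] {J : Type} (M : Matrix J J ℂ) : Matrix J J (PowerSeries A) :=
  M.map fun a => PowerSeries.C (algebraMap ℂ A a)

/-- `σ₁(u, C) = tr (A₂ S₁(u) R^t(3 - 2u) C₂)`. -/
def sigmaOne [Algebra ℂ A] (κ : Kind) (C : Matrix ℤˣ ℤˣ ℂ) (S : Matrix ℤˣ ℤˣ (PowerSeries A)) :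
    PowerSeries A :=
  Matrix.trace (constMat antisym * (S ⊗ₖ (1 : Matrix ℤˣ ℤˣ (PowerSeries A)))
    * (matRt κ 3).map (scalarSeries A) * constMat ((1 : Matrix ℤˣ ℤˣ ℂ) ⊗ₖ C))

/-- `σ₂(u) = tr (A₂ S₁(u) R^t(1 - 2u) S₂(u - 1))`; it does not involve `C`. -/
def sigmaTwo [Algebra ℂ A] (κ : Kind) (S : Matrix ℤˣ ℤˣ (PowerSeries A)) : PowerSeries A :=
  Matrix.trace (constMat antisym * (S ⊗ₖ (1 : Matrix ℤˣ ℤˣ (PowerSeries A)))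
    * (matRt κ 1).map (scalarSeries A) * ((1 : Matrix ℤˣ ℤˣ (PowerSeries A)) ⊗ₖ S.map shiftU))

/-- The Bethe subalgebra `ℬ^∓` of `Y^∓(2)` attached to `C = F₁₁`: it is generated by the
coefficients of the series `σ₁(u, F₁₁)` and `σ₂(u, F₁₁)`. -/
def bethe (κ : Kind) : Subalgebra ℂ (twistedYangian κ) :=
  Algebra.adjoin ℂ
    ((Set.range fun n => PowerSeries.coeff n (sigmaOne κ matF11 (twS κ))) ∪
      Set.range fun n => PowerSeries.coeff n (sigmaTwo κ (twS κ)))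

end Twisted

/-! ### The coideal structure and the modules `L ⊗ W(δ)` -/

section Coideal

lemma theta_mul (κ : Kind) (i b j : ℤˣ) : theta κ i b * theta κ b j = theta κ i j := by
  cases κ
  · simp only [theta]
    rw [mul_assoc, ← mul_assoc b b j, Int.units_mul_self, one_mul]
  · simp [theta]

lemma transposeNeg_mul {A : Type*} [Ring A] (κ : Kind) {S T : Matrix ℤˣ ℤˣ (PowerSeries A)}
    (hST : ∀ i j k l, S i j * T k l = T k l * S i j) :
    transposeNeg κ (S * T) = transposeNeg κ T * transposeNeg κ S := by
  ext i j : 2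
  have h : ∀ b, (theta κ i j : ℤ) • negU (S (-j) b * T b (-i))
      = ((theta κ i (-b) : ℤ) • negU (T (- -b) (-i))) *
        ((theta κ (-b) j : ℤ) • negU (S (-j) (- -b))) := by
    intro b
    rw [neg_neg, hST, negU_mul, smul_mul_smul_comm, ← Units.val_mul, theta_mul]
  simp only [transposeNeg, Matrix.of_apply, Matrix.mul_apply, negU_sum, Finset.smul_sum, h]
  exact congrArg _ <| Equiv.sum_comp (Equiv.neg ℤˣ) fun b : ℤˣ =>
    ((theta κ i b : ℤ) • negU (T (-b) (-i))) * ((theta κ b j : ℤ) • negU (S (-j) (-b)))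

lemma matS_mul {A : Type*} [Ring A] (κ : Kind) {S T : Matrix ℤˣ ℤˣ (PowerSeries A)}
    (hST : ∀ i j k l, S i j * T k l = T k l * S i j) :
    matS κ (S * T) = S * matS κ T * transposeNeg κ S := by
  rw [matS, transposeNeg_mul κ hST, matS]
  simp only [Matrix.mul_assoc]

lemma transposeNeg_map {A B : Type*} [Ring A] [Ring B] (κ : Kind)
    (T : Matrix ℤˣ ℤˣ (PowerSeries A)) (φ : A →+* B) :
    transposeNeg κ (T.map (PowerSeries.map φ)) = (transposeNeg κ T).map (PowerSeries.map φ) := by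
  ext i j n
  simp only [transposeNeg, Matrix.of_apply, Matrix.map_apply, map_zsmul, negU,
    PowerSeries.coeff_map, PowerSeries.coeff_mk, map_mul, map_pow, map_neg, map_one]

lemma matS_map {A B : Type*} [Ring A] [Ring B] (κ : Kind)
    (T : Matrix ℤˣ ℤˣ (PowerSeries A)) (φ : A →+* B) :
    matS κ (T.map (PowerSeries.map φ)) = (matS κ T).map (PowerSeries.map φ) := by
  rw [matS, matS, transposeNeg_map, Matrix.map_mul]

lemma lift_genS {A : Type*} [Ring A] [Algebra ℂ A] (κ : Kind) (T : Matrix ℤˣ ℤˣ (PowerSeries A))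
    (hT : IsYangianMatrix T) (M : ℕ) (i j : ℤˣ) :
    Yangian.lift T hT (genS κ M i j) = PowerSeries.coeff M (matS κ T i j) := by
  have h : T = (matT ℤˣ).map (PowerSeries.map (Yangian.lift T hT : Yangian ℤˣ →+* A)) := by
    ext i j r
    simp [matT, Yangian.lift_genT]
  conv_rhs => rw [h, matS_map]
  simp [genS]

lemma commute_series {A : Type*} [Ring A] {f g : PowerSeries A}
    (h : ∀ r s, Commute (PowerSeries.coeff r f) (PowerSeries.coeff s g)) : f * g = g * f := by
  ext n
  rw [PowerSeries.coeff_mul, PowerSeries.coeff_mul, ← Finset.Nat.sum_antidiagonal_swap]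
  exact Finset.sum_congr rfl fun p _ => (h _ _).eq

variable {n : Type} [Fintype n] [DecidableEq n]

/-- The scalar matrices `End(L) → End(L) ⊗ Y(2)`. -/
def inclEnd (n : Type) [Fintype n] [DecidableEq n] :
    Matrix n n ℂ →ₐ[ℂ] Matrix n n (Yangian ℤˣ) :=
  AlgHom.mapMatrix (Algebra.ofId ℂ (Yangian ℤˣ))

/-- The image in `End(L) ⊗ Y(2)` of `T(u)` acting on `L`. -/
def leftT (ρ : Yangian ℤˣ →ₐ[ℂ] Matrix n n ℂ) :
    Matrix ℤˣ ℤˣ (PowerSeries (Matrix n n (Yangian ℤˣ))) :=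
  (matT ℤˣ).map (PowerSeries.map (((inclEnd n).comp ρ : Yangian ℤˣ →ₐ[ℂ] _) : Yangian ℤˣ →+* _))

/-- The `T`-matrix of the second tensor factor of `End(L) ⊗ Y(2)`. -/
def rightT (n : Type) [Fintype n] [DecidableEq n] :
    Matrix ℤˣ ℤˣ (PowerSeries (Matrix n n (Yangian ℤˣ))) :=
  (matT ℤˣ).map (PowerSeries.map (Matrix.scalar n))

lemma commute_left_right (ρ : Yangian ℤˣ →ₐ[ℂ] Matrix n n ℂ) (r s : ℕ) (i j k l : ℤˣ) :
    Commute (PowerSeries.coeff r (leftT ρ i j)) (PowerSeries.coeff s (rightT n k l)) := by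
  simp only [leftT, rightT, Matrix.map_apply, PowerSeries.coeff_map]
  show _ = _
  ext p q
  rw [Matrix.scalar_apply, Matrix.mul_diagonal, Matrix.diagonal_mul]
  exact Algebra.commutes (A := Yangian ℤˣ)
    (ρ (PowerSeries.coeff r (matT ℤˣ i j)) p q) (PowerSeries.coeff s (matT ℤˣ k l))

lemma isYangianMatrix_leftT_mul_rightT (ρ : Yangian ℤˣ →ₐ[ℂ] Matrix n n ℂ) :
    IsYangianMatrix (leftT ρ * rightT n) :=
  IsYangianMatrix.mul (isYangianMatrix_matT.map _) (isYangianMatrix_matT.map _)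
    fun r s i j k l => commute_left_right ρ r s i j k l

/-- The homomorphism `(ρ ⊗ id) ∘ Δ : Y(2) → End(L) ⊗ Y(2)`, where `End(L) ⊗ Y(2)` is the algebra
of matrices over `Y(2)`: it maps `t_{ij}(u)` to `∑ₐ ρ(t_{ia}(u)) ⊗ t_{aj}(u)`. -/
def coaction (ρ : Yangian ℤˣ →ₐ[ℂ] Matrix n n ℂ) : Yangian ℤˣ →ₐ[ℂ] Matrix n n (Yangian ℤˣ) :=
  Yangian.lift (leftT ρ * rightT n) (isYangianMatrix_leftT_mul_rightT ρ)

lemma coeff_mem_mul {A : Type*} [Ring A] [Algebra ℂ A] (𝓜 : Subalgebra ℂ A)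
    {S T : Matrix ℤˣ ℤˣ (PowerSeries A)} (hS : ∀ r i j, PowerSeries.coeff r (S i j) ∈ 𝓜)
    (hT : ∀ r i j, PowerSeries.coeff r (T i j) ∈ 𝓜) (r : ℕ) (i j : ℤˣ) :
    PowerSeries.coeff r ((S * T) i j) ∈ 𝓜 := by
  simp only [Matrix.mul_apply, map_sum, PowerSeries.coeff_mul]
  exact sum_mem fun a _ => sum_mem fun p _ => mul_mem (hS _ _ _) (hT _ _ _)

/-- The twisted Yangian is a left coideal. -/
lemma coaction_mem (κ : Kind) (ρ : Yangian ℤˣ →ₐ[ℂ] Matrix n n ℂ) (x : Yangian ℤˣ)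
    (hx : x ∈ twistedYangian κ) (p q : n) : coaction ρ x p q ∈ twistedYangian κ := by
  set 𝓜 : Subalgebra ℂ (Matrix n n (Yangian ℤˣ)) := (twistedYangian κ).matrix with h𝓜
  suffices h : twistedYangian κ ≤ 𝓜.comap (coaction ρ) from (h hx) p q
  refine Algebra.adjoin_le ?_
  rintro _ ⟨⟨M, i, j⟩, rfl⟩
  show coaction ρ (genS κ M i j) ∈ 𝓜
  rw [coaction, lift_genS, matS_mul κ fun i j k l =>
    commute_series fun r s => commute_left_right ρ r s i j k l]
  have hL : ∀ r i j, PowerSeries.coeff r (leftT ρ i j) ∈ 𝓜 := by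
    intro r i j p q
    simp only [leftT, Matrix.map_apply, PowerSeries.coeff_map]
    exact (twistedYangian κ).algebraMap_mem _
  refine coeff_mem_mul 𝓜 (coeff_mem_mul 𝓜 hL ?_) ?_ M i j
  · intro r i j p q
    rw [rightT, matS_map, Matrix.map_apply, PowerSeries.coeff_map, Matrix.scalar_apply,
      Matrix.diagonal_apply]
    split_ifs
    · exact (twGen κ r i j).2
    · exact zero_mem _
  · intro r i j
    simp only [transposeNeg, Matrix.of_apply, negU, map_zsmul, PowerSeries.coeff_mk]
    exact zsmul_mem (mul_mem (pow_mem (neg_mem (one_mem _)) _) (hL _ _ _)) _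

/-- The representation of `Y^∓(2)` on `L ⊗ W`, for a `Y(2)`-module `L` given by `ρ` and a
one-dimensional `Y^∓(2)`-module `W` given by the character `w`: it is `(ρ ⊗ w) ∘ Δ`. -/
def tensorCharacter (κ : Kind) (ρ : Yangian ℤˣ →ₐ[ℂ] Matrix n n ℂ)
    (w : twistedYangian κ →ₐ[ℂ] ℂ) : twistedYangian κ →ₐ[ℂ] Matrix n n ℂ where
  toFun x := Matrix.of fun p q => w ⟨coaction ρ x p q, coaction_mem κ ρ x x.2 p q⟩
  map_one' := by
    ext p q
    simp only [Matrix.of_apply, OneMemClass.coe_one, map_one, Matrix.one_apply]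
    split_ifs
    · exact map_one w
    · exact map_zero w
  map_mul' x y := by
    ext p q
    simp only [Matrix.of_apply, Matrix.mul_apply, ← map_mul, ← map_sum]
    congr 1
    ext1
    simp [Matrix.mul_apply]
  map_zero' := by
    ext p q
    simp only [Matrix.of_apply, ZeroMemClass.coe_zero, map_zero, Matrix.zero_apply]
    exact map_zero w
  map_add' x y := by
    ext p q
    simp only [Matrix.of_apply, Matrix.add_apply, ← map_add]
    congr 1
    ext1
    simp
  commutes' c := by
    ext p q
    have h : (⟨coaction ρ (algebraMap ℂ (twistedYangian κ) c) p q,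
        coaction_mem κ ρ _ (algebraMap ℂ (twistedYangian κ) c).2 p q⟩ : twistedYangian κ)
        = if p = q then algebraMap ℂ (twistedYangian κ) c else 0 := by
      ext1
      have : ((algebraMap ℂ (twistedYangian κ) c : twistedYangian κ) : Yangian ℤˣ)
          = algebraMap ℂ (Yangian ℤˣ) c := rfl
      simp only [this, AlgHom.commutes, Matrix.algebraMap_matrix_apply]
      split_ifs <;> rfl
    simp only [Matrix.of_apply, Matrix.algebraMap_matrix_apply, h]
    split_ifs
    · exact w.commutes c
    · exact map_zero w

end Coideal

section Character

/-- `w` is the action of `Y⁺(2)` on its one-dimensional module `W(δ)`: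
`s₁₁(u) ↦ (u + δ) / (u + 1/2)`, `s_{-1,-1}(u) ↦ (u - δ + 1) / (u + 1/2)`, and
`s_{1,-1}(u), s_{-1,1}(u) ↦ 0`. -/
structure IsCharacterW (δ : ℂ) (w : twistedYangian Kind.plus →ₐ[ℂ] ℂ) : Prop where
  pos : PowerSeries.map (w : twistedYangian Kind.plus →+* ℂ) (twS Kind.plus 1 1)
    = (1 + PowerSeries.C δ * PowerSeries.X) * (1 + PowerSeries.C (1 / 2) * PowerSeries.X)⁻¹
  neg : PowerSeries.map (w : twistedYangian Kind.plus →+* ℂ) (twS Kind.plus (-1) (-1))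
    = (1 + PowerSeries.C (1 - δ) * PowerSeries.X) * (1 + PowerSeries.C (1 / 2) * PowerSeries.X)⁻¹
  pos_neg : PowerSeries.map (w : twistedYangian Kind.plus →+* ℂ) (twS Kind.plus 1 (-1)) = 0
  neg_pos : PowerSeries.map (w : twistedYangian Kind.plus →+* ℂ) (twS Kind.plus (-1) 1) = 0

/-! The module `W(δ)` exists: up to a scalar series it is spanned by the highest weight vector of
the `gl₂`-Verma module of highest weight `(δ - 1, -1/2)`. -/

/-- Operators `v_n ↦ c_n v_n` on sequences. -/
def seqDiag (c : ℕ → ℂ) : Module.End ℂ (ℕ → ℂ) where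
  toFun g n := c n * g n
  map_add' x y := by funext n; simp [mul_add]
  map_smul' r x := by funext n; simp; ring

/-- The weighted backward shift. -/
def seqE (c : ℕ → ℂ) : Module.End ℂ (ℕ → ℂ) where
  toFun g n := c n * g (n + 1)
  map_add' x y := by funext n; simp [mul_add]
  map_smul' r x := by funext n; simp; ring

/-- The forward shift. -/
def seqF : Module.End ℂ (ℕ → ℂ) where
  toFun g n := if n = 0 then 0 else g (n - 1)
  map_add' x y := by funext n; by_cases h : n = 0 <;> simp [h]
  map_smul' r x := by funext n; by_cases h : n = 0 <;> simp [h]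

/-- The operators `E_{ij}` on the Verma module. -/
def vermaE (α β : ℂ) : Matrix ℤˣ ℤˣ (Module.End ℂ (ℕ → ℂ)) :=
  glMatrix (seqDiag fun n => α - n) (seqE fun n => ((n : ℂ) + 1) * (α - β - n)) seqF
    (seqDiag fun n => β + n)

lemma isYangianMatrix_verma (α β : ℂ) : IsYangianMatrix (evalMatrix (vermaE α β)) := by
  refine isYangianMatrix_glMatrix _ _ _ _ ?_ ?_ ?_ ?_ ?_ ?_ <;>
    refine LinearMap.ext fun g => funext fun n => ?_ <;> rcases n with _ | n <;>
    simp [seqDiag, seqE, seqF] <;> ring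

/-- The highest weight vector. -/
def vac : ℕ → ℂ := Pi.single 0 1

/-- Each coefficient of `F` acts on the highest weight vector by the corresponding coefficient
of `c`. -/
def HasEig (F : PowerSeries (Module.End ℂ (ℕ → ℂ))) (c : PowerSeries ℂ) : Prop :=
  ∀ n, PowerSeries.coeff n F vac = PowerSeries.coeff n c • vac

lemma HasEig.mul_scalar {F : PowerSeries (Module.End ℂ (ℕ → ℂ))} {c : PowerSeries ℂ}
    (h : HasEig F c) (g : PowerSeries ℂ) : HasEig (scalarSeries _ g * F) (g * c) := by
  intro n
  simp only [PowerSeries.coeff_mul, LinearMap.sum_apply, Finset.sum_smul]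
  refine Finset.sum_congr rfl fun p _ => ?_
  simp only [scalarSeries, PowerSeries.coeff_map, Module.End.mul_apply, h p.2, map_smul,
    Module.algebraMap_end_apply, mul_smul]
  exact smul_comm _ _ _

lemma HasEig.add {F G : PowerSeries (Module.End ℂ (ℕ → ℂ))} {c e : PowerSeries ℂ}
    (h : HasEig F c) (h' : HasEig G e) : HasEig (F + G) (c + e) := by
  intro n
  simp [h n, h' n, add_smul]

lemma coeff_lin_mul_lin {A : Type*} [Ring A] (x y p q : A) (n : ℕ) :
    PowerSeries.coeff n ((PowerSeries.C x + PowerSeries.C y * PowerSeries.X)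
        * (PowerSeries.C p + PowerSeries.C q * PowerSeries.X))
      = if n = 0 then x * p else if n = 1 then x * q + y * p else if n = 2 then y * q else 0 := by
  have h : (PowerSeries.C x + PowerSeries.C y * PowerSeries.X)
        * (PowerSeries.C p + PowerSeries.C q * PowerSeries.X)
      = PowerSeries.C (x * p) + PowerSeries.C (x * q + y * p) * PowerSeries.X
        + PowerSeries.C (y * q) * PowerSeries.X ^ 2 := by
    have hX : ∀ z : A, PowerSeries.X * PowerSeries.C z = PowerSeries.C z * PowerSeries.X :=
      fun z => (PowerSeries.commute_X _).symm.eq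
    simp only [add_mul, mul_add, map_add, map_mul, pow_two]
    simp only [mul_assoc, hX]
    simp only [← mul_assoc (PowerSeries.X) (PowerSeries.C _), hX]
    simp only [mul_assoc]
    abel
  rw [h]
  simp only [map_add (PowerSeries.coeff n), PowerSeries.coeff_C_mul, PowerSeries.coeff_C,
    PowerSeries.coeff_X, PowerSeries.coeff_X_pow]
  rcases n with _ | _ | _ | n <;> simp

lemma negU_lin {A : Type*} [Ring A] (p q : A) :
    negU (PowerSeries.C p + PowerSeries.C q * PowerSeries.X)
      = PowerSeries.C p + PowerSeries.C (-q) * PowerSeries.X := by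
  ext n
  rcases n with _ | _ | n <;>
    simp [negU, PowerSeries.coeff_X]

lemma hasEig_lin {x y p q x' y' p' q' : Module.End ℂ (ℕ → ℂ)} {c₀ c₁ c₂ : ℂ}
    (h0 : (x * p + x' * p') vac = c₀ • vac)
    (h1 : (x * q + y * p + (x' * q' + y' * p')) vac = c₁ • vac)
    (h2 : (y * q + y' * q') vac = c₂ • vac) :
    HasEig ((PowerSeries.C x + PowerSeries.C y * PowerSeries.X)
        * (PowerSeries.C p + PowerSeries.C q * PowerSeries.X)
        + (PowerSeries.C x' + PowerSeries.C y' * PowerSeries.X)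
        * (PowerSeries.C p' + PowerSeries.C q' * PowerSeries.X))
      (PowerSeries.C c₀ + PowerSeries.C c₁ * PowerSeries.X
        + PowerSeries.C c₂ * PowerSeries.X ^ 2) := by
  intro n
  rw [map_add, coeff_lin_mul_lin, coeff_lin_mul_lin]
  simp only [map_add (PowerSeries.coeff n), PowerSeries.coeff_C_mul, PowerSeries.coeff_C,
    PowerSeries.coeff_X, PowerSeries.coeff_X_pow]
  rcases n with _ | _ | _ | n
  · simpa using h0
  · simpa using h1
  · simpa using h2
  · simp

lemma sum_units {M : Type*} [AddCommMonoid M] (f : ℤˣ → M) : ∑ c, f c = f 1 + f (-1) := by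
  rw [UnitsInt.univ, Finset.sum_pair (by decide)]

lemma matS_plus_apply {A : Type*} [Ring A] (T : Matrix ℤˣ ℤˣ (PowerSeries A)) (i j : ℤˣ) :
    matS Kind.plus T i j = T i 1 * negU (T (-j) (-1)) + T i (-1) * negU (T (-j) 1) := by
  rw [matS, Matrix.mul_apply, sum_units]
  simp [transposeNeg, theta]

lemma hasEig_verma (δ : ℂ) :
    HasEig (matS Kind.plus (evalMatrix (vermaE (δ - 1) (-1 / 2))) 1 1)
      ((1 + PowerSeries.C δ * PowerSeries.X) * (1 - PowerSeries.C (1 / 2) * PowerSeries.X)) ∧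
    HasEig (matS Kind.plus (evalMatrix (vermaE (δ - 1) (-1 / 2))) (-1) (-1))
      ((1 + PowerSeries.C (1 - δ) * PowerSeries.X) *
        (1 - PowerSeries.C (1 / 2) * PowerSeries.X)) ∧
    HasEig (matS Kind.plus (evalMatrix (vermaE (δ - 1) (-1 / 2))) 1 (-1)) 0 ∧
    HasEig (matS Kind.plus (evalMatrix (vermaE (δ - 1) (-1 / 2))) (-1) 1) 0 := by
  have hv : ∀ {F} {c e : PowerSeries ℂ}, HasEig F c → c = e → HasEig F e := by
    rintro F c _ h rfl
    exact h
  have hvac : ∀ n, vac n = if n = 0 then 1 else 0 := by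
    intro n
    simp [vac, Pi.single_apply]
  simp only [matS_plus_apply, neg_neg, evalMatrix, Matrix.of_apply, negU_lin, vermaE, glMatrix]
  refine ⟨?_, ?_, ?_, ?_⟩
  · refine hv (hasEig_lin (c₀ := 1) (c₁ := δ - 1 / 2) (c₂ := -(δ * (1 / 2))) ?_ ?_ ?_) ?_
    · funext n; simp
    · funext n; rcases n with _ | n <;> simp [seqDiag, seqE, seqF, hvac]; ring
    · funext n; rcases n with _ | n <;> simp [seqDiag, seqE, seqF, hvac]; ring
    · simp only [map_neg, map_mul, map_sub, map_one]
      ring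
  · refine hv (hasEig_lin (c₀ := 1) (c₁ := 1 - δ - 1 / 2) (c₂ := -((1 - δ) * (1 / 2))) ?_ ?_ ?_) ?_
    · funext n; simp
    · funext n; rcases n with _ | n <;> simp [seqDiag, seqE, seqF, hvac]; ring
    · funext n; rcases n with _ | n <;> simp [seqDiag, seqE, seqF, hvac]; ring
    · simp only [map_neg, map_mul, map_sub, map_one]
      ring
  · refine hv (hasEig_lin (c₀ := 0) (c₁ := 0) (c₂ := 0) ?_ ?_ ?_) (by simp)
    · funext n; simp
    · funext n; rcases n with _ | n <;> simp [seqDiag, seqE, seqF, hvac]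
    · funext n; rcases n with _ | n <;> simp [seqDiag, seqE, seqF, hvac]
  · refine hv (hasEig_lin (c₀ := 0) (c₁ := 0) (c₂ := 0) ?_ ?_ ?_) (by simp)
    · funext n; simp
    · funext n; rcases n with _ | n <;> simp [seqDiag, seqE, seqF, hvac]
    · funext n; rcases n with _ | _ | n <;> simp [seqDiag, seqE, seqF, hvac]; ring

/-- The twist of the Verma module by the scalar series `(1 - u⁻¹ / 2)⁻¹`. -/
def twistSeries : PowerSeries ℂ := (1 - PowerSeries.C (1 / 2) * PowerSeries.X)⁻¹

/-- `T(u)` acting on the twisted Verma module. -/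
def vermaT (δ : ℂ) : Matrix ℤˣ ℤˣ (PowerSeries (Module.End ℂ (ℕ → ℂ))) :=
  Matrix.scalar ℤˣ (scalarSeries _ twistSeries) * evalMatrix (vermaE (δ - 1) (-1 / 2))

lemma scalarSeries_comm {A : Type*} [Ring A] [Algebra ℂ A] (g : PowerSeries ℂ)
    (F : PowerSeries A) : scalarSeries A g * F = F * scalarSeries A g :=
  commute_series fun r s => by
    rw [scalarSeries, PowerSeries.coeff_map]
    exact Algebra.commutes _ _

lemma isYangianMatrix_scalar {A : Type*} [Ring A] [Algebra ℂ A] (g : PowerSeries ℂ)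
    (hg : PowerSeries.coeff 0 g = 1) :
    IsYangianMatrix (Matrix.scalar ℤˣ (scalarSeries A g)) where
  zero i j := by
    rw [Matrix.scalar_apply, Matrix.diagonal_apply]
    split_ifs
    · rw [scalarSeries, PowerSeries.coeff_map, hg, map_one]
    · exact map_zero _
  comm r s i j k l := by
    have h : ∀ r (i j : ℤˣ), PowerSeries.coeff r (Matrix.scalar ℤˣ (scalarSeries A g) i j)
        = algebraMap ℂ A (if i = j then PowerSeries.coeff r g else 0) := by
      intro r i j
      rw [Matrix.scalar_apply, Matrix.diagonal_apply]
      split_ifs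
      · rw [scalarSeries, PowerSeries.coeff_map]
      · rw [map_zero, map_zero]
    simp only [h, ← map_mul, ← map_sub]
    congr 1
    split_ifs <;> ring

lemma constantCoeff_twist (c : ℂ) :
    PowerSeries.constantCoeff (1 - PowerSeries.C c * PowerSeries.X) ≠ 0 := by
  simp

lemma isYangianMatrix_vermaT (δ : ℂ) : IsYangianMatrix (vermaT δ) := by
  refine (isYangianMatrix_scalar _ ?_).mul (isYangianMatrix_verma _ _) fun r s i j k l => ?_
  · simp [twistSeries]
  · rw [Matrix.scalar_apply, Matrix.diagonal_apply]
    split_ifs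
    · rw [scalarSeries, PowerSeries.coeff_map]
      exact Algebra.commutes _ _
    · rw [map_zero]
      exact Commute.zero_left _

lemma negU_twist : negU twistSeries = (1 + PowerSeries.C (1 / 2) * PowerSeries.X)⁻¹ := by
  rw [PowerSeries.eq_inv_iff_mul_eq_one (by simp)]
  have h : (1 + PowerSeries.C (1 / 2) * PowerSeries.X : PowerSeries ℂ)
      = negU (1 - PowerSeries.C (1 / 2) * PowerSeries.X) := by
    have := negU_lin (1 : ℂ) (-(1 / 2))
    rw [neg_neg, map_neg, map_one, neg_mul, ← sub_eq_add_neg] at this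
    exact this.symm
  rw [h, ← negU_mul, twistSeries, PowerSeries.inv_mul_cancel _ (constantCoeff_twist _)]
  ext n
  by_cases hn : n = 0 <;> simp [negU, PowerSeries.coeff_one, hn]

lemma matS_vermaT (δ : ℂ) (i j : ℤˣ) :
    matS Kind.plus (vermaT δ) i j = scalarSeries _ (twistSeries * negU twistSeries) *
      matS Kind.plus (evalMatrix (vermaE (δ - 1) (-1 / 2))) i j := by
  have hn : negU (scalarSeries (Module.End ℂ (ℕ → ℂ)) twistSeries)
      = scalarSeries _ (negU twistSeries) := by
    ext1 n
    simp only [negU, scalarSeries, PowerSeries.coeff_map, PowerSeries.coeff_mk, map_mul, map_pow,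
      map_neg, map_one]
  rw [matS_plus_apply, matS_plus_apply]
  simp only [vermaT, Matrix.scalar_apply, Matrix.diagonal_mul, negU_mul, hn, map_mul]
  simp only [mul_assoc, mul_add]
  simp only [← mul_assoc (evalMatrix _ _ _) (scalarSeries _ _), ← scalarSeries_comm]
  simp only [mul_assoc]

lemma twist_calc (c : PowerSeries ℂ) :
    twistSeries * negU twistSeries * (c * (1 - PowerSeries.C (1 / 2) * PowerSeries.X))
      = c * (1 + PowerSeries.C (1 / 2) * PowerSeries.X)⁻¹ := by
  have h : twistSeries * (1 - PowerSeries.C (1 / 2) * PowerSeries.X) = 1 := by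
    rw [twistSeries, PowerSeries.inv_mul_cancel _ (constantCoeff_twist _)]
  rw [negU_twist]
  linear_combination c * (1 + PowerSeries.C (1 / 2) * PowerSeries.X)⁻¹ * h

/-- The one-dimensional module `W(δ)` over `Y⁺(2)` exists and is unique. -/
theorem existsUnique_characterW (δ : ℂ) :
    ∃! w : twistedYangian Kind.plus →ₐ[ℂ] ℂ, IsCharacterW δ w := by
  set ρ := Yangian.lift (vermaT δ) (isYangianMatrix_vermaT δ) with hρ
  obtain ⟨h1, h2, h3, h4⟩ := hasEig_verma δ
  have k1 : HasEig (matS Kind.plus (vermaT δ) 1 1)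
      ((1 + PowerSeries.C δ * PowerSeries.X) * (1 + PowerSeries.C (1 / 2) * PowerSeries.X)⁻¹) := by
    rw [matS_vermaT, ← twist_calc]
    exact h1.mul_scalar _
  have k2 : HasEig (matS Kind.plus (vermaT δ) (-1) (-1))
      ((1 + PowerSeries.C (1 - δ) * PowerSeries.X) *
        (1 + PowerSeries.C (1 / 2) * PowerSeries.X)⁻¹) := by
    rw [matS_vermaT, ← twist_calc]
    exact h2.mul_scalar _
  have k3 : HasEig (matS Kind.plus (vermaT δ) 1 (-1)) 0 := by
    rw [matS_vermaT, ← mul_zero (twistSeries * negU twistSeries)]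
    exact h3.mul_scalar _
  have k4 : HasEig (matS Kind.plus (vermaT δ) (-1) 1) 0 := by
    rw [matS_vermaT, ← mul_zero (twistSeries * negU twistSeries)]
    exact h4.mul_scalar _
  have hstab : ∀ x : twistedYangian Kind.plus, ∃ c : ℂ, ρ x vac = c • vac := by
    rintro ⟨x, hx⟩
    refine Algebra.adjoin_induction (p := fun x _ => ∃ c : ℂ, ρ x vac = c • vac)
      ?_ ?_ ?_ ?_ hx
    · rintro _ ⟨⟨M, i, j⟩, rfl⟩
      simp only [hρ, lift_genS]
      rcases units_cases i with rfl | rfl <;> rcases units_cases j with rfl | rfl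
      · exact ⟨_, k1 M⟩
      · exact ⟨_, k3 M⟩
      · exact ⟨_, k4 M⟩
      · exact ⟨_, k2 M⟩
    · intro c
      exact ⟨c, by rw [AlgHom.commutes, Module.algebraMap_end_apply]⟩
    · rintro x y _ _ ⟨c, hc⟩ ⟨e, he⟩
      exact ⟨c + e, by rw [map_add, LinearMap.add_apply, hc, he, add_smul]⟩
    · rintro x y _ _ ⟨c, hc⟩ ⟨e, he⟩
      exact ⟨e * c, by rw [map_mul, Module.End.mul_apply, he, map_smul, hc, smul_smul]⟩
  have hvac : vac 0 = 1 := by simp [vac]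
  let w : twistedYangian Kind.plus →ₐ[ℂ] ℂ :=
    { toFun := fun x => ρ x vac 0
      map_one' := by simp [hvac]
      map_zero' := by simp
      map_add' := fun x y => by simp
      map_mul' := fun x y => by
        obtain ⟨c, hc⟩ := hstab x
        obtain ⟨e, he⟩ := hstab y
        simp only [MulMemClass.coe_mul, map_mul, Module.End.mul_apply, he, map_smul, hc,
          Pi.smul_apply, smul_eq_mul, hvac]
        ring
      commutes' := fun c => by
        have : ((algebraMap ℂ (twistedYangian Kind.plus) c : twistedYangian Kind.plus) :
          Yangian ℤˣ) = algebraMap ℂ (Yangian ℤˣ) c := rfl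
        simp only [this, AlgHom.commutes, Module.algebraMap_end_apply, Pi.smul_apply, smul_eq_mul,
          hvac, mul_one, Algebra.algebraMap_self, RingHom.id_apply] }
  have hw : ∀ i j c, HasEig (matS Kind.plus (vermaT δ) i j) c →
      PowerSeries.map (w : twistedYangian Kind.plus →+* ℂ) (twS Kind.plus i j) = c := by
    intro i j c h
    ext M
    have e1 : PowerSeries.coeff M (PowerSeries.map (w : twistedYangian Kind.plus →+* ℂ)
        (twS Kind.plus i j)) = ρ (genS Kind.plus M i j) vac 0 := by
      rw [PowerSeries.coeff_map, twS, Matrix.of_apply, PowerSeries.coeff_mk]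
      rfl
    rw [e1, hρ, lift_genS, h M, Pi.smul_apply, hvac, smul_eq_mul, mul_one]
  refine ⟨w, ⟨hw _ _ _ k1, hw _ _ _ k2, hw _ _ _ k3, hw _ _ _ k4⟩, fun w' hw' => ?_⟩
  have hgen : ∀ x ∈ (Set.range fun x : ℕ × ℤˣ × ℤˣ => genS Kind.plus x.1 x.2.1 x.2.2),
      ∀ hx, w' ⟨x, hx⟩ = w ⟨x, hx⟩ := by
    rintro _ ⟨⟨M, i, j⟩, rfl⟩ hx
    have e : ∀ v : twistedYangian Kind.plus →ₐ[ℂ] ℂ, v ⟨genS Kind.plus M i j, hx⟩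
        = PowerSeries.coeff M (PowerSeries.map (v : twistedYangian Kind.plus →+* ℂ)
          (twS Kind.plus i j)) := by
      intro v
      rw [PowerSeries.coeff_map, twS, Matrix.of_apply, PowerSeries.coeff_mk]
      rfl
    show w' ⟨genS Kind.plus M i j, hx⟩ = w ⟨genS Kind.plus M i j, hx⟩
    rw [e, e]
    rcases units_cases i with rfl | rfl <;> rcases units_cases j with rfl | rfl
    · rw [hw'.pos, hw _ _ _ k1]
    · rw [hw'.pos_neg, hw _ _ _ k3]
    · rw [hw'.neg_pos, hw _ _ _ k4]
    · rw [hw'.neg, hw _ _ _ k2]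
  exact AlgHom.adjoin_ext fun x hx => hgen x hx _

/-- The one-dimensional module `W(δ)` over `Y⁺(2)`, as a character of `Y⁺(2)`. -/
def characterW (δ : ℂ) : twistedYangian Kind.plus →ₐ[ℂ] ℂ :=
  (existsUnique_characterW δ).choose

lemma isCharacterW_characterW (δ : ℂ) : IsCharacterW δ (characterW δ) :=
  (existsUnique_characterW δ).choose_spec.1

end Character

/-! ### Images of the Bethe subalgebras and their limits -/

section Limit

variable {k : ℕ}

/-- The image of `ℬ⁻` in `End(L(α₁,β₁) ⊗ ⋯ ⊗ L(α_k,β_k))`, where `α_i - β_i = d_i`. -/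
def imageBetheMinus (d : Fin k → ℕ) (α β : Fin k → ℂ) : Subalgebra ℂ (EndTensor d) :=
  (bethe Kind.minus).map ((tensorRep d α β).comp (twistedYangian Kind.minus).val)

/-- The image of `ℬ⁺` in `End(L(α₁,β₁) ⊗ ⋯ ⊗ L(α_k,β_k) ⊗ W(δ))`, where `α_i - β_i = d_i`. -/
def imageBethePlus (d : Fin k → ℕ) (α β : Fin k → ℂ) (δ : ℂ) : Subalgebra ℂ (EndTensor d) :=
  (bethe Kind.plus).map (tensorCharacter Kind.plus (tensorRep d α β) (characterW δ))

/-- Convergence of a family of finite-dimensional subspaces `B t` to the subspace `A` in the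
Grassmannian: suitable bases of `B t` converge to a basis of `A`. -/
def GrassmannTendsto {τ V : Type*} [AddCommGroup V] [Module ℂ V] [TopologicalSpace V]
    (B : τ → Submodule ℂ V) (l : Filter τ) (A : Submodule ℂ V) : Prop :=
  ∃ (r : ℕ) (b : τ → Fin r → V) (a : Fin r → V),
    (LinearIndependent ℂ a ∧ Submodule.span ℂ (Set.range a) = A) ∧
    (∀ᶠ t in l, LinearIndependent ℂ (b t) ∧ Submodule.span ℂ (Set.range (b t)) = B t) ∧
    ∀ i, Filter.Tendsto (fun t => b t i) l (nhds (a i))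

end Limit

end

end TwistedBethe

/-! Two facts about the images `B t` of the Bethe subalgebra determine the limit: each `B t` is
commutative, and the operators `h^{(i)}` are limits of elements of `B t`.

Why they suffice. The `h^{(i)}` are diagonal in the weight basis and their joint eigenvalues
separate the basis vectors, so they generate all diagonal matrices. Hence there are `b p t ∈ B t`
that tend to the diagonal matrix units. For large `t` the vectors obtained by applying the `b p t`
to the all-ones vector form a basis, so that vector is cyclic for `B t`. In a commutative algebra,
an element that kills a cyclic vector is zero. Therefore the `b p t` are a basis of `B t`, and it
converges to a basis of the diagonal algebra (`grassmannTendsto_of_diagonal`).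

Commutativity. Up to a scalar series, `S(u)` acts as `T(u) K(u) T^t(-u)`, where `T` is a product of
Lax matrices and `K` is diagonal: `K = 1` in the symplectic case, and `K = 1 + u⁻¹/2 + (δ - 1/2) u⁻¹
F₁₁` in the orthogonal case. The RTT relation for `T` and the reflection equation for `K` give the
reflection equation for `S` (`IsGlFamily.reflection`). A combination of its entries shows that the
coefficients of `s₁₁(u) - s_{-1,-1}(u)` commute (`commute_coeff_diffS`). The series `σ₁` is an
invertible scalar series times this difference (`sigmaOne_eq`). The series `σ₂` is scalar
(`commute_coeff_sigmaTwo`), because at `v = u - 1` the R-matrix degenerates to a multiple of the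
antisymmetrizer and `σ₂` becomes a Sklyanin determinant (`IsGlFamily.sdet`).

Limits. Replace `u` by `tu`. Each Lax matrix becomes `(1 + u_i u⁻¹) + t⁻¹ E_i u⁻¹`, with scalar
leading term, so the leading term of `s₁₁ - s_{-1,-1}` vanishes. Its `t⁻¹`-term is `2u⁻¹ ∑ h^{(i)}
∏_{j≠i} (1 - u_j² u⁻²)` plus a scalar series (`hasExp_diffS`). As the `u_i²` are distinct, Lagrange
interpolation in `u²` isolates each `h^{(i)}` (`diffS_mem_of_coeff_mem`). -/

namespace TwistedBethe

noncomputable section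

/-! ### Limits of commutative subalgebras -/

section LimitLemma

open Filter Topology

variable {n τ : Type*} [Fintype n] [DecidableEq n]

/-- The limits of convergent families of elements of the subalgebras `B t`. -/
def limitSubalgebra (B : τ → Subalgebra ℂ (Matrix n n ℂ)) (l : Filter τ) :
    Subalgebra ℂ (Matrix n n ℂ) where
  carrier := {x | ∃ g : τ → Matrix n n ℂ, (∀ t, g t ∈ B t) ∧ Tendsto g l (𝓝 x)}
  mul_mem' := by
    rintro x y ⟨f, hf, hf'⟩ ⟨g, hg, hg'⟩
    exact ⟨fun t => f t * g t, fun t => mul_mem (hf t) (hg t), hf'.mul hg'⟩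
  add_mem' := by
    rintro x y ⟨f, hf, hf'⟩ ⟨g, hg, hg'⟩
    exact ⟨fun t => f t + g t, fun t => add_mem (hf t) (hg t), hf'.add hg'⟩
  algebraMap_mem' c := ⟨fun _ => algebraMap ℂ _ c, fun t => (B t).algebraMap_mem c,
    tendsto_const_nhds⟩

lemma mem_limitSubalgebra {B : τ → Subalgebra ℂ (Matrix n n ℂ)} {l : Filter τ}
    {x : Matrix n n ℂ} : x ∈ limitSubalgebra B l ↔
      ∃ g : τ → Matrix n n ℂ, (∀ t, g t ∈ B t) ∧ Tendsto g l (𝓝 x) := Iff.rfl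

/-- A family of functions that separates the points of a finite set generates the algebra of
all functions. -/
lemma adjoin_eq_top_of_separates {ι : Type*} (c : ι → n → ℂ)
    (hc : ∀ p q, (∀ i, c i p = c i q) → p = q) :
    Algebra.adjoin ℂ (Set.range c) = ⊤ := by
  have hs : ∀ p, Pi.single p (1 : ℂ) ∈ Algebra.adjoin ℂ (Set.range c) := by
    intro p
    -- For each `q` a separating function, normalised affinely, gives a factor equal to 1 at `p` and
    -- 0 at `q`; the product of these factors is the indicator of `p`.
    have hq : ∀ q : n, ∃ f ∈ Algebra.adjoin ℂ (Set.range c), f p = 1 ∧ (q ≠ p → f q = 0) := by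
      intro q
      by_cases hqp : q = p
      · exact ⟨1, one_mem _, rfl, fun h => absurd hqp h⟩
      · obtain ⟨i, hi⟩ : ∃ i, c i p ≠ c i q := by
          by_contra! h
          exact hqp (hc p q h).symm
        refine ⟨(c i p - c i q)⁻¹ • (c i - algebraMap ℂ (n → ℂ) (c i q)),
          Subalgebra.smul_mem _ (sub_mem (Algebra.subset_adjoin (Set.mem_range_self i))
            (Subalgebra.algebraMap_mem _ _)) _, ?_, fun _ => ?_⟩
        · simp [inv_mul_cancel₀ (sub_ne_zero.2 hi)]
        · simp
    choose f hf hf1 hf0 using hq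
    have : Pi.single p (1 : ℂ) = ∏ q, f q := by
      funext r
      rw [Finset.prod_apply]
      by_cases hr : r = p
      · subst hr
        simp [hf1]
      · rw [Pi.single_eq_of_ne hr]
        exact (Finset.prod_eq_zero (f := fun q => f q r) (Finset.mem_univ r) (hf0 r hr)).symm
    rw [this]
    exact prod_mem fun q _ => hf q
  refine eq_top_iff.2 fun g _ => ?_
  have : g = ∑ p, g p • Pi.single p (1 : ℂ) := by
    funext r
    simp [Finset.sum_apply, Pi.single_apply]
  rw [this]
  exact sum_mem fun p _ => Subalgebra.smul_mem _ (hs p) _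

/-- If commutative subalgebras `B t` contain elements that converge to diagonal matrices with
separating joint spectrum, then `B t` converges to the algebra of diagonal matrices. -/
theorem grassmannTendsto_of_diagonal {ι : Type*} (c : ι → n → ℂ)
    (hc : ∀ p q, (∀ i, c i p = c i q) → p = q)
    (B : τ → Subalgebra ℂ (Matrix n n ℂ)) (l : Filter τ)
    (hcomm : ∀ t, ∀ x ∈ B t, ∀ y ∈ B t, x * y = y * x)
    (hlim : ∀ i, Matrix.diagonal (c i) ∈ limitSubalgebra B l) :
    GrassmannTendsto (fun t => Subalgebra.toSubmodule (B t)) l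
      (Subalgebra.toSubmodule
        (Algebra.adjoin ℂ (Set.range fun i => Matrix.diagonal (c i)))) := by
  have hadj : Algebra.adjoin ℂ (Set.range fun i => Matrix.diagonal (c i))
      = (Matrix.diagonalAlgHom ℂ : (n → ℂ) →ₐ[ℂ] Matrix n n ℂ).range := by
    rw [← Algebra.map_top, ← adjoin_eq_top_of_separates c hc, AlgHom.map_adjoin, ← Set.range_comp]
    rfl
  have hle : Algebra.adjoin ℂ (Set.range fun i => Matrix.diagonal (c i)) ≤ limitSubalgebra B l :=
    Algebra.adjoin_le (by rintro _ ⟨i, rfl⟩; exact hlim i)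
  have hε : ∀ p : n, Matrix.diagonal (Pi.single p (1 : ℂ)) ∈ limitSubalgebra B l := fun p =>
    hle (by rw [hadj]; exact ⟨Pi.single p 1, rfl⟩)
  choose b hb hbt using fun p => mem_limitSubalgebra.1 (hε p)
  set e := (Fintype.equivFin n).symm
  have hfun : (fun p : n => Matrix.diagonal (Pi.single p (1 : ℂ)))
      = (Matrix.diagonalAlgHom ℂ : (n → ℂ) →ₐ[ℂ] Matrix n n ℂ).toLinearMap ∘ Pi.basisFun ℂ n := by
    funext p
    simp
  have hind : LinearIndependent ℂ fun p : n => Matrix.diagonal (Pi.single p (1 : ℂ)) := by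
    rw [hfun]
    exact (Pi.basisFun ℂ n).linearIndependent.map' _
      (LinearMap.ker_eq_bot.2 Matrix.diagonal_injective)
  have hspan : Submodule.span ℂ (Set.range fun p : n => Matrix.diagonal (Pi.single p (1 : ℂ)))
      = Subalgebra.toSubmodule
        (Algebra.adjoin ℂ (Set.range fun i => Matrix.diagonal (c i))) := by
    rw [hadj, hfun, Set.range_comp, ← Submodule.map_span, (Pi.basisFun ℂ n).span_eq,
      Submodule.map_top]
    rfl
  -- the matrix whose columns are the vectors `b p t *ᵥ 1`
  let N : τ → Matrix n n ℂ := fun t => Matrix.of fun q p => (b p t).mulVec 1 q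
  -- In the limit `b p t` becomes the `p`-th diagonal matrix unit, which sends the all-ones vector
  -- to the `p`-th basis vector; so `N` tends to the identity and is eventually invertible.
  have hN : Tendsto N l (𝓝 1) := by
    refine tendsto_pi_nhds.2 fun q => tendsto_pi_nhds.2 fun p => ?_
    have h1 : Tendsto (fun t => ∑ r, b p t q r) l
        (𝓝 (∑ r, Matrix.diagonal (Pi.single p (1 : ℂ)) q r)) :=
      tendsto_finsetSum _ fun r _ =>
        (tendsto_pi_nhds.1 (tendsto_pi_nhds.1 (hbt p) q) r)
    have h2 : ∑ r, Matrix.diagonal (Pi.single p (1 : ℂ)) q r = (1 : Matrix n n ℂ) q p := by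
      simp [Matrix.diagonal_apply, Pi.single_apply, Matrix.one_apply]
    rw [h2] at h1
    simpa [N, Matrix.mulVec, dotProduct] using h1
  have hdet : ∀ᶠ t in l, IsUnit (N t) := by
    have h1 : Tendsto (fun t => (N t).det) l (𝓝 (1 : Matrix n n ℂ).det) :=
      (Continuous.matrix_det continuous_id).continuousAt.tendsto.comp hN
    rw [Matrix.det_one] at h1
    filter_upwards [h1.eventually_ne one_ne_zero] with t ht
    rw [Matrix.isUnit_iff_isUnit_det]
    exact isUnit_iff_ne_zero.2 ht
  refine ⟨Fintype.card n, fun t i => b (e i) t, fun i => Matrix.diagonal (Pi.single (e i) 1),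
    ⟨hind.comp e e.injective, ?_⟩, ?_, fun i => hbt (e i)⟩
  · rw [← hspan, ← e.surjective.range_comp fun p : n => Matrix.diagonal (Pi.single p (1 : ℂ))]
    rfl
  · filter_upwards [hdet] with t ht
    have key : ∀ w : n → ℂ, (∑ p, w p • b p t).mulVec 1 = (N t).mulVec w := by
      intro w
      funext q
      rw [Matrix.sum_mulVec, Finset.sum_apply, Matrix.mulVec, dotProduct]
      refine Finset.sum_congr rfl fun p _ => ?_
      rw [Matrix.smul_mulVec, Pi.smul_apply, smul_eq_mul, mul_comm]
      rfl
    have hli : LinearIndependent ℂ fun p => b p t := by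
      rw [Fintype.linearIndependent_iff]
      intro w hw
      have h0 : (N t).mulVec w = (N t).mulVec 0 := by
        rw [← key, hw, Matrix.zero_mulVec, Matrix.mulVec_zero]
      have := Matrix.mulVec_injective_of_isUnit ht h0
      exact fun p => congrFun this p
    refine ⟨hli.comp e e.injective, ?_⟩
    rw [show (fun i => b (e i) t) = (fun p => b p t) ∘ e from rfl, e.surjective.range_comp]
    refine le_antisymm (Submodule.span_le.2 ?_) fun x hx => ?_
    · rintro _ ⟨p, rfl⟩
      exact hb p t
    -- The coefficients `w` make the combination of the `b p t` agree with `x` on the all-ones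
    -- vector.
    · obtain ⟨w, hw⟩ := (Matrix.mulVec_surjective_iff_isUnit.2 ht) (x.mulVec 1)
      -- The all-ones vector is cyclic for `B t`: every basis vector is `z 1` with `z ∈ B t`, and `y
      -- z 1 = z y 1 = 0` by commutativity.
      have hy : ∀ y ∈ B t, y.mulVec (1 : n → ℂ) = 0 → y = 0 := by
        intro y hyB hy
        ext q r
        obtain ⟨w', hw'⟩ := (Matrix.mulVec_surjective_iff_isUnit.2 ht) (Pi.single r 1)
        have hz : (∑ p, w' p • b p t) ∈ B t :=
          sum_mem fun p _ => Subalgebra.smul_mem _ (hb p t) _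
        have h1 : y.mulVec ((∑ p, w' p • b p t).mulVec 1) = 0 := by
          rw [Matrix.mulVec_mulVec, hcomm t _ hyB _ hz, ← Matrix.mulVec_mulVec, hy,
            Matrix.mulVec_zero]
        rw [key, hw'] at h1
        simpa using congrFun h1 q
      have hz : (∑ p, w p • b p t) ∈ B t :=
        sum_mem fun p _ => Subalgebra.smul_mem _ (hb p t) _
      have h2 : x - ∑ p, w p • b p t = 0 := by
        refine hy _ (sub_mem hx hz) ?_
        rw [Matrix.sub_mulVec, key, hw, sub_self]
      rw [sub_eq_zero.1 h2]
      exact sum_mem fun p _ => Submodule.smul_mem _ _ (Submodule.subset_span ⟨p, rfl⟩)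

end LimitLemma

end

end TwistedBethe

namespace TwistedBethe

noncomputable section

/-! ### Exchange relations at a pair of points

`x` and `y` are central elements that stand for `u⁻¹` and `v⁻¹`. -/

section Exchange

variable {𝕜 R : Type*} [CommRing 𝕜] [Ring R] [Algebra 𝕜 R]

/-- The relation of the Yangian between `T(u)` and `T(v)`. -/
def RTT (x y : 𝕜) (T U : Matrix ℤˣ ℤˣ R) : Prop :=
  ∀ i j k l, (y - x) • (T i j * U k l - U k l * T i j) = (x * y) • (T k j * U i l - U k j * T i l)

/-- The commutation relations of `gl₂`. -/
def IsGl (E : Matrix ℤˣ ℤˣ R) : Prop :=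
  ∀ i j k l, E i j * E k l - E k l * E i j
    = (if k = j then E i l else 0) - (if i = l then E k j else 0)

/-- The entries of two matrices commute with each other. -/
def EntriesCommute (S T : Matrix ℤˣ ℤˣ R) : Prop := ∀ i j k l, Commute (S i j) (T k l)

/-- The matrix `1 + E u⁻¹`. -/
def lax (x : 𝕜) (E : Matrix ℤˣ ℤˣ R) : Matrix ℤˣ ℤˣ R := 1 + x • E

lemma lax_apply (x : 𝕜) (E : Matrix ℤˣ ℤˣ R) (i j : ℤˣ) :
    lax x E i j = (if i = j then 1 else 0) + x • E i j := by
  simp [lax, Matrix.one_apply]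

lemma EntriesCommute.symm {S T : Matrix ℤˣ ℤˣ R} (h : EntriesCommute S T) : EntriesCommute T S :=
  fun i j k l => (h k l i j).symm

lemma EntriesCommute.one_right (S : Matrix ℤˣ ℤˣ R) : EntriesCommute S 1 := by
  intro i j k l
  rw [Matrix.one_apply]
  split_ifs
  · exact Commute.one_right _
  · exact Commute.zero_right _

lemma EntriesCommute.mul_right {S T U : Matrix ℤˣ ℤˣ R} (h : EntriesCommute S T)
    (h' : EntriesCommute S U) : EntriesCommute S (T * U) := by
  intro i j k l
  rw [Matrix.mul_apply]
  exact Commute.sum_right _ _ _ fun a _ => (h _ _ _ _).mul_right (h' _ _ _ _)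

lemma EntriesCommute.lax {E F : Matrix ℤˣ ℤˣ R} (h : EntriesCommute E F) (x y : 𝕜) :
    EntriesCommute (lax x E) (lax y F) := by
  intro i j k l
  rw [lax_apply, lax_apply]
  have h1 : ∀ (P : Prop) [Decidable P] (a : R), Commute (if P then (1 : R) else 0) a := by
    intro P _ a
    split_ifs
    · exact Commute.one_left _
    · exact Commute.zero_left _
  exact (h1 _ _).add_left ((h1 _ _).symm.add_right (((h i j k l).smul_left x).smul_right y))

/-- Constants drop out of the commutator, which leaves `x y [E_{ij}, E_{kl}]`. On the other side the
quadratic terms cancel, and what remains is the `gl₂` relation multiplied by `x y (y - x)`. -/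
lemma RTT.lax {E : Matrix ℤˣ ℤˣ R} (hE : IsGl E) (x y : 𝕜) : RTT x y (lax x E) (lax y E) := by
  intro i j k l
  have e : TwistedBethe.lax x E i j * TwistedBethe.lax y E k l
      - TwistedBethe.lax y E k l * TwistedBethe.lax x E i j
      = (x * y) • (E i j * E k l - E k l * E i j) := by
    simp only [lax_apply]
    split_ifs <;> simp only [add_mul, mul_add, smul_mul_assoc, mul_smul_comm, smul_smul, one_mul,
      mul_one, zero_add] <;> match_scalars <;> ring
  rw [e, hE]
  simp only [lax_apply]
  split_ifs <;> simp only [add_mul, mul_add, smul_mul_assoc, mul_smul_comm, smul_smul, one_mul,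
    mul_one, zero_add, sub_zero, zero_sub, sub_self, smul_zero] <;> match_scalars <;> ring

lemma RTT.one (x y : 𝕜) : RTT x y (1 : Matrix ℤˣ ℤˣ R) 1 := by
  intro i j k l
  simp only [Matrix.one_apply]
  split_ifs <;> simp

/-- This is the compatibility of the coproduct with the relations, at a fixed pair of points. -/
lemma RTT.mul {x y : 𝕜} {S S' T T' : Matrix ℤˣ ℤˣ R} (hS : RTT x y S S') (hT : RTT x y T T')
    (h : EntriesCommute T S') (h' : EntriesCommute T' S) : RTT x y (S * T) (S' * T') := by
  intro i j k l
  have hc : ∀ (c : 𝕜) (F : R), algebraMap 𝕜 R c * F = F * algebraMap 𝕜 R c :=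
    fun c F => Algebra.commutes c F
  simp only [RTT, Algebra.smul_def] at hS hT ⊢
  simp only [Matrix.mul_apply]
  exact product_relation _ _ S S' T T' (hc _) (hc _) (fun i j k l => h i j k l)
    (fun i j k l => h' i j k l) hS hT i j k l

/-- The matrix `T^t`, where `E_{ij}^t = θ_{ij} E_{-j,-i}`. -/
def twTr (κ : Kind) (T : Matrix ℤˣ ℤˣ R) : Matrix ℤˣ ℤˣ R :=
  Matrix.of fun i j => (theta κ i j : ℤ) • T (-j) (-i)

lemma EntriesCommute.twTr_left {S T : Matrix ℤˣ ℤˣ R} (h : EntriesCommute S T) (κ : Kind) :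
    EntriesCommute (twTr κ S) T := fun i j k l => by
  rw [twTr, Matrix.of_apply]
  exact (h _ _ _ _).smul_left _

lemma twTr_one (κ : Kind) : twTr κ (1 : Matrix ℤˣ ℤˣ R) = 1 := by
  ext i j
  rcases units_cases i with rfl | rfl <;> rcases units_cases j with rfl | rfl <;>
    cases κ <;> simp [twTr, theta]

/-- Transposition reverses the product because the entries commute; the signs match because `θ_{ib}
θ_{bj} = θ_{ij}`, and the summation index is replaced by its negative. -/
lemma twTr_mul (κ : Kind) {S T : Matrix ℤˣ ℤˣ R} (h : EntriesCommute S T) :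
    twTr κ (S * T) = twTr κ T * twTr κ S := by
  ext i j : 2
  have e : ∀ b, (theta κ i j : ℤ) • (S (-j) b * T b (-i))
      = ((theta κ i (-b) : ℤ) • (T (- -b) (-i))) *
        ((theta κ (-b) j : ℤ) • (S (-j) (- -b))) := by
    intro b
    rw [neg_neg, (h _ _ _ _).eq, smul_mul_smul_comm, ← Units.val_mul, theta_mul]
  simp only [twTr, Matrix.of_apply, Matrix.mul_apply, Finset.smul_sum, e]
  exact Equiv.sum_comp (Equiv.neg ℤˣ) fun b : ℤˣ =>
    ((theta κ i b : ℤ) • (T (-b) (-i))) * ((theta κ b j : ℤ) • (S (-j) (-b)))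

/-- `M ⊗ 1`. -/
def kr₁ (M : Matrix ℤˣ ℤˣ R) : Matrix (ℤˣ × ℤˣ) (ℤˣ × ℤˣ) R := M ⊗ₖ 1

/-- `1 ⊗ M`. -/
def kr₂ (M : Matrix ℤˣ ℤˣ R) : Matrix (ℤˣ × ℤˣ) (ℤˣ × ℤˣ) R := 1 ⊗ₖ M

lemma kr₁_apply (M : Matrix ℤˣ ℤˣ R) (i k j l : ℤˣ) :
    kr₁ M (i, k) (j, l) = if k = l then M i j else 0 := by
  simp [kr₁, Matrix.one_apply]

lemma kr₂_apply (M : Matrix ℤˣ ℤˣ R) (i k j l : ℤˣ) :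
    kr₂ M (i, k) (j, l) = if i = j then M k l else 0 := by
  simp [kr₂, Matrix.one_apply]

lemma kr₁_smul (g : R) (M : Matrix ℤˣ ℤˣ (R)) :
    kr₁ (g • M) = g • kr₁ M := by
  ext1 ⟨i, k⟩ ⟨j, l⟩
  simp [kr₁_apply]

lemma kr₂_smul (g : R) (M : Matrix ℤˣ ℤˣ (R)) :
    kr₂ (g • M) = g • kr₂ M := by
  ext1 ⟨i, k⟩ ⟨j, l⟩
  simp [kr₂_apply]

lemma sum_pairs {M : Type*} [AddCommMonoid M] (f : ℤˣ × ℤˣ → M) :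
    ∑ a, f a = ∑ i, ∑ k, f (i, k) := Fintype.sum_prod_type f

lemma kr₁_mul_apply (M : Matrix ℤˣ ℤˣ R) (N : Matrix (ℤˣ × ℤˣ) (ℤˣ × ℤˣ) R) (i k : ℤˣ)
    (r : ℤˣ × ℤˣ) : (kr₁ M * N) (i, k) r = ∑ a, M i a * N (a, k) r := by
  simp only [Matrix.mul_apply, kr₁_apply, sum_pairs, ite_mul, zero_mul]
  exact Finset.sum_congr rfl fun a _ => Fintype.sum_ite_eq _ _

lemma kr₂_mul_apply (M : Matrix ℤˣ ℤˣ R) (N : Matrix (ℤˣ × ℤˣ) (ℤˣ × ℤˣ) R) (i k : ℤˣ)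
    (r : ℤˣ × ℤˣ) : (kr₂ M * N) (i, k) r = ∑ a, M k a * N (i, a) r := by
  simp only [Matrix.mul_apply, kr₂_apply, sum_pairs, ite_mul, zero_mul]
  rw [Finset.sum_comm]
  exact Finset.sum_congr rfl fun a _ => Fintype.sum_ite_eq _ _

lemma kr₁_mul (M N : Matrix ℤˣ ℤˣ R) : kr₁ (M * N) = kr₁ M * kr₁ N := by
  ext ⟨i, k⟩ ⟨j, l⟩
  rw [kr₁_mul_apply]
  simp only [kr₁_apply, Matrix.mul_apply]
  split_ifs <;> simp

lemma kr₂_mul (M N : Matrix ℤˣ ℤˣ R) : kr₂ (M * N) = kr₂ M * kr₂ N := by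
  ext ⟨i, k⟩ ⟨j, l⟩
  rw [kr₂_mul_apply]
  simp only [kr₂_apply, Matrix.mul_apply]
  split_ifs <;> simp

lemma kr₁_mul_kr₂_apply (M N : Matrix ℤˣ ℤˣ R) (i k j l : ℤˣ) :
    (kr₁ M * kr₂ N) (i, k) (j, l) = M i j * N k l := by
  simp [kr₁_mul_apply, kr₂_apply, -UnitsInt.univ]

lemma kr₂_mul_kr₁_apply (M N : Matrix ℤˣ ℤˣ R) (i k j l : ℤˣ) :
    (kr₂ N * kr₁ M) (i, k) (j, l) = N k l * M i j := by
  simp [kr₂_mul_apply, kr₁_apply, -UnitsInt.univ]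

lemma EntriesCommute.kr {M N : Matrix ℤˣ ℤˣ R} (h : EntriesCommute M N) :
    kr₁ M * kr₂ N = kr₂ N * kr₁ M := by
  ext ⟨i, k⟩ ⟨j, l⟩
  rw [kr₁_mul_kr₂_apply, kr₂_mul_kr₁_apply, (h i j k l).eq]

/-- The permutation operator. -/
def permP (R : Type*) [Ring R] : Matrix (ℤˣ × ℤˣ) (ℤˣ × ℤˣ) R :=
  Matrix.of fun a b => if a.1 = b.2 ∧ a.2 = b.1 then 1 else 0

/-- The operator `Q = ∑ E_{ij}^t ⊗ E_{ji}`. -/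
def projQ (κ : Kind) (R : Type*) [Ring R] : Matrix (ℤˣ × ℤˣ) (ℤˣ × ℤˣ) R :=
  Matrix.of fun a b => if a.1 = -a.2 ∧ b.1 = -b.2 then ((theta κ a.2 b.2 : ℤˣ) : ℤ) else 0

/-- The operator `R(u - v)`, multiplied by `v⁻¹ - u⁻¹`. -/
def opR (R : Type*) [Ring R] [Algebra 𝕜 R] (x y : 𝕜) : Matrix (ℤˣ × ℤˣ) (ℤˣ × ℤˣ) R :=
  (y - x) • 1 - (x * y) • permP R

/-- The operator `R^t(-u - v)`, multiplied by `u⁻¹ + v⁻¹`. -/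
def opRt (κ : Kind) (R : Type*) [Ring R] [Algebra 𝕜 R] (x y : 𝕜) :
    Matrix (ℤˣ × ℤˣ) (ℤˣ × ℤˣ) R :=
  (x + y) • 1 + (x * y) • projQ κ R

lemma permP_mul_apply (M : Matrix (ℤˣ × ℤˣ) (ℤˣ × ℤˣ) R) (i k : ℤˣ) (r : ℤˣ × ℤˣ) :
    (permP R * M) (i, k) r = M (k, i) r := by
  simp [Matrix.mul_apply, permP, sum_pairs, ite_and, -UnitsInt.univ]

lemma mul_permP_apply (M : Matrix (ℤˣ × ℤˣ) (ℤˣ × ℤˣ) R) (j l : ℤˣ) (r : ℤˣ × ℤˣ) :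
    (M * permP R) r (j, l) = M r (l, j) := by
  simp [Matrix.mul_apply, permP, sum_pairs, ite_and, -UnitsInt.univ]

/-- The matrix form `R(u-v) T₁(u) T₂(v) = T₂(v) T₁(u) R(u-v)`; its entries are the RTT relations
with terms regrouped. -/
lemma RTT.opR_mul {x y : 𝕜} {T U : Matrix ℤˣ ℤˣ R} (h : RTT x y T U) :
    opR R x y * (kr₁ T * kr₂ U) = kr₂ U * kr₁ T * opR R x y := by
  ext ⟨i, k⟩ ⟨j, l⟩
  simp only [opR, sub_mul, mul_sub, smul_mul_assoc, mul_smul_comm, one_mul, mul_one,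
    Matrix.sub_apply, Matrix.smul_apply, permP_mul_apply, mul_permP_apply, kr₁_mul_kr₂_apply,
    kr₂_mul_kr₁_apply]
  have := h i j k l
  rw [smul_sub, smul_sub] at this
  rw [sub_eq_sub_iff_sub_eq_sub]
  exact this

/-- Transposing `R T₁(-u) U₂(v) = U₂(v) T₁(-u) R` in the first tensor factor turns `R(-u-v)` into
`R^t(-u-v)` and moves `T^t` to the other side of it. This is why the first argument of `RTT` is
`-x`. -/
lemma opRt_left {κ : Kind} {x y : 𝕜} {T U : Matrix ℤˣ ℤˣ R} (h : RTT (-x) y T U) :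
    kr₁ (twTr κ T) * opRt κ R x y * kr₂ U = kr₂ U * opRt κ R x y * kr₁ (twTr κ T) := by
  ext ⟨i, k⟩ ⟨j, l⟩
  simp only [opRt, add_mul, mul_add, smul_mul_assoc, mul_smul_comm, mul_one,
    Matrix.add_apply, Matrix.smul_apply, mul_assoc, kr₁_mul_apply, kr₂_mul_apply]
  have := h (-j) (-i) k l
  simp only [Matrix.mul_apply, sum_pairs, sum_units, projQ, kr₁_apply, kr₂_apply, twTr,
    Matrix.of_apply]
  rcases units_cases i with rfl | rfl <;> rcases units_cases j with rfl | rfl <;>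
    rcases units_cases k with rfl | rfl <;> rcases units_cases l with rfl | rfl <;>
    cases κ <;> simp [theta] at this ⊢ <;>
    first
      | linear_combination (norm := module) (1 : 𝕜) • this
      | linear_combination (norm := module) (-1 : 𝕜) • this

/-- The counterpart of `opRt_left`, with the transposition applied in the second tensor factor. -/
lemma opRt_right {κ : Kind} {x y : 𝕜} {T U : Matrix ℤˣ ℤˣ R} (h : RTT (-y) x U T) :
    kr₁ T * opRt κ R x y * kr₂ (twTr κ U) = kr₂ (twTr κ U) * opRt κ R x y * kr₁ T := by
  ext ⟨i, k⟩ ⟨j, l⟩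
  simp only [opRt, add_mul, mul_add, smul_mul_assoc, mul_smul_comm, mul_one,
    Matrix.add_apply, Matrix.smul_apply, mul_assoc, kr₁_mul_apply, kr₂_mul_apply]
  have := h (-l) (-k) i j
  simp only [Matrix.mul_apply, sum_pairs, sum_units, projQ, kr₁_apply, kr₂_apply, twTr,
    Matrix.of_apply]
  rcases units_cases i with rfl | rfl <;> rcases units_cases j with rfl | rfl <;>
    rcases units_cases k with rfl | rfl <;> rcases units_cases l with rfl | rfl <;>
    cases κ <;> simp [theta] at this ⊢ <;>
    first
      | linear_combination (norm := module) (-1 : 𝕜) • this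
      | linear_combination (norm := module) (1 : 𝕜) • this

/-- Dressing a solution of the reflection equation by solutions of exchange relations. -/
lemma dressing {M : Type*} [Ring M] {r r' l₁ l₂ m₁ m₂ s₁ s₂ : M}
    (hl : r * (l₁ * l₂) = l₂ * l₁ * r) (hm : r * (m₁ * m₂) = m₂ * m₁ * r)
    (h : m₁ * r' * l₂ = l₂ * r' * m₁) (h' : l₁ * r' * m₂ = m₂ * r' * l₁)
    (hs : r * s₁ * r' * s₂ = s₂ * r' * s₁ * r) (c : s₁ * l₂ = l₂ * s₁) (c' : m₁ * s₂ = s₂ * m₁)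
    (d : l₁ * s₂ = s₂ * l₁) (d' : s₁ * m₂ = m₂ * s₁) :
    r * (l₁ * s₁ * m₁) * r' * (l₂ * s₂ * m₂) = (l₂ * s₂ * m₂) * r' * (l₁ * s₁ * m₁) * r := by
  calc r * (l₁ * s₁ * m₁) * r' * (l₂ * s₂ * m₂)
      = r * l₁ * s₁ * (m₁ * r' * l₂) * s₂ * m₂ := by simp only [mul_assoc]
    _ = r * l₁ * (s₁ * l₂) * r' * (m₁ * s₂) * m₂ := by rw [h]; simp only [mul_assoc]
    _ = r * (l₁ * l₂) * s₁ * r' * s₂ * (m₁ * m₂) := by rw [c, c']; simp only [mul_assoc]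
    _ = l₂ * l₁ * (r * s₁ * r' * s₂) * (m₁ * m₂) := by rw [hl]; simp only [mul_assoc]
    _ = l₂ * (l₁ * s₂) * r' * s₁ * (r * (m₁ * m₂)) := by rw [hs]; simp only [mul_assoc]
    _ = l₂ * s₂ * l₁ * r' * (s₁ * m₂) * m₁ * r := by rw [d, hm]; simp only [mul_assoc]
    _ = l₂ * s₂ * (l₁ * r' * m₂) * s₁ * m₁ * r := by rw [d']; simp only [mul_assoc]
    _ = (l₂ * s₂ * m₂) * r' * (l₁ * s₁ * m₁) * r := by rw [h']; simp only [mul_assoc]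

/-- The commutator of `s₁₁(u) - s_{-1,-1}(u)` and `s₁₁(v) - s_{-1,-1}(v)` is a combination of
matrix entries of the reflection equation. -/
lemma reflection_trace_commute (κ : Kind) {x y : 𝕜} {S S' : Matrix ℤˣ ℤˣ R}
    (h : opR R x y * kr₁ S * opRt κ R x y * kr₂ S' = kr₂ S' * opRt κ R x y * kr₁ S * opR R x y) :
    (((y - x) ^ 2 - (x * y) ^ 2) * ((x + y) ^ 2 - (x * y) ^ 2)) •
      ((S 1 1 - S (-1) (-1)) * (S' 1 1 - S' (-1) (-1))
        - (S' 1 1 - S' (-1) (-1)) * (S 1 1 - S (-1) (-1))) = 0 := by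
  have key : ∀ i k j l, ∑ a, ∑ b, opR R x y (i, k) (a, b) *
      ∑ c, S a c * ∑ e, opRt κ R x y (c, b) (j, e) * S' e l
      = ∑ e, S' k e * ∑ a, ∑ b, opRt κ R x y (i, e) (a, b) * ∑ c, S a c *
        opR R x y (c, b) (j, l) := by
    intro i k j l
    have := congrFun (congrFun h (i, k)) (j, l)
    simp only [mul_assoc] at this
    rw [kr₂_mul_apply, Matrix.mul_apply, sum_pairs] at this
    simp only [kr₁_mul_apply, Matrix.mul_apply (M := opRt κ R x y), sum_pairs, kr₂_apply] at this
    simpa [-UnitsInt.univ] using this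
  -- Only weight-preserving entries enter: the four diagonal ones, and the two that exchange
  -- `(1,-1)` and `(-1,1)`. The polynomial weights below eliminate all other products of entries of
  -- `S` and `S'`.
  have e1 := key 1 1 1 1
  have e2 := key (-1) (-1) (-1) (-1)
  have e3 := key 1 (-1) 1 (-1)
  have e4 := key (-1) 1 (-1) 1
  have e5 := key 1 (-1) (-1) 1
  have e6 := key (-1) 1 1 (-1)
  simp only [sum_units, opR, opRt, permP, projQ, Matrix.sub_apply, Matrix.add_apply,
    Matrix.smul_apply, Matrix.of_apply, Matrix.one_apply] at e1 e2 e3 e4 e5 e6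
  simp only [sub_mul, mul_sub]
  cases κ
  · simp [theta, mul_add, add_mul, mul_sub, sub_mul, ← mul_assoc] at e1 e2 e3 e4 e5 e6
    linear_combination (norm := module)
      (y ^ 2 - x ^ 2 + x * y ^ 2 + x ^ 2 * y) • (e1 + e2)
      + (-y ^ 2 + x * y ^ 2 + x ^ 2 - x ^ 2 * y + x ^ 2 * y ^ 2) • (e3 + e4)
      + (-2 * x ^ 2 * y + x ^ 2 * y ^ 2) • (e5 + e6)
  · simp [theta, mul_add, add_mul, mul_sub, sub_mul, ← mul_assoc] at e1 e2 e3 e4 e5 e6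
    linear_combination (norm := module)
      (y ^ 2 - x ^ 2 + x * y ^ 2 + x ^ 2 * y) • (e1 + e2)
      + (-y ^ 2 + x * y ^ 2 + x ^ 2 - x ^ 2 * y - x ^ 2 * y ^ 2) • (e3 + e4)
      + (-2 * x * y ^ 2 + x ^ 2 * y ^ 2) • (e5 + e6)

end Exchange

end

end TwistedBethe

namespace TwistedBethe

noncomputable section

section Exchange

variable {𝕜 R : Type*} [CommRing 𝕜] [Ring R] [Algebra 𝕜 R]

/-! ### The boundary matrix -/

/-- The diagonal boundary matrix `(1 + a u⁻¹) + c u⁻¹ F₁₁`. -/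
def bdry (a c x : 𝕜) : Matrix ℤˣ ℤˣ 𝕜 :=
  Matrix.diagonal fun i => 1 + a * x + c * x * ((i : ℤ) : 𝕜)

/-- The parameters for which the boundary matrix solves the reflection equation. -/
def IsBdry : Kind → 𝕜 → 𝕜 → Prop
  | Kind.minus, a, c => a = 0 ∧ c = 0
  | Kind.plus, a, _ => 2 * a = 1

lemma bdry_minus (x : 𝕜) : bdry 0 0 x = 1 := by
  simp [bdry]

lemma permP_map : (permP 𝕜).map (algebraMap 𝕜 R) = permP R := by
  ext a b
  simp only [permP, Matrix.map_apply, Matrix.of_apply]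
  split_ifs <;> simp

lemma projQ_map (κ : Kind) : (projQ κ 𝕜).map (algebraMap 𝕜 R) = projQ κ R := by
  ext a b
  simp only [projQ, Matrix.map_apply, Matrix.of_apply]
  split_ifs <;> simp

lemma smul_map (c : 𝕜) (M : Matrix (ℤˣ × ℤˣ) (ℤˣ × ℤˣ) 𝕜) :
    (algebraMap 𝕜 R).mapMatrix (c • M) = c • M.map (algebraMap 𝕜 R) := by
  ext a b
  simp only [RingHom.mapMatrix_apply, Matrix.map_apply, Matrix.smul_apply, smul_eq_mul, map_mul,
    Algebra.smul_def (A := R)]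

lemma opR_map (x y : 𝕜) : (opR 𝕜 x y).map (algebraMap 𝕜 R) = opR R x y := by
  rw [← RingHom.mapMatrix_apply, opR, opR, map_sub, smul_map, smul_map, permP_map,
    ← RingHom.mapMatrix_apply, map_one]

lemma opRt_map (κ : Kind) (x y : 𝕜) : (opRt κ 𝕜 x y).map (algebraMap 𝕜 R) = opRt κ R x y := by
  rw [← RingHom.mapMatrix_apply, opRt, opRt, map_add, smul_map, smul_map, projQ_map,
    ← RingHom.mapMatrix_apply, map_one]

lemma kr₁_map (M : Matrix ℤˣ ℤˣ 𝕜) : (kr₁ M).map (algebraMap 𝕜 R)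
    = kr₁ (M.map (algebraMap 𝕜 R)) := by
  ext ⟨i, k⟩ ⟨j, l⟩
  simp only [kr₁_apply, Matrix.map_apply]
  split_ifs <;> simp

lemma kr₂_map (M : Matrix ℤˣ ℤˣ 𝕜) : (kr₂ M).map (algebraMap 𝕜 R)
    = kr₂ (M.map (algebraMap 𝕜 R)) := by
  ext ⟨i, k⟩ ⟨j, l⟩
  simp only [kr₂_apply, Matrix.map_apply]
  split_ifs <;> simp

/-- The boundary matrix is scalar-valued, so the reflection equation reduces to polynomial
identities over the commutative ring `𝕜`, checked entry by entry. -/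
lemma bdry_reflection_aux {κ : Kind} {a c : 𝕜} (h : IsBdry κ a c) (x y : 𝕜) :
    opR 𝕜 x y * kr₁ (bdry a c x) * opRt κ 𝕜 x y * kr₂ (bdry a c y)
      = kr₂ (bdry a c y) * opRt κ 𝕜 x y * kr₁ (bdry a c x) * opR 𝕜 x y := by
  have hk : kr₁ (bdry a c x) = Matrix.diagonal fun p : ℤˣ × ℤˣ =>
      1 + a * x + c * x * ((p.1 : ℤ) : 𝕜) := by
    ext ⟨i, k⟩ ⟨j, l⟩
    simp only [kr₁_apply, bdry, Matrix.diagonal_apply, Prod.mk.injEq, ite_and]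
    split_ifs <;> rfl
  have hk' : kr₂ (bdry a c y) = Matrix.diagonal fun p : ℤˣ × ℤˣ =>
      1 + a * y + c * y * ((p.2 : ℤ) : 𝕜) := by
    ext ⟨i, k⟩ ⟨j, l⟩
    simp only [kr₂_apply, bdry, Matrix.diagonal_apply, Prod.mk.injEq, ite_and]
  rw [hk, hk']
  ext ⟨i, k⟩ ⟨j, l⟩
  rw [Matrix.mul_diagonal, Matrix.mul_apply, Matrix.mul_apply]
  simp only [Matrix.mul_diagonal, Matrix.diagonal_mul, sum_pairs, sum_units]
  cases κ
  · obtain ⟨rfl, rfl⟩ := h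
    rcases units_cases i with rfl | rfl <;> rcases units_cases j with rfl | rfl <;>
      rcases units_cases k with rfl | rfl <;> rcases units_cases l with rfl | rfl <;>
      simp [opR, opRt, permP, projQ, theta] <;> ring
  · replace h : 2 * a = 1 := h
    -- Since `2a = 1`, the element 2 is invertible; writing `x = 2ξ` and `y = 2η` removes `a` and
    -- leaves identities that `ring` can decide.
    obtain ⟨ξ, rfl⟩ : ∃ ξ, x = 2 * ξ := ⟨a * x, by linear_combination -x * h⟩
    obtain ⟨η, rfl⟩ : ∃ η, y = 2 * η := ⟨a * y, by linear_combination -y * h⟩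
    have e : ∀ ξ, a * (2 * ξ) = ξ := fun ξ => by linear_combination ξ * h
    simp only [e]
    rcases units_cases i with rfl | rfl <;> rcases units_cases j with rfl | rfl <;>
      rcases units_cases k with rfl | rfl <;> rcases units_cases l with rfl | rfl <;>
      simp [opR, opRt, permP, projQ, theta] <;> ring

lemma bdry_reflection {κ : Kind} {a c : 𝕜} (h : IsBdry κ a c) (x y : 𝕜) :
    opR R x y * kr₁ ((bdry a c x).map (algebraMap 𝕜 R)) * opRt κ R x y
        * kr₂ ((bdry a c y).map (algebraMap 𝕜 R))
      = kr₂ ((bdry a c y).map (algebraMap 𝕜 R)) * opRt κ R x y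
        * kr₁ ((bdry a c x).map (algebraMap 𝕜 R)) * opR R x y := by
  have := congrArg (fun M => M.map (algebraMap 𝕜 R)) (bdry_reflection_aux h x y)
  simpa only [Matrix.map_mul, opR_map, opRt_map, kr₁_map, kr₂_map] using this

/-- `1 - P`. -/
def opA (R : Type*) [Ring R] : Matrix (ℤˣ × ℤˣ) (ℤˣ × ℤˣ) R := 1 - permP R

lemma opA_map : (opA 𝕜).map (algebraMap 𝕜 R) = opA R := by
  rw [← RingHom.mapMatrix_apply, opA, opA, map_sub, map_one, RingHom.mapMatrix_apply, permP_map]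

/-- The condition `y - x = x y` says `v = u - 1`. The scalar `m` is the Sklyanin determinant of the
boundary matrix, up to normalisation; it is read off from the diagonal entry at `(1,-1)`. -/
lemma opA_mul_bdry_aux {κ : Kind} {a c : 𝕜} (h : IsBdry κ a c) {x y : 𝕜} (hxy : y - x = x * y) :
    ∃ m : 𝕜, opA 𝕜 * (kr₁ (bdry a c x) * opRt κ 𝕜 x y * kr₂ (bdry a c y)) = m • opA 𝕜 := by
  have hk : kr₁ (bdry a c x) = Matrix.diagonal fun p : ℤˣ × ℤˣ =>
      1 + a * x + c * x * ((p.1 : ℤ) : 𝕜) := by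
    ext ⟨i, k⟩ ⟨j, l⟩
    simp only [kr₁_apply, bdry, Matrix.diagonal_apply, Prod.mk.injEq, ite_and]
    split_ifs <;> rfl
  have hk' : kr₂ (bdry a c y) = Matrix.diagonal fun p : ℤˣ × ℤˣ =>
      1 + a * y + c * y * ((p.2 : ℤ) : 𝕜) := by
    ext ⟨i, k⟩ ⟨j, l⟩
    simp only [kr₂_apply, bdry, Matrix.diagonal_apply, Prod.mk.injEq, ite_and]
  rw [hk, hk']
  simp only [opA, sub_mul, one_mul]
  cases κ
  · obtain ⟨rfl, rfl⟩ := h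
    refine ⟨x + y + 2 * (x * y), ?_⟩
    ext ⟨i, k⟩ ⟨j, l⟩
    rw [Matrix.sub_apply, permP_mul_apply]
    simp only [Matrix.mul_diagonal, Matrix.diagonal_mul]
    rcases units_cases i with rfl | rfl <;> rcases units_cases j with rfl | rfl <;>
      rcases units_cases k with rfl | rfl <;> rcases units_cases l with rfl | rfl <;>
      simp [opRt, permP, projQ, theta] <;> ring
  · refine ⟨(x + y) * ((1 + a * x + c * x) * (1 + a * y - c * y))
      + (x * y) * (2 * c * x * (1 + a * y - c * y)), ?_⟩
    ext ⟨i, k⟩ ⟨j, l⟩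
    rw [Matrix.sub_apply, permP_mul_apply]
    simp only [Matrix.mul_diagonal, Matrix.diagonal_mul]
    replace h : 2 * a = 1 := h
    rcases units_cases i with rfl | rfl <;> rcases units_cases j with rfl | rfl <;>
      rcases units_cases k with rfl | rfl <;> rcases units_cases l with rfl | rfl <;>
      simp [opRt, permP, projQ, theta] <;>
      first
        | ring1
        | linear_combination (-2 * c * (x + y + x * y)) * hxy + (2 * c * x ^ 2 * y ^ 2) * h
        | linear_combination -((-2 * c * (x + y + x * y)) * hxy + (2 * c * x ^ 2 * y ^ 2) * h)

lemma opA_mul_bdry {κ : Kind} {a c : 𝕜} (h : IsBdry κ a c) {x y : 𝕜} (hxy : y - x = x * y) :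
    ∃ m : 𝕜, opA R * (kr₁ ((bdry a c x).map (algebraMap 𝕜 R)) * opRt κ R x y
      * kr₂ ((bdry a c y).map (algebraMap 𝕜 R))) = m • opA R := by
  obtain ⟨m, hm⟩ := opA_mul_bdry_aux h hxy
  refine ⟨m, ?_⟩
  have := congrArg (fun M => M.map (algebraMap 𝕜 R)) hm
  simp only [Matrix.map_mul, opA_map, opRt_map, kr₁_map, kr₂_map] at this
  rw [this, ← RingHom.mapMatrix_apply, smul_map, opA_map]

/-! ### Quantum determinants -/

/-- `T(u)` has a scalar quantum determinant: `A₂ T₁(u) T₂(u - 1) = m A₂`. -/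
def HasQdet (M N : Matrix ℤˣ ℤˣ R) : Prop :=
  ∃ m : 𝕜, opA R * (kr₁ M * kr₂ N) = m • opA R

lemma HasQdet.one : HasQdet (𝕜 := 𝕜) (1 : Matrix ℤˣ ℤˣ R) 1 :=
  ⟨1, by simp [kr₁, kr₂]⟩

/-- Multiplicativity of the quantum determinant: since `M'₁` and `N₂` commute, the product regroups
as `(M₁ N₂)(M'₁ N'₂)`, and the antisymmetrizer passes through the two groups in turn. -/
lemma HasQdet.mul {M N M' N' : Matrix ℤˣ ℤˣ R} (h : HasQdet (𝕜 := 𝕜) M N)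
    (h' : HasQdet (𝕜 := 𝕜) M' N') (hc : EntriesCommute M' N) :
    HasQdet (𝕜 := 𝕜) (M * M') (N * N') := by
  obtain ⟨m, hm⟩ := h
  obtain ⟨m', hm'⟩ := h'
  refine ⟨m * m', ?_⟩
  rw [kr₁_mul, kr₂_mul, mul_assoc (kr₁ M), ← mul_assoc (kr₁ M'), hc.kr, mul_assoc (kr₂ N),
    ← mul_assoc (kr₁ M), ← mul_assoc (opA R), hm, smul_mul_assoc, hm', smul_smul]

lemma HasQdet.lax {E : Matrix ℤˣ ℤˣ R} (hE : IsGl E) {c₁ c₂ : 𝕜}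
    (h₁ : E 1 1 + E (-1) (-1) = c₁ • 1)
    (h₂ : E 1 1 * E (-1) (-1) - E 1 1 - E (-1) 1 * E 1 (-1) = c₂ • 1) {x y : 𝕜}
    (hxy : y - x = x * y) : HasQdet (𝕜 := 𝕜) (lax x E) (lax y E) := by
  -- Expanding `T₁₁(u) T_{-1,-1}(u-1) - T_{-1,1}(u) T_{1,-1}(u-1)` and using `x = y - x y` in the
  -- term `x E₁₁` produces the trace and the shifted Casimir element, hence this scalar.
  refine ⟨1 + y * c₁ + (x * y) * c₂, ?_⟩
  ext ⟨i, k⟩ ⟨j, l⟩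
  have e1 := hE 1 (-1) (-1) 1
  have e2 := hE 1 1 (-1) (-1)
  have e3 := hE 1 1 1 (-1)
  have e4 := hE 1 1 (-1) 1
  have e5 := hE (-1) (-1) 1 (-1)
  have e6 := hE (-1) (-1) (-1) 1
  simp at e1 e2 e3 e4 e5 e6
  simp only [opA, sub_mul, one_mul, Matrix.sub_apply, permP_mul_apply, kr₁_mul_kr₂_apply,
    lax_apply, Matrix.smul_apply]
  have hz : ∀ z : R, (y - x) • z - (x * y) • z = 0 := fun z => by rw [hxy, sub_self]
  rcases units_cases i with rfl | rfl <;> rcases units_cases j with rfl | rfl <;>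
    rcases units_cases k with rfl | rfl <;> rcases units_cases l with rfl | rfl <;>
    simp [permP, add_mul, mul_add]
  · linear_combination (norm := module) (1 : 𝕜) • hz (E (-1) 1) + (x * y) • e4
  · linear_combination (norm := module) y • h₁ + (x * y) • h₂ - (1 : 𝕜) • hz (E 1 1)
  · linear_combination (norm := module) (x * y) • e1 + (x * y) • e2 - y • h₁ - (x * y) • h₂
      + (1 : 𝕜) • hz (E (-1) (-1))
  · linear_combination (norm := module) (-1 : 𝕜) • hz (E 1 (-1)) - (x * y) • e5
  · linear_combination (norm := module) (-1 : 𝕜) • hz (E (-1) 1) - (x * y) • e4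
  · linear_combination (norm := module) (-y) • h₁ - (x * y) • h₂ + (1 : 𝕜) • hz (E 1 1)
  · linear_combination (norm := module) y • h₁ + (x * y) • h₂ - (1 : 𝕜) • hz (E (-1) (-1))
      - (x * y) • e1 - (x * y) • e2
  · linear_combination (norm := module) (1 : 𝕜) • hz (E 1 (-1)) + (x * y) • e5

end Exchange

end

end TwistedBethe

namespace TwistedBethe

noncomputable section

section Exchange

variable {𝕜 R : Type*} [CommRing 𝕜] [Ring R] [Algebra 𝕜 R]

/-! ### Products of Lax matrices -/

/-- Pairwise commuting copies of `gl₂` with scalar central elements. -/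
structure IsGlFamily (𝕜 : Type*) {R ι : Type*} [CommRing 𝕜] [Ring R] [Algebra 𝕜 R]
    (E : ι → Matrix ℤˣ ℤˣ R) : Prop where
  isGl (i : ι) : IsGl (E i)
  commute (i j : ι) : i ≠ j → EntriesCommute (E i) (E j)
  trace (i : ι) : ∃ c : 𝕜, E i 1 1 + E i (-1) (-1) = c • 1
  casimir (i : ι) : ∃ c : 𝕜,
    E i 1 1 * E i (-1) (-1) - E i 1 1 - E i (-1) 1 * E i 1 (-1) = c • 1

variable {ι : Type*} {E : ι → Matrix ℤˣ ℤˣ R}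

/-- The product of the matrices `1 + E_i u⁻¹`. -/
def monodromy (E : ι → Matrix ℤˣ ℤˣ R) (x : 𝕜) (l : List ι) : Matrix ℤˣ ℤˣ R :=
  (l.map fun i => lax x (E i)).prod

@[simp]
lemma monodromy_nil (x : 𝕜) : monodromy E x [] = 1 := rfl

@[simp]
lemma monodromy_cons (x : 𝕜) (i : ι) (l : List ι) :
    monodromy E x (i :: l) = lax x (E i) * monodromy E x l := by
  simp [monodromy]

lemma monodromy_concat (x : 𝕜) (i : ι) (l : List ι) :
    monodromy E x (l ++ [i]) = monodromy E x l * lax x (E i) := by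
  simp [monodromy]

lemma IsGlFamily.entriesCommute (h : IsGlFamily 𝕜 E) (x y : 𝕜) {i : ι} {l : List ι} (hi : i ∉ l) :
    EntriesCommute (lax x (E i)) (monodromy E y l) := by
  induction l with
  | nil => exact EntriesCommute.one_right _
  | cons j l ih =>
    rw [List.mem_cons, not_or] at hi
    rw [monodromy_cons]
    exact ((h.commute i j hi.1).lax x y).mul_right (ih hi.2)

/-- Induction on the number of sites: each Lax matrix satisfies RTT, and distinct sites commute. -/
lemma IsGlFamily.rtt (h : IsGlFamily 𝕜 E) (x y : 𝕜) {l : List ι} (hl : l.Nodup) :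
    RTT x y (monodromy E x l) (monodromy E y l) := by
  induction l with
  | nil => exact RTT.one x y
  | cons i l ih =>
    rw [List.nodup_cons] at hl
    rw [monodromy_cons, monodromy_cons]
    exact (RTT.lax (h.isGl i) x y).mul (ih hl.2) (h.entriesCommute _ _ hl.1).symm
      (h.entriesCommute _ _ hl.1).symm

lemma IsGlFamily.hasQdet (h : IsGlFamily 𝕜 E) {x y : 𝕜} (hxy : y - x = x * y) {l : List ι}
    (hl : l.Nodup) : HasQdet (𝕜 := 𝕜) (monodromy E x l) (monodromy E y l) := by
  induction l with
  | nil => exact HasQdet.one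
  | cons i l ih =>
    rw [List.nodup_cons] at hl
    rw [monodromy_cons, monodromy_cons]
    obtain ⟨c₁, h₁⟩ := h.trace i
    obtain ⟨c₂, h₂⟩ := h.casimir i
    exact (HasQdet.lax (h.isGl i) h₁ h₂ hxy).mul (ih hl.2) (h.entriesCommute _ _ hl.1).symm

/-- The image of `E` under the automorphism `E_{ij} ↦ -θ_{ij} E_{-j,-i}` of `gl₂`. -/
def negTr (κ : Kind) (E : Matrix ℤˣ ℤˣ R) : Matrix ℤˣ ℤˣ R := -twTr κ E

/-- The sign in `-u` is absorbed by the automorphism `negTr` of `gl₂`, so the transposed Lax matrix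
is again a Lax matrix at `u`. -/
lemma twTr_lax (κ : Kind) (x : 𝕜) (E : Matrix ℤˣ ℤˣ R) :
    twTr κ (lax (-x) E) = lax x (negTr κ E) := by
  ext i j
  have h := congrFun (congrFun (twTr_one (R := R) κ) i) j
  simp only [twTr, Matrix.of_apply] at h
  simp only [lax, negTr, twTr, Matrix.add_apply, Matrix.of_apply, Matrix.smul_apply,
    Matrix.neg_apply, smul_add, neg_smul, smul_neg, h]
  rw [smul_comm]

lemma IsGl.negTr {E : Matrix ℤˣ ℤˣ R} (hE : IsGl E) (κ : Kind) : IsGl (negTr κ E) := by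
  intro i j k l
  have := hE (-j) (-i) (-l) (-k)
  rcases units_cases i with rfl | rfl <;> rcases units_cases j with rfl | rfl <;>
    rcases units_cases k with rfl | rfl <;> rcases units_cases l with rfl | rfl <;>
    cases κ <;> simp [TwistedBethe.negTr, twTr, theta] at this ⊢ <;>
    first
      | exact this
      | linear_combination (norm := module) (1 : ℤ) • this
      | linear_combination (norm := module) (-1 : ℤ) • this

lemma IsGlFamily.negTr (h : IsGlFamily 𝕜 E) (κ : Kind) :
    IsGlFamily 𝕜 fun i => negTr κ (E i) where
  isGl i := (h.isGl i).negTr κ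
  commute i j hij := by
    intro a b c d
    simp only [TwistedBethe.negTr, Matrix.neg_apply]
    exact ((((h.commute i j hij).twTr_left κ).symm.twTr_left κ).symm _ _ _ _).neg_left.neg_right
  trace i := by
    obtain ⟨c, hc⟩ := h.trace i
    refine ⟨-c, ?_⟩
    rw [neg_smul, ← hc]
    cases κ <;> simp [TwistedBethe.negTr, twTr, theta]
  casimir i := by
    obtain ⟨c, hc⟩ := h.trace i
    obtain ⟨c', hc'⟩ := h.casimir i
    -- The automorphism exchanges the two diagonal generators up to sign, which turns `-E₁₁` in the
    -- Casimir expression into `+E_{-1,-1}`; the difference is the trace `c`.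
    refine ⟨c + c', ?_⟩
    rw [add_smul, ← hc, ← hc']
    have := h.isGl i 1 1 (-1) (-1)
    simp at this
    rw [sub_eq_zero.1 this]
    cases κ <;> (simp [TwistedBethe.negTr, twTr, theta]; abel)

/-- `T^t(-u)` is itself a monodromy matrix, with the sites in reverse order. The RTT relation and
the quantum determinant are therefore available for it without a separate proof. -/
lemma IsGlFamily.twTr_monodromy (h : IsGlFamily 𝕜 E) (κ : Kind) (x : 𝕜) {l : List ι}
    (hl : l.Nodup) :
    twTr κ (monodromy E (-x) l) = monodromy (fun i => TwistedBethe.negTr κ (E i)) x l.reverse := by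
  induction l with
  | nil => exact twTr_one κ
  | cons i l ih =>
    rw [List.nodup_cons] at hl
    rw [monodromy_cons, List.reverse_cons, monodromy_concat, twTr_mul _ (h.entriesCommute _ _ hl.1),
      ih hl.2, twTr_lax]

/-! ### The dressed boundary matrix -/

/-- The matrix `S(u) = T(u) K(u) T^t(-u)`. -/
def dressed (κ : Kind) (a c : 𝕜) (E : ι → Matrix ℤˣ ℤˣ R) (x : 𝕜) (l : List ι) :
    Matrix ℤˣ ℤˣ R :=
  monodromy E x l * (bdry a c x).map (algebraMap 𝕜 R) * twTr κ (monodromy E (-x) l)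

lemma entriesCommute_map (K : Matrix ℤˣ ℤˣ 𝕜) (M : Matrix ℤˣ ℤˣ R) :
    EntriesCommute (K.map (algebraMap 𝕜 R)) M := fun _ _ _ _ => Algebra.commutes _ _

/-- Sklyanin's dressing: `T` and `T^t(-u)` each satisfy RTT, they are exchanged through `R^t`, and
the scalar boundary matrix commutes with everything it has to pass. -/
lemma IsGlFamily.reflection (h : IsGlFamily 𝕜 E) {κ : Kind} {a c : 𝕜} (hK : IsBdry κ a c)
    (x y : 𝕜) {l : List ι} (hl : l.Nodup) :
    opR R x y * kr₁ (dressed κ a c E x l) * opRt κ R x y * kr₂ (dressed κ a c E y l)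
      = kr₂ (dressed κ a c E y l) * opRt κ R x y * kr₁ (dressed κ a c E x l) * opR R x y := by
  simp only [dressed, kr₁_mul, kr₂_mul]
  refine dressing (h.rtt x y hl).opR_mul ?_ (opRt_left (h.rtt (-x) y hl))
    (opRt_right (h.rtt (-y) x hl)) (bdry_reflection hK x y) (entriesCommute_map _ _).kr
    (entriesCommute_map _ _).symm.kr (entriesCommute_map _ _).symm.kr (entriesCommute_map _ _).kr
  rw [h.twTr_monodromy κ x hl, h.twTr_monodromy κ y hl]
  exact ((h.negTr κ).rtt x y (List.nodup_reverse.2 hl)).opR_mul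

/-- Moving `T₂` to the left through `R^t` and `K₁`, and `K₂` past `T^t₁`, groups the factors as
`(T₁T₂)(K₁R^tK₂)(T^t₁T^t₂)`. The antisymmetrizer absorbs each group into a scalar: two quantum
determinants and the boundary contribution. -/
lemma IsGlFamily.sdet (h : IsGlFamily 𝕜 E) {κ : Kind} {a c : 𝕜} (hK : IsBdry κ a c)
    {x y : 𝕜} (hxy : y - x = x * y) {l : List ι} (hl : l.Nodup) :
    ∃ m : 𝕜, opA R * kr₁ (dressed κ a c E x l) * opRt κ R x y * kr₂ (dressed κ a c E y l)
      = m • opA R := by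
  obtain ⟨m₁, h₁⟩ := h.hasQdet hxy hl
  obtain ⟨m₂, h₂⟩ := opA_mul_bdry (R := R) hK hxy
  obtain ⟨m₃, h₃⟩ := (h.negTr κ).hasQdet hxy (List.nodup_reverse.2 hl)
  rw [← h.twTr_monodromy κ x hl, ← h.twTr_monodromy κ y hl] at h₃
  refine ⟨m₁ * (m₂ * m₃), ?_⟩
  simp only [dressed, kr₁_mul, kr₂_mul]
  set k := (bdry a c x).map (algebraMap 𝕜 R)
  set k' := (bdry a c y).map (algebraMap 𝕜 R)
  set t := monodromy E x l
  set t' := monodromy E y l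
  set s := twTr κ (monodromy E (-x) l)
  set s' := twTr κ (monodromy E (-y) l)
  have e₁ : kr₁ s * opRt κ R x y * kr₂ t' = kr₂ t' * opRt κ R x y * kr₁ s :=
    opRt_left (h.rtt (-x) y hl)
  have e₂ : kr₁ k * kr₂ t' = kr₂ t' * kr₁ k := (entriesCommute_map _ _).kr
  have e₃ : kr₁ s * kr₂ k' = kr₂ k' * kr₁ s := (entriesCommute_map _ _).symm.kr
  calc opA R * (kr₁ t * kr₁ k * kr₁ s) * opRt κ R x y * (kr₂ t' * kr₂ k' * kr₂ s')
      = opA R * (kr₁ t * kr₁ k * (kr₁ s * opRt κ R x y * kr₂ t') * kr₂ k' * kr₂ s') := by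
        simp only [mul_assoc]
    _ = opA R * (kr₁ t * (kr₁ k * kr₂ t') * opRt κ R x y * (kr₁ s * kr₂ k') * kr₂ s') := by
        rw [e₁]; simp only [mul_assoc]
    _ = opA R * (kr₁ t * kr₂ t') * (kr₁ k * opRt κ R x y * kr₂ k') * (kr₁ s * kr₂ s') := by
        rw [e₂, e₃]; simp only [mul_assoc]
    _ = (m₁ * (m₂ * m₃)) • opA R := by
        rw [h₁, smul_mul_assoc, h₂, smul_smul, smul_mul_assoc, h₃, smul_smul, mul_assoc]

end Exchange

end

end TwistedBethe

namespace TwistedBethe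

noncomputable section

/-! ### Substitutions `u ↦ -u` and `u ↦ u - 1` as ring homomorphisms of series -/

section SeriesHoms

variable {A : Type*} [Ring A]

/-- `f(u) ↦ f(-u)` as a ring homomorphism. -/
def negHom : PowerSeries A →+* PowerSeries A where
  toFun := negU
  map_one' := by
    ext n
    by_cases hn : n = 0 <;> simp [negU, PowerSeries.coeff_one, hn]
  map_mul' := negU_mul
  map_zero' := negU_zero
  map_add' := negU_add

lemma negHom_C (a : A) : negHom (PowerSeries.C a) = PowerSeries.C a := by
  ext n
  by_cases hn : n = 0 <;> simp [negHom, negU, PowerSeries.coeff_C, hn]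

lemma negHom_X : negHom (PowerSeries.X : PowerSeries A) = -PowerSeries.X := by
  ext n
  by_cases hn : n = 1 <;> simp [negHom, negU, PowerSeries.coeff_X, hn]

variable [Algebra ℂ A]

/-- The series `(u - 1)⁻¹`. -/
def shiftX : PowerSeries ℂ := PowerSeries.X * (1 - PowerSeries.X)⁻¹

lemma shiftX_mul : shiftX * (1 - PowerSeries.X) = PowerSeries.X := by
  rw [shiftX, mul_assoc, PowerSeries.inv_mul_cancel _ (by simp), mul_one]

lemma coeff_shiftX_pow_of_lt {n r : ℕ} (h : n < r) : PowerSeries.coeff n (shiftX ^ r) = 0 := by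
  rw [shiftX, mul_pow, PowerSeries.coeff_X_pow_mul', if_neg (by omega)]

/-- The `r`-th power of `(u-1)⁻¹` has order `r` in `u⁻¹`, so the defining sum may be extended to any
larger range; this allows a common range for different coefficients. -/
lemma coeff_shiftU (f : PowerSeries A) {n N : ℕ} (h : n < N) :
    PowerSeries.coeff n (shiftU f)
      = ∑ r ∈ Finset.range N, PowerSeries.coeff n (shiftX ^ r) • PowerSeries.coeff r f := by
  rw [shiftU, PowerSeries.coeff_mk]
  refine Finset.sum_subset (Finset.range_subset_range.2 h) fun r _ hr => ?_
  have hr' : n < r := by simpa using hr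
  have := coeff_shiftX_pow_of_lt hr'
  rw [shiftX] at this
  rw [this, zero_smul]

lemma shiftU_C (a : A) : shiftU (PowerSeries.C a) = PowerSeries.C a := by
  ext n
  rw [coeff_shiftU _ (Nat.lt_succ_self n), Finset.sum_eq_single 0]
  · by_cases hn : n = 0 <;> simp [PowerSeries.coeff_one, PowerSeries.coeff_C, hn]
  · intro r _ hr
    simp [PowerSeries.coeff_C, hr]
  · simp

lemma shiftU_mul (f g : PowerSeries A) : shiftU (f * g) = shiftU f * shiftU g := by
  ext n
  have h2 : ∀ p ∈ Finset.HasAntidiagonal.antidiagonal n,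
      PowerSeries.coeff p.1 (shiftU f) * PowerSeries.coeff p.2 (shiftU g)
      = ∑ r ∈ Finset.range (n + 1), ∑ s ∈ Finset.range (n + 1),
        (PowerSeries.coeff p.1 (shiftX ^ r) * PowerSeries.coeff p.2 (shiftX ^ s)) •
          (PowerSeries.coeff r f * PowerSeries.coeff s g) := by
    intro p hp
    have hp' := Finset.HasAntidiagonal.mem_antidiagonal.1 hp
    rw [coeff_shiftU f (N := n + 1) (by omega), coeff_shiftU g (N := n + 1) (by omega),
      Finset.sum_mul_sum]
    simp only [smul_mul_smul_comm]
  rw [PowerSeries.coeff_mul, Finset.sum_congr rfl h2, Finset.sum_comm]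
  have h3 : ∀ r ∈ Finset.range (n + 1), ∑ p ∈ Finset.HasAntidiagonal.antidiagonal n,
      ∑ s ∈ Finset.range (n + 1),
        (PowerSeries.coeff p.1 (shiftX ^ r) * PowerSeries.coeff p.2 (shiftX ^ s)) •
          (PowerSeries.coeff r f * PowerSeries.coeff s g)
      = ∑ s ∈ Finset.range (n + 1), PowerSeries.coeff n (shiftX ^ (r + s)) •
          (PowerSeries.coeff r f * PowerSeries.coeff s g) := by
    intro r _
    rw [Finset.sum_comm]
    refine Finset.sum_congr rfl fun s _ => ?_
    rw [← Finset.sum_smul, pow_add, PowerSeries.coeff_mul]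
  rw [Finset.sum_congr rfl h3, coeff_shiftU _ (Nat.lt_succ_self n)]
  simp only [PowerSeries.coeff_mul, Finset.smul_sum]
  rw [Finset.sum_sigma', ← Finset.sum_product']
  -- Pairs `(r, s)` with `r + s ≤ n` correspond to the terms of the convolution product; the other
  -- pairs of the square contribute zero, because `shiftX ^ (r + s)` has order `r + s > n`.
  refine Finset.sum_of_injOn (fun x => x.2) ?_ ?_ ?_ ?_
  · rintro ⟨a, p⟩ ha ⟨b, q⟩ hb h
    simp only [Finset.coe_sigma, Set.mem_sigma_iff, Finset.mem_coe, Finset.HasAntidiagonal.mem_antidiagonal] at ha hb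
    obtain rfl : p = q := h
    obtain rfl : a = b := ha.2.symm.trans hb.2
    rfl
  · rintro ⟨a, p⟩ ha
    simp only [Finset.coe_sigma, Set.mem_sigma_iff, Finset.mem_coe, Finset.HasAntidiagonal.mem_antidiagonal,
      Finset.mem_range] at ha
    simp only [Finset.coe_product, Finset.coe_range, Set.mem_prod, Set.mem_Iio]
    omega
  · rintro p hp hq
    have : n < p.1 + p.2 := by
      by_contra hle
      refine hq ⟨⟨p.1 + p.2, p⟩, ?_, rfl⟩
      simp
      omega
    rw [coeff_shiftX_pow_of_lt this, zero_smul]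
  · rintro ⟨a, p⟩ ha
    simp only [Finset.mem_sigma, Finset.HasAntidiagonal.mem_antidiagonal] at ha
    rw [← ha.2]

/-- `f(u) ↦ f(u - 1)` as a ring homomorphism. -/
def shiftHom : PowerSeries A →+* PowerSeries A where
  toFun := shiftU
  map_one' := by rw [← map_one (PowerSeries.C (R := A)), shiftU_C]
  map_mul' := shiftU_mul
  map_zero' := by rw [← map_zero (PowerSeries.C (R := A)), shiftU_C]
  map_add' f g := by
    ext n
    simp only [map_add, coeff_shiftU _ (Nat.lt_succ_self n), smul_add, Finset.sum_add_distrib]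

lemma shiftHom_C (a : A) : shiftHom (PowerSeries.C a) = PowerSeries.C a := shiftU_C a

lemma shiftHom_scalarSeries (f : PowerSeries ℂ) :
    shiftHom (scalarSeries A f) = scalarSeries A (shiftHom f) := by
  ext n
  rw [scalarSeries, PowerSeries.coeff_map]
  refine (coeff_shiftU _ (Nat.lt_succ_self n)).trans ?_
  refine Eq.trans ?_ (congrArg (algebraMap ℂ A) (coeff_shiftU _ (Nat.lt_succ_self n)).symm)
  simp only [map_sum, PowerSeries.coeff_map, smul_eq_mul, map_mul, Algebra.smul_def (A := A)]

lemma shiftX_eq : shiftHom (PowerSeries.X : PowerSeries ℂ) = shiftX := by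
  ext n
  refine (coeff_shiftU _ (show n < n + 2 by omega)).trans ?_
  rw [Finset.sum_eq_single 1]
  · simp
  · intro r _ hr
    simp [PowerSeries.coeff_X, hr]
  · simp

lemma scalarSeries_C (a : ℂ) :
    scalarSeries A (PowerSeries.C a) = PowerSeries.C (algebraMap ℂ A a) := by
  simp [scalarSeries]

lemma scalarSeries_X : scalarSeries A PowerSeries.X = PowerSeries.X := by
  simp [scalarSeries]

lemma shiftHom_X : shiftHom (PowerSeries.X : PowerSeries A) = scalarSeries A shiftX := by
  rw [← shiftX_eq, ← shiftHom_scalarSeries, scalarSeries_X]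

/-- Series with coefficients in `A` form an algebra over scalar series. -/
abbrev seriesAlgebra (A : Type*) [Ring A] [Algebra ℂ A] : Algebra (PowerSeries ℂ) (PowerSeries A) :=
  (scalarSeries A).toAlgebra' fun c F => scalarSeries_comm c F

/-- Series in two variables with coefficients in `A` form an algebra over scalar series. -/
abbrev seriesAlgebra₂ (A : Type*) [Ring A] [Algebra ℂ A] :
    Algebra (PowerSeries (PowerSeries ℂ)) (PowerSeries (PowerSeries A)) :=
  (PowerSeries.map (scalarSeries A)).toAlgebra' fun c F => commute_series fun r s => by
    rw [PowerSeries.coeff_map]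
    exact scalarSeries_comm _ _

end SeriesHoms

end

end TwistedBethe

namespace TwistedBethe

noncomputable section

/-! ### Specialising matrices of series, and commutativity of the coefficients of `s₁₁ - s_{-1,-1}`
-/

section DressedSeries

variable {A : Type*} [Ring A] {ι : Type*}

/-- The product of the matrices `1 + E_i u⁻¹` as a matrix of series. -/
def seriesT (E : ι → Matrix ℤˣ ℤˣ A) (l : List ι) : Matrix ℤˣ ℤˣ (PowerSeries A) :=
  (l.map fun i => evalMatrix (E i)).prod

/-- The boundary matrix as a matrix of scalar series. -/
def seriesK (a c : ℂ) : Matrix ℤˣ ℤˣ (PowerSeries ℂ) :=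
  bdry (PowerSeries.C a) (PowerSeries.C c) PowerSeries.X

variable {𝕜 R : Type*} [CommRing 𝕜] [Ring R] [Algebra 𝕜 R]

/-- A ring homomorphism that sends `X` to a central scalar `x` acts as evaluation of the spectral
parameter at `x⁻¹`. Different `φ` yield the two independent variables, `-u` and `u - 1`, so that the
point identities apply to formal series. -/
lemma seriesT_map (E : ι → Matrix ℤˣ ℤˣ A) (l : List ι) (φ : PowerSeries A →+* R) {x : 𝕜}
    (hx : φ PowerSeries.X = algebraMap 𝕜 R x) :
    (seriesT E l).map φ = monodromy (fun i => (E i).map (φ.comp PowerSeries.C)) x l := by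
  have h : ∀ E : Matrix ℤˣ ℤˣ A, (evalMatrix E).map φ = lax x (E.map (φ.comp PowerSeries.C)) := by
    intro E
    ext i j
    simp only [evalMatrix, Matrix.map_apply, Matrix.of_apply, map_add, map_mul, hx, lax_apply,
      RingHom.comp_apply, Algebra.smul_def, Algebra.commutes]
    congr 1
    split_ifs <;> simp
  induction l with
  | nil => simp [seriesT]
  | cons i l ih =>
    rw [monodromy_cons, ← ih, ← h, ← Matrix.map_mul]
    simp [seriesT]

lemma transposeNeg_eq (κ : Kind) (T : Matrix ℤˣ ℤˣ (PowerSeries A)) (φ : PowerSeries A →+* R) :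
    (transposeNeg κ T).map φ = twTr κ (T.map (φ.comp negHom)) := by
  ext i j
  simp only [transposeNeg, twTr, Matrix.map_apply, Matrix.of_apply, map_zsmul]
  rfl

variable [Algebra ℂ A]

/-- The matrix `T(u) K(u) T^t(-u)` of series. -/
def seriesS (κ : Kind) (a c : ℂ) (E : ι → Matrix ℤˣ ℤˣ A) (l : List ι) :
    Matrix ℤˣ ℤˣ (PowerSeries A) :=
  seriesT E l * (seriesK a c).map (scalarSeries A) * transposeNeg κ (seriesT E l)

lemma seriesS_map (κ : Kind) (a c : ℂ) (E : ι → Matrix ℤˣ ℤˣ A) (l : List ι)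
    (φ : PowerSeries A →+* R) {x a' c' : 𝕜} (hx : φ PowerSeries.X = algebraMap 𝕜 R x)
    (ha : φ (PowerSeries.C (algebraMap ℂ A a)) = algebraMap 𝕜 R a')
    (hc : φ (PowerSeries.C (algebraMap ℂ A c)) = algebraMap 𝕜 R c') :
    (seriesS κ a c E l).map φ
      = dressed κ a' c' (fun i => (E i).map (φ.comp PowerSeries.C)) x l := by
  have hn : (φ.comp negHom) PowerSeries.X = algebraMap 𝕜 R (-x) := by
    rw [RingHom.comp_apply, negHom_X, map_neg, hx, map_neg]
  have hC : (φ.comp negHom).comp PowerSeries.C = φ.comp PowerSeries.C := by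
    ext a
    simp [negHom_C]
  have hK : ((seriesK a c).map (scalarSeries A)).map φ
      = (bdry a' c' x).map (algebraMap 𝕜 R) := by
    ext i j
    simp only [seriesK, bdry, Matrix.map_apply, Matrix.diagonal_apply]
    split_ifs
    · simp only [map_add, map_mul, map_one, map_intCast, scalarSeries_C, scalarSeries_X, hx, ha, hc]
    · simp
  rw [seriesS, Matrix.map_mul, Matrix.map_mul, transposeNeg_eq, seriesT_map E l φ hx,
    seriesT_map E l _ hn, hK, hC, dressed]

lemma IsGlFamily.map {E : ι → Matrix ℤˣ ℤˣ A} (h : IsGlFamily ℂ E) (ψ : A →+* R) (χ : ℂ → 𝕜)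
    (hψ : ∀ c, ψ (algebraMap ℂ A c) = algebraMap 𝕜 R (χ c)) :
    IsGlFamily 𝕜 fun i => (E i).map ψ where
  isGl i := by
    intro a b c d
    simp only [Matrix.map_apply, ← map_mul, ← map_sub, h.isGl i a b c d]
    split_ifs <;> simp
  commute i j hij := fun a b c d => (h.commute i j hij a b c d).map ψ
  trace i := by
    obtain ⟨c, hc⟩ := h.trace i
    refine ⟨χ c, ?_⟩
    rw [← Algebra.algebraMap_eq_smul_one] at hc ⊢
    rw [← hψ, ← hc]
    simp
  casimir i := by
    obtain ⟨c, hc⟩ := h.casimir i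
    refine ⟨χ c, ?_⟩
    rw [← Algebra.algebraMap_eq_smul_one] at hc ⊢
    rw [← hψ, ← hc]
    simp

/-- The series `s₁₁(u) - s_{-1,-1}(u)`. -/
def diffS {R : Type*} [Ring R] (S : Matrix ℤˣ ℤˣ R) : R := S 1 1 - S (-1) (-1)

lemma IsBdry.map {κ : Kind} {a c : ℂ} (h : IsBdry κ a c) (χ : ℂ →+* 𝕜) :
    IsBdry κ (χ a) (χ c) := by
  cases κ
  · obtain ⟨rfl, rfl⟩ := h
    exact ⟨map_zero χ, map_zero χ⟩
  · have h' : 2 * a = 1 := h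
    show 2 * χ a = 1
    rw [← map_one χ, ← h', map_mul, map_ofNat]

/-- Once the lower coefficients of `F` vanish, the `n`-th coefficient of `D * F` is `b` times that
of `F`, and `b` is left regular. -/
lemma eq_zero_of_mul_eq_zero_of_coeff {B : Type*} [Ring B] {D F : PowerSeries B} {n : ℕ} {b : B}
    (hb : PowerSeries.coeff 0 D = b) (hreg : ∀ z, b * z = 0 → z = 0) (h : D * F = 0) :
    PowerSeries.coeff n F = 0 := by
  induction n using Nat.strong_induction_on with
  | _ n ih =>
    have h1 := congrArg (PowerSeries.coeff n) h
    rw [PowerSeries.coeff_mul, Finset.sum_eq_single (0, n), hb, map_zero] at h1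
    · exact hreg _ h1
    · rintro ⟨p, q⟩ hpq hne
      have hpq' := Finset.HasAntidiagonal.mem_antidiagonal.1 hpq
      have : q < n := by
        simp only at hpq'
        rcases Nat.eq_zero_or_pos p with rfl | hp
        · exact absurd (by simp at hpq'; simp [hpq']) hne
        · omega
      rw [ih q this, mul_zero]
    · intro hn
      exact absurd (by simp) hn

/-- The reflection equation is used in series in two variables, `x = u⁻¹` inner and `y = v⁻¹` outer.
The polynomial factor left by `reflection_trace_commute` can then be cancelled. -/
lemma commute_coeff_diffS {E : ι → Matrix ℤˣ ℤˣ A} (h : IsGlFamily ℂ E) {κ : Kind} {a c : ℂ}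
    (hK : IsBdry κ a c) {l : List ι} (hl : l.Nodup) (r s : ℕ) :
    Commute (PowerSeries.coeff r (diffS (seriesS κ a c E l)))
      (PowerSeries.coeff s (diffS (seriesS κ a c E l))) := by
  let := seriesAlgebra₂ A
  have halg : ∀ f, algebraMap (PowerSeries (PowerSeries ℂ)) (PowerSeries (PowerSeries A)) f
      = PowerSeries.map (scalarSeries A) f := fun f => rfl
  set ψ : A →+* PowerSeries (PowerSeries A) := PowerSeries.C.comp PowerSeries.C with hψ
  set χ : ℂ →+* PowerSeries (PowerSeries ℂ) := PowerSeries.C.comp PowerSeries.C with hχ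
  have hψχ : ∀ z, ψ (algebraMap ℂ A z)
      = algebraMap (PowerSeries (PowerSeries ℂ)) (PowerSeries (PowerSeries A)) (χ z) := by
    intro z
    simp [halg, hψ, hχ, scalarSeries_C]
  have hU : (inU (A := A)).comp PowerSeries.C = ψ := rfl
  have hV : (inV (A := A)).comp PowerSeries.C = ψ := by
    ext1 z
    simp [inV, hψ]
  set x : PowerSeries (PowerSeries ℂ) := PowerSeries.C PowerSeries.X with hx
  set y : PowerSeries (PowerSeries ℂ) := PowerSeries.X with hy
  have h1 : (seriesS κ a c E l).map inU
      = dressed κ (χ a) (χ c) (fun i => (E i).map ψ) x l := by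
    rw [← hU]
    refine seriesS_map κ a c E l inU ?_ (hψχ a) (hψχ c)
    simp [inU, halg, hx, scalarSeries_X]
  have h2 : (seriesS κ a c E l).map inV
      = dressed κ (χ a) (χ c) (fun i => (E i).map ψ) y l := by
    have e : ∀ z, inV (PowerSeries.C z) = ψ z := fun z => DFunLike.congr_fun hV z
    rw [← hV]
    refine seriesS_map κ a c E l inV ?_ (by rw [e, hψχ]) (by rw [e, hψχ])
    simp [inV, halg, hy]
  have key := reflection_trace_commute κ ((h.map ψ χ hψχ).reflection (hK.map χ) x y hl)
  rw [← h1, ← h2] at key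
  simp only [Matrix.map_apply, ← map_sub, Algebra.smul_def, halg] at key
  have hzero : ∀ n, PowerSeries.coeff n (inU (diffS (seriesS κ a c E l)) *
      inV (diffS (seriesS κ a c E l)) - inV (diffS (seriesS κ a c E l)) *
      inU (diffS (seriesS κ a c E l))) = 0 := by
    intro n
    -- At `y = 0` the factor `((y-x)² - (xy)²)((x+y)² - (xy)²)` equals `x⁴`, which is not a zero
    -- divisor.
    refine eq_zero_of_mul_eq_zero_of_coeff (b := PowerSeries.X ^ 4) ?_ ?_ key
    · rw [PowerSeries.coeff_map]
      have : PowerSeries.coeff 0 (((y - x) ^ 2 - (x * y) ^ 2) * ((x + y) ^ 2 - (x * y) ^ 2))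
          = (PowerSeries.X : PowerSeries ℂ) ^ 4 := by
        simp [hx, hy]
        ring
      rw [this, map_pow, scalarSeries_X]
    · intro z hz
      ext m
      have := congrArg (PowerSeries.coeff (m + 4)) hz
      rwa [PowerSeries.coeff_X_pow_mul, map_zero] at this
  have := congrArg (PowerSeries.coeff r) (hzero s)
  rw [map_sub, map_sub, coeff_UV, coeff_VU, map_zero, sub_eq_zero] at this
  exact this

end DressedSeries

end

end TwistedBethe

namespace TwistedBethe

noncomputable section

/-! ### The generating series `σ₁` and `σ₂` -/

section Sigma

variable {A : Type*} [Ring A] [Algebra ℂ A] {ι : Type*}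

lemma opP_eq : opP = permP ℂ := by
  ext ⟨i, k⟩ ⟨j, l⟩
  simp only [opP, sum_units, Matrix.add_apply, Matrix.kroneckerMap_apply, permP, Matrix.of_apply]
  rcases units_cases i with rfl | rfl <;> rcases units_cases j with rfl | rfl <;>
    rcases units_cases k with rfl | rfl <;> rcases units_cases l with rfl | rfl <;>
    simp

lemma opQ_eq (κ : Kind) : opQ κ = projQ κ ℂ := by
  ext ⟨i, k⟩ ⟨j, l⟩
  simp only [opQ, sum_units, Matrix.add_apply, Matrix.kroneckerMap_apply, projQ, Matrix.of_apply]
  cases κ <;> rcases units_cases i with rfl | rfl <;> rcases units_cases j with rfl | rfl <;>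
    rcases units_cases k with rfl | rfl <;> rcases units_cases l with rfl | rfl <;>
    simp [theta]

lemma antisym_apply (p q : ℤˣ × ℤˣ) : antisym p q = 1 / 2 * opA ℂ p q := by
  simp [antisym, opP_eq, opA]

lemma constMat_antisym : constMat (A := A) antisym
    = PowerSeries.C (algebraMap ℂ A (1 / 2)) • opA (PowerSeries A) := by
  ext1 p q
  simp only [constMat, Matrix.map_apply, antisym_apply, Matrix.smul_apply, smul_eq_mul, map_mul,
    opA, permP, Matrix.sub_apply, Matrix.one_apply, Matrix.of_apply]
  congr 1
  split_ifs <;> simp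

/-- The scalar factor between `σ₁(u)` and `s₁₁(u) - s_{-1,-1}(u)`. -/
def sigmaFactor : Kind → PowerSeries ℂ
  | Kind.minus => -PowerSeries.C (1 / 2)
  | Kind.plus => -PowerSeries.C (1 / 2)
      + PowerSeries.X * (PowerSeries.C 3 * PowerSeries.X - 2)⁻¹

/-- As `tr F₁₁ = 0`, the identity part of `R^t` contributes only `-tr(S F₁₁)/2`. The `Q`-part
contributes zero in the symplectic case and a scalar multiple of the same difference in the
orthogonal case. -/
lemma sigmaOne_eq (κ : Kind) (S : Matrix ℤˣ ℤˣ (PowerSeries A)) :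
    sigmaOne κ matF11 S = scalarSeries A (sigmaFactor κ) * diffS S := by
  set ρ := scalarSeries A (PowerSeries.X * (PowerSeries.C 3 * PowerSeries.X - 2)⁻¹) with hρ
  have hR : ∀ p q, (matRt κ 3).map (scalarSeries A) p q
      = (if p = q then 1 else 0) - ρ * projQ κ (PowerSeries A) p q := by
    intro p q
    simp only [matRt, Matrix.map_apply, Matrix.sub_apply, Matrix.one_apply, Matrix.smul_apply,
      smul_eq_mul, map_sub, map_mul, hρ, opQ_eq, projQ, Matrix.of_apply]
    congr 1
    · split_ifs <;> simp
    · congr 1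
      split_ifs <;> simp
  have hF : ∀ p q, constMat (A := A) ((1 : Matrix ℤˣ ℤˣ ℂ) ⊗ₖ matF11) p q
      = if p = q then (((p.2 : ℤˣ) : ℤ) : PowerSeries A) else 0 := by
    rintro ⟨i, k⟩ ⟨j, l⟩
    rcases units_cases i with rfl | rfl <;> rcases units_cases j with rfl | rfl <;>
      rcases units_cases k with rfl | rfl <;> rcases units_cases l with rfl | rfl <;>
      simp [constMat, matF11]
  have hS : S ⊗ₖ (1 : Matrix ℤˣ ℤˣ (PowerSeries A)) = kr₁ S := rfl
  have hc : ∀ F : PowerSeries A, F * ρ = ρ * F := fun F => (scalarSeries_comm _ F).symm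
  have hh : ∀ F : PowerSeries A, PowerSeries.C (algebraMap ℂ A (1 / 2)) * F
      + PowerSeries.C (algebraMap ℂ A (1 / 2)) * F = F := by
    intro F
    rw [← add_mul, ← map_add, ← map_add, add_halves, map_one, map_one, one_mul]
  rw [sigmaOne, constMat_antisym, hS, Matrix.smul_mul, Matrix.smul_mul, Matrix.smul_mul,
    Matrix.trace_smul, Matrix.trace, sum_pairs]
  simp only [sum_units, Matrix.diag_apply, Matrix.mul_apply, sum_pairs, hR, hF, kr₁_apply, opA,
    Matrix.sub_apply, Matrix.one_apply, permP, projQ, Matrix.of_apply, smul_eq_mul]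
  cases κ
  · have hf : scalarSeries A (sigmaFactor Kind.minus) = -PowerSeries.C (algebraMap ℂ A (1 / 2)) := by
      rw [sigmaFactor, map_neg, scalarSeries_C]
    rw [hf]
    generalize PowerSeries.C (algebraMap ℂ A (1 / 2)) = e
    simp [theta, diffS, mul_add, mul_sub, hc]
    abel
  · have hf : scalarSeries A (sigmaFactor Kind.plus)
        = -PowerSeries.C (algebraMap ℂ A (1 / 2)) + ρ := by
      rw [sigmaFactor, map_add, map_neg, scalarSeries_C]
    rw [hf]
    generalize PowerSeries.C (algebraMap ℂ A (1 / 2)) = e at hh ⊢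
    simp [theta, diffS, mul_add, mul_sub, add_mul, hc]
    linear_combination (norm := module)
      (1 : ℤ) • hh (ρ * S 1 1) - (1 : ℤ) • hh (ρ * S (-1) (-1))

lemma constantCoeff_sigmaFactor (κ : Kind) :
    PowerSeries.constantCoeff (sigmaFactor κ) = -(1 / 2) := by
  cases κ <;> simp [sigmaFactor]

lemma mul_scalar_smul (g : PowerSeries ℂ) (M N : Matrix (ℤˣ × ℤˣ) (ℤˣ × ℤˣ) (PowerSeries A)) :
    M * (scalarSeries A g • N) = scalarSeries A g • (M * N) := by
  ext1 p q
  simp only [Matrix.mul_apply, Matrix.smul_apply, smul_eq_mul, Finset.mul_sum]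
  refine Finset.sum_congr rfl fun r _ => ?_
  rw [← mul_assoc, ← scalarSeries_comm, mul_assoc]

/-- The series `σ₂(u)` acts by scalars. -/
lemma commute_coeff_sigmaTwo {E : ι → Matrix ℤˣ ℤˣ A} (h : IsGlFamily ℂ E) {κ : Kind} {a c : ℂ}
    (hK : IsBdry κ a c) {l : List ι} (hl : l.Nodup) (g : PowerSeries ℂ) (n : ℕ) (z : A) :
    Commute (PowerSeries.coeff n (sigmaTwo κ (scalarSeries A g • seriesS κ a c E l))) z := by
  let := seriesAlgebra A
  have halg : ∀ f, algebraMap (PowerSeries ℂ) (PowerSeries A) f = scalarSeries A f := fun f => rfl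
  have hsm : ∀ (f : PowerSeries ℂ) (F : PowerSeries A), f • F = scalarSeries A f * F :=
    fun _ _ => rfl
  -- The degeneration condition `y - x = x y` at `v = u - 1`.
  have hxy : shiftX - PowerSeries.X = PowerSeries.X * shiftX := by
    linear_combination shiftX_mul
  set S := seriesS κ a c E l with hS
  have h1 : S = dressed κ (PowerSeries.C a) (PowerSeries.C c)
      (fun i => (E i).map PowerSeries.C) PowerSeries.X l := by
    have := seriesS_map (𝕜 := PowerSeries ℂ) κ a c E l (RingHom.id (PowerSeries A))
      (x := PowerSeries.X) (a' := PowerSeries.C a) (c' := PowerSeries.C c)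
      (by rw [halg, scalarSeries_X]; rfl) (by rw [halg, scalarSeries_C]; rfl)
      (by rw [halg, scalarSeries_C]; rfl)
    rw [← hS] at this
    exact this
  have h2 : S.map shiftHom = dressed κ (PowerSeries.C a) (PowerSeries.C c)
      (fun i => (E i).map PowerSeries.C) shiftX l := by
    have hC : (shiftHom (A := A)).comp PowerSeries.C = PowerSeries.C := by
      ext1 z
      exact shiftHom_C z
    have := seriesS_map (𝕜 := PowerSeries ℂ) κ a c E l (shiftHom (A := A))
      (x := shiftX) (a' := PowerSeries.C a) (c' := PowerSeries.C c)
      (by rw [halg, shiftHom_X]) (by rw [halg, scalarSeries_C, shiftHom_C])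
      (by rw [halg, scalarSeries_C, shiftHom_C])
    rwa [hC] at this
  have hE : IsGlFamily (PowerSeries ℂ) fun i => (E i).map (PowerSeries.C (R := A)) :=
    h.map (PowerSeries.C (R := A)) PowerSeries.C fun c => by rw [halg, scalarSeries_C]
  obtain ⟨m, hm⟩ := hE.sdet (hK.map PowerSeries.C) hxy hl
  rw [← h1, ← h2] at hm
  -- For `v = u - 1` one has `-u - v = 1 - 2u`, so multiplication by `u⁻¹ + v⁻¹` turns the matrix
  -- `R^t(1 - 2u)` of `σ₂` into the denominator-free `opRt`.
  have hRt : (PowerSeries.X + shiftX : PowerSeries ℂ) • (matRt κ 1).map (scalarSeries A)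
      = opRt κ (PowerSeries A) PowerSeries.X shiftX := by
    have e : (PowerSeries.X + shiftX)
        * (PowerSeries.X * (PowerSeries.C 1 * PowerSeries.X - 2)⁻¹ : PowerSeries ℂ)
        = -(PowerSeries.X * shiftX) := by
      have e1 : (PowerSeries.C 1 * PowerSeries.X - 2 : PowerSeries ℂ)
          * (PowerSeries.C 1 * PowerSeries.X - 2)⁻¹ = 1 :=
        PowerSeries.mul_inv_cancel _ (by
          rw [show (2 : PowerSeries ℂ) = PowerSeries.C 2 from (map_ofNat _ 2).symm]
          simp)
      rw [map_one, one_mul] at e1 ⊢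
      linear_combination (-PowerSeries.X * shiftX) * e1
        - (PowerSeries.X * (PowerSeries.X - 2 : PowerSeries ℂ)⁻¹) * hxy
    have e2 : scalarSeries A (PowerSeries.X + shiftX) * scalarSeries A
        (PowerSeries.X * (PowerSeries.C 1 * PowerSeries.X - 2)⁻¹)
        = -scalarSeries A (PowerSeries.X * shiftX) := by
      rw [← map_mul, e, map_neg]
    ext1 p q
    have hq : scalarSeries A (PowerSeries.C (projQ κ ℂ p q)) = projQ κ (PowerSeries A) p q := by
      simp only [projQ, Matrix.of_apply]
      split_ifs <;> simp
    have h1 : scalarSeries A ((1 : Matrix (ℤˣ × ℤˣ) (ℤˣ × ℤˣ) (PowerSeries ℂ)) p q)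
        = (1 : Matrix (ℤˣ × ℤˣ) (ℤˣ × ℤˣ) (PowerSeries A)) p q := by
      simp only [Matrix.one_apply]
      split_ifs <;> simp
    simp only [matRt, opRt, opQ_eq, Matrix.map_apply, Matrix.sub_apply, Matrix.smul_apply,
      Matrix.add_apply, hsm, smul_eq_mul]
    rw [map_sub, map_mul, mul_sub, ← mul_assoc, e2, h1, hq, neg_mul, sub_neg_eq_add]
  have hW : (scalarSeries A g • S).map shiftU
      = scalarSeries A (shiftHom g) • S.map shiftHom := by
    ext1 i j
    simp only [Matrix.map_apply, Matrix.smul_apply, smul_eq_mul, ← shiftHom_scalarSeries,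
      ← map_mul]
    rfl
  have htr : Matrix.trace (opA (PowerSeries A)) = 2 := by
    rw [Matrix.trace, sum_pairs]
    simp only [Matrix.diag_apply, opA, permP, Matrix.sub_apply, Matrix.one_apply, Matrix.of_apply,
      sum_units]
    simp
    norm_num
  -- The expression under the trace is a scalar multiple of the antisymmetrizer by
  -- `IsGlFamily.sdet`; the shifted prefactor `g(u-1)` is scalar and comes out of the trace.
  have hfin : scalarSeries A (PowerSeries.X + shiftX) * sigmaTwo κ (scalarSeries A g • S)
      = scalarSeries A (PowerSeries.C (1 / 2) * (g * shiftHom g) * m * 2) := by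
    have e3 : sigmaTwo κ (scalarSeries A g • S) = scalarSeries A (PowerSeries.C (1 / 2) * g) *
        (scalarSeries A (shiftHom g) * Matrix.trace (opA (PowerSeries A) * kr₁ S *
          (matRt κ 1).map (scalarSeries A) * kr₂ (S.map shiftHom))) := by
      have k1 : (scalarSeries A g • S) ⊗ₖ (1 : Matrix ℤˣ ℤˣ (PowerSeries A))
        = scalarSeries A g • kr₁ S := kr₁_smul _ _
      have k2 : (1 : Matrix ℤˣ ℤˣ (PowerSeries A)) ⊗ₖ (scalarSeries A (shiftHom g) • S.map shiftHom)
        = scalarSeries A (shiftHom g) • kr₂ (S.map shiftHom) := kr₂_smul _ _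
      rw [sigmaTwo, hW, k1, k2, constMat_antisym, ← scalarSeries_C, mul_scalar_smul,
        mul_scalar_smul]
      simp only [Matrix.smul_mul, Matrix.trace_smul, smul_eq_mul]
      simp only [← mul_assoc (scalarSeries A _) (scalarSeries A _), ← map_mul]
      congr 2
      ring
    have e4 : scalarSeries A (PowerSeries.X + shiftX) *
        Matrix.trace (opA (PowerSeries A) * kr₁ S *
          (matRt κ 1).map (scalarSeries A) * kr₂ (S.map shiftHom)) = scalarSeries A m * 2 := by
      rw [← smul_eq_mul, ← Matrix.trace_smul, ← Matrix.smul_mul, ← mul_scalar_smul]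
      have : scalarSeries A (PowerSeries.X + shiftX) • (matRt κ 1).map (scalarSeries A)
        = opRt κ (PowerSeries A) PowerSeries.X shiftX := hRt
      rw [this, hm, Matrix.trace_smul, htr]
      rfl
    rw [e3, ← mul_assoc, ← mul_assoc, scalarSeries_comm (PowerSeries.X + shiftX), mul_assoc,
      mul_assoc, ← mul_assoc (scalarSeries A (PowerSeries.X + shiftX)),
      scalarSeries_comm (PowerSeries.X + shiftX), mul_assoc, e4, map_mul, map_mul, map_mul, map_mul,
      map_mul, map_ofNat]
    simp only [mul_assoc]
  set σ := sigmaTwo κ (scalarSeries A g • S)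
  have hz : scalarSeries A (PowerSeries.X + shiftX) * (σ * PowerSeries.C z - PowerSeries.C z * σ)
      = 0 := by
    rw [mul_sub, ← mul_assoc, hfin, scalarSeries_comm _ (PowerSeries.C z), ← hfin, ← mul_assoc,
      ← mul_assoc, scalarSeries_comm _ (PowerSeries.C z), sub_self]
  -- `X + shiftX = X (2 - X) / (1 - X)` is `X` times a unit, so it may be replaced by `X`, and then
  -- cancelled by passing to the next coefficient.
  have hX : PowerSeries.X * (σ * PowerSeries.C z - PowerSeries.C z * σ) = 0 := by
    have e5 : (PowerSeries.C 2 - PowerSeries.X : PowerSeries ℂ)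
        * (PowerSeries.C 2 - PowerSeries.X)⁻¹ = 1 := PowerSeries.mul_inv_cancel _ (by simp)
    have e6 : (PowerSeries.C 2 - PowerSeries.X)⁻¹ * (1 - PowerSeries.X)
        * (PowerSeries.X + shiftX) = (PowerSeries.X : PowerSeries ℂ) := by
      rw [map_ofNat] at e5 ⊢
      linear_combination PowerSeries.X * e5 + (2 - PowerSeries.X : PowerSeries ℂ)⁻¹ * shiftX_mul
    rw [← scalarSeries_X, ← e6, map_mul, mul_assoc, hz, mul_zero]
  have := congrArg (PowerSeries.coeff (n + 1)) hX
  rw [PowerSeries.coeff_succ_X_mul, map_sub, PowerSeries.coeff_mul_C, PowerSeries.coeff_C_mul,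
    map_zero, sub_eq_zero] at this
  exact this

end Sigma

end

end TwistedBethe

namespace TwistedBethe

noncomputable section

/-! ### Scalar leading terms at large evaluation parameters -/

section LeadingTerm

variable {ι : Type*}

/-- The leading term of the monodromy matrix. -/
def leadSeries (u : ι → ℂ) (s : Finset ι) : PowerSeries ℂ :=
  ∏ i ∈ s, (1 + PowerSeries.C (u i) * PowerSeries.X)

/-- The product of the leading terms of `T(u)` and `T(-u)`. -/
def evenSeries (u : ι → ℂ) (s : Finset ι) : PowerSeries ℂ :=
  ∏ i ∈ s, (1 - PowerSeries.C (u i ^ 2) * PowerSeries.X ^ 2)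

lemma leadSeries_mul_negHom (u : ι → ℂ) (s : Finset ι) :
    leadSeries u s * negHom (leadSeries u s) = evenSeries u s := by
  rw [leadSeries, map_prod, ← Finset.prod_mul_distrib]
  refine Finset.prod_congr rfl fun i _ => ?_
  rw [map_add, map_mul, map_one, negHom_C, negHom_X, map_pow]
  ring

lemma negHom_scalarSeries {A : Type*} [Ring A] [Algebra ℂ A] (f : PowerSeries ℂ) :
    negHom (scalarSeries A f) = scalarSeries A (negHom f) := by
  ext n
  simp [negHom, negU, scalarSeries]

end LeadingTerm

/-! ### First-order expansions in `t⁻¹`, and interpolation -/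

section Asymptotics

open Filter Topology

variable {A : Type*} [Ring A] [Algebra ℂ A] [TopologicalSpace A]

/-- `a t = a₀ + a₁ t⁻¹ + o(t⁻¹)` as `t → ∞`. -/
def HasExpansion (a : ℂ → A) (a₀ a₁ : A) : Prop :=
  Tendsto (fun t => t • (a t - a₀)) (Bornology.cobounded ℂ) (𝓝 a₁)

/-- The coefficients of `F t (t u)` have the first-order expansions given by `F₀` and `F₁`. -/
def HasExp (F : ℂ → PowerSeries A) (F₀ F₁ : PowerSeries A) : Prop :=
  ∀ n, HasExpansion (fun t => (t⁻¹) ^ n • PowerSeries.coeff n (F t)) (PowerSeries.coeff n F₀)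
    (PowerSeries.coeff n F₁)

lemma eventually_ne_zero_cobounded : ∀ᶠ t : ℂ in Bornology.cobounded ℂ, t ≠ 0 :=
  Bornology.eventually_ne_cobounded 0

/-- Series that are linear in `u⁻¹`, with linear coefficient `t b₀ + b₁`. -/
lemma HasExp.linear (e b₀ b₁ : A) :
    HasExp (fun t => PowerSeries.C e + PowerSeries.C (t • b₀ + b₁) * PowerSeries.X)
      (PowerSeries.C e + PowerSeries.C b₀ * PowerSeries.X) (PowerSeries.C b₁ * PowerSeries.X) := by
  intro n
  refine Tendsto.congr' ?_ tendsto_const_nhds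
  filter_upwards [eventually_ne_zero_cobounded] with t ht
  rcases n with _ | _ | n
  · simp
  · simp [smul_smul, ht]
  · simp only [map_add, PowerSeries.coeff_C_mul, PowerSeries.coeff_X, PowerSeries.coeff_C]
    simp

/-- Entrywise first-order expansions of a matrix of series. -/
def HasExpM (F : ℂ → Matrix ℤˣ ℤˣ (PowerSeries A)) (F₀ F₁ : Matrix ℤˣ ℤˣ (PowerSeries A)) : Prop :=
  ∀ i j, HasExp (fun t => F t i j) (F₀ i j) (F₁ i j)

/-- After `u ↦ tu` the Lax matrix with parameter `tv` is exactly `(1 + v u⁻¹) + t⁻¹ E u⁻¹`, with no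
further terms. -/
lemma hasExpM_evalMatrix (E : Matrix ℤˣ ℤˣ A) (v : ℂ) :
    HasExpM (fun t => evalMatrix ((t * v) • (1 : Matrix ℤˣ ℤˣ A) + E))
      (Matrix.scalar ℤˣ (scalarSeries A (1 + PowerSeries.C v * PowerSeries.X)))
      (E.map fun x => PowerSeries.C x * PowerSeries.X) := by
  intro i j
  have h := HasExp.linear (if i = j then (1 : A) else 0) (if i = j then v • 1 else 0) (E i j)
  convert h using 2 with t
  · simp only [evalMatrix, Matrix.of_apply, Matrix.add_apply, Matrix.smul_apply, Matrix.one_apply]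
    congr 3
    split_ifs <;> simp [mul_smul]
  · rw [Matrix.scalar_apply, Matrix.diagonal_apply]
    split_ifs
    · simp [scalarSeries_C, scalarSeries_X, Algebra.smul_def]
    · simp
  · rfl

variable [IsTopologicalRing A]

lemma HasExpansion.add {a b : ℂ → A} {a₀ a₁ b₀ b₁ : A} (ha : HasExpansion a a₀ a₁)
    (hb : HasExpansion b b₀ b₁) : HasExpansion (fun t => a t + b t) (a₀ + b₀) (a₁ + b₁) := by
  refine (Tendsto.add ha hb).congr fun t => ?_
  rw [← smul_add, add_sub_add_comm]

lemma HasExpansion.sum {ι : Type*} (s : Finset ι) {a : ι → ℂ → A} {a₀ a₁ : ι → A}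
    (h : ∀ i ∈ s, HasExpansion (a i) (a₀ i) (a₁ i)) :
    HasExpansion (fun t => ∑ i ∈ s, a i t) (∑ i ∈ s, a₀ i) (∑ i ∈ s, a₁ i) := by
  refine (tendsto_finsetSum s fun i hi => h i hi).congr fun t => ?_
  rw [← Finset.smul_sum, Finset.sum_sub_distrib]

lemma HasExpansion.smul {a : ℂ → A} {a₀ a₁ : A} (ha : HasExpansion a a₀ a₁) (c : ℂ) :
    HasExpansion (fun t => c • a t) (c • a₀) (c • a₁) := by
  refine (Tendsto.const_smul ha c).congr fun t => ?_
  rw [smul_comm, smul_sub]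

lemma HasExp.add {F G : ℂ → PowerSeries A} {F₀ F₁ G₀ G₁ : PowerSeries A} (hF : HasExp F F₀ F₁)
    (hG : HasExp G G₀ G₁) : HasExp (fun t => F t + G t) (F₀ + G₀) (F₁ + G₁) := by
  intro n
  simpa only [map_add, smul_add] using (hF n).add (hG n)

lemma HasExp.zsmul {F : ℂ → PowerSeries A} {F₀ F₁ : PowerSeries A} (hF : HasExp F F₀ F₁) (z : ℤ) :
    HasExp (fun t => z • F t) (z • F₀) (z • F₁) := by
  intro n
  have := (hF n).smul (z : ℂ)
  simpa only [map_zsmul, Int.cast_smul_eq_zsmul, smul_comm z] using this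

lemma HasExp.negHom {F : ℂ → PowerSeries A} {F₀ F₁ : PowerSeries A} (hF : HasExp F F₀ F₁) :
    HasExp (fun t => negHom (F t)) (negHom F₀) (negHom F₁) := by
  intro n
  have e : ∀ G : PowerSeries A, PowerSeries.coeff n (TwistedBethe.negHom G)
      = (-1 : ℂ) ^ n • PowerSeries.coeff n G := by
    intro G
    simp [TwistedBethe.negHom, negU, Algebra.smul_def]
  simpa only [e, smul_comm _ ((-1 : ℂ) ^ n)] using (hF n).smul ((-1) ^ n)

lemma HasExp.sub {F G : ℂ → PowerSeries A} {F₀ F₁ G₀ G₁ : PowerSeries A} (hF : HasExp F F₀ F₁)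
    (hG : HasExp G G₀ G₁) : HasExp (fun t => F t - G t) (F₀ - G₀) (F₁ - G₁) := by
  simpa only [neg_smul, one_smul, ← sub_eq_add_neg] using hF.add (hG.zsmul (-1))

lemma HasExpM.transposeNeg {F : ℂ → Matrix ℤˣ ℤˣ (PowerSeries A)}
    {F₀ F₁ : Matrix ℤˣ ℤˣ (PowerSeries A)} (hF : HasExpM F F₀ F₁) (κ : Kind) :
    HasExpM (fun t => transposeNeg κ (F t)) (transposeNeg κ F₀) (transposeNeg κ F₁) := by
  intro i j
  exact ((hF (-j) (-i)).negHom).zsmul _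

variable [ContinuousSMul ℂ A]

lemma HasExpansion.tendsto {a : ℂ → A} {a₀ a₁ : A} (h : HasExpansion a a₀ a₁) :
    Tendsto a (Bornology.cobounded ℂ) (𝓝 a₀) := by
  have h1 : Tendsto (fun t : ℂ => t⁻¹ • (t • (a t - a₀)) + a₀) (Bornology.cobounded ℂ)
      (𝓝 ((0 : ℂ) • a₁ + a₀)) :=
    ((tendsto_inv₀_cobounded).smul h).add tendsto_const_nhds
  rw [zero_smul, zero_add] at h1
  refine h1.congr' ?_
  filter_upwards [eventually_ne_zero_cobounded] with t ht
  rw [smul_smul, inv_mul_cancel₀ ht, one_smul, sub_add_cancel]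

lemma HasExpansion.mul {a b : ℂ → A} {a₀ a₁ b₀ b₁ : A} (ha : HasExpansion a a₀ a₁)
    (hb : HasExpansion b b₀ b₁) :
    HasExpansion (fun t => a t * b t) (a₀ * b₀) (a₀ * b₁ + a₁ * b₀) := by
  have h := (Tendsto.mul (tendsto_const_nhds (x := a₀)) hb).add (Tendsto.mul ha hb.tendsto)
  refine h.congr fun t => ?_
  rw [mul_smul_comm, smul_mul_assoc, ← smul_add]
  congr 1
  noncomm_ring

/-- The Leibniz rule, with the order of factors kept. The rescaling `t⁻ⁿ` of the `n`-th coefficient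
is multiplicative along a convolution. -/
lemma HasExp.mul {F G : ℂ → PowerSeries A} {F₀ F₁ G₀ G₁ : PowerSeries A} (hF : HasExp F F₀ F₁)
    (hG : HasExp G G₀ G₁) : HasExp (fun t => F t * G t) (F₀ * G₀) (F₀ * G₁ + F₁ * G₀) := by
  intro n
  have h := HasExpansion.sum (Finset.HasAntidiagonal.antidiagonal n)
    fun p _ => (hF p.1).mul (hG p.2)
  rw [Finset.sum_add_distrib] at h
  simp only [map_add, PowerSeries.coeff_mul]
  convert h using 3 with t
  rw [Finset.smul_sum]
  refine Finset.sum_congr rfl fun p hp => ?_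
  rw [smul_mul_smul_comm, ← pow_add, Finset.HasAntidiagonal.mem_antidiagonal.1 hp]

lemma HasExpM.mul {F G : ℂ → Matrix ℤˣ ℤˣ (PowerSeries A)}
    {F₀ F₁ G₀ G₁ : Matrix ℤˣ ℤˣ (PowerSeries A)} (hF : HasExpM F F₀ F₁) (hG : HasExpM G G₀ G₁) :
    HasExpM (fun t => F t * G t) (F₀ * G₀) (F₀ * G₁ + F₁ * G₀) := by
  intro i j
  have h := ((hF i 1).mul (hG 1 j)).add ((hF i (-1)).mul (hG (-1) j))
  simp only [Matrix.add_apply, Matrix.mul_apply, sum_units]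
  rwa [add_add_add_comm] at h

variable {ι : Type*}

variable [DecidableEq ι]

/-- All leading terms are scalar, so by the Leibniz rule the first-order term is a sum over sites of
`E_i u⁻¹` times the leading terms of the other sites. Only its diagonal difference is needed later.
-/
lemma hasExpM_seriesT (E : ι → Matrix ℤˣ ℤˣ A) (u : ι → ℂ) {l : List ι} (hl : l.Nodup) :
    ∃ F₁, HasExpM (fun t => seriesT (fun i => (t * u i) • (1 : Matrix ℤˣ ℤˣ A) + E i) l)
      (Matrix.scalar ℤˣ (scalarSeries A (leadSeries u l.toFinset))) F₁ ∧
      diffS F₁ = ∑ i ∈ l.toFinset, PowerSeries.C (diffS (E i)) *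
        scalarSeries A (PowerSeries.X * leadSeries u (l.toFinset.erase i)) := by
  induction l with
  | nil =>
    refine ⟨0, fun i j => ?_, by simp [diffS]⟩
    have h := HasExp.linear (if i = j then (1 : A) else 0) 0 0
    convert h using 2 with t
    · simp [seriesT, Matrix.one_apply, apply_ite PowerSeries.C]
    · simp [leadSeries, Matrix.one_apply, apply_ite PowerSeries.C]
    · simp
  | cons i l ih =>
    obtain ⟨hi, hl⟩ := List.nodup_cons.1 hl
    obtain ⟨F₁, h1, h2⟩ := ih hl
    have hi' : i ∉ l.toFinset := by simpa using hi
    refine ⟨Matrix.scalar ℤˣ (scalarSeries A (1 + PowerSeries.C (u i) * PowerSeries.X))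
            * F₁ + (E i).map (fun x => PowerSeries.C x * PowerSeries.X) *
            Matrix.scalar ℤˣ (scalarSeries A (leadSeries u l.toFinset)), ?_, ?_⟩
    · convert (hasExpM_evalMatrix (E i) (u i)).mul h1 using 1
      · funext t
        simp [seriesT]
      · rw [← map_mul, ← map_mul, List.toFinset_cons, leadSeries, Finset.prod_insert hi']
        rfl
    · have e : diffS (Matrix.scalar ℤˣ (scalarSeries A (1 + PowerSeries.C (u i) * PowerSeries.X))
            * F₁ + (E i).map (fun x => PowerSeries.C x * PowerSeries.X) *
            Matrix.scalar ℤˣ (scalarSeries A (leadSeries u l.toFinset)))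
          = scalarSeries A (1 + PowerSeries.C (u i) * PowerSeries.X) * diffS F₁
            + PowerSeries.C (diffS (E i)) *
              scalarSeries A (PowerSeries.X * leadSeries u l.toFinset) := by
        simp only [diffS, Matrix.add_apply, Matrix.scalar_apply, Matrix.diagonal_mul,
          Matrix.mul_diagonal, Matrix.map_apply, map_sub, map_mul (scalarSeries A) PowerSeries.X,
          scalarSeries_X]
        noncomm_ring
      rw [e, h2, List.toFinset_cons, Finset.sum_insert hi', Finset.erase_insert hi', add_comm,
        Finset.mul_sum]
      congr 1
      refine Finset.sum_congr rfl fun j hj => ?_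
      have hij : i ≠ j := fun h => hi' (h ▸ hj)
      rw [Finset.erase_insert_of_ne hij, leadSeries, leadSeries,
        Finset.prod_insert (fun h => hi' (Finset.mem_of_mem_erase h)), ← mul_assoc,
        scalarSeries_comm, mul_assoc, ← map_mul]
      congr 2
      ring

/-- After extracting the common factors, this is `(1 - u_i x) + (1 + u_i x) = 2`. -/
lemma leadSeries_mul_negHom_erase (u : ι → ℂ) {s : Finset ι} {i : ι} (hi : i ∈ s) :
    leadSeries u (s.erase i) * negHom (leadSeries u s)
      + leadSeries u s * negHom (leadSeries u (s.erase i)) = 2 * evenSeries u (s.erase i) := by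
  have h : leadSeries u s
      = (1 + PowerSeries.C (u i) * PowerSeries.X) * leadSeries u (s.erase i) :=
    (Finset.mul_prod_erase s _ hi).symm
  rw [← leadSeries_mul_negHom, h, map_mul, map_add, map_mul, map_one, negHom_C, negHom_X]
  ring

/-- The leading coefficients of `s₁₁(u) - s_{-1,-1}(u)`. -/
lemma hasExp_diffS (κ : Kind) (a c : ℂ) (E : ι → Matrix ℤˣ ℤˣ A) (u : ι → ℂ) {l : List ι}
    (hl : l.Nodup) :
    HasExp (fun t => diffS (seriesS κ a c (fun i => (t * u i) • (1 : Matrix ℤˣ ℤˣ A) + E i) l)) 0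
      (∑ i ∈ l.toFinset, PowerSeries.C (diffS (E i)) *
          scalarSeries A (2 * PowerSeries.X * evenSeries u (l.toFinset.erase i))
        + scalarSeries A (2 * PowerSeries.C c * PowerSeries.X * evenSeries u l.toFinset)) := by
  obtain ⟨T₁, h1, h2⟩ := hasExpM_seriesT E u hl
  set p := leadSeries u l.toFinset with hp
  have hK : HasExpM (fun _ => (seriesK a c).map (scalarSeries A)) 1
      (Matrix.diagonal fun i => scalarSeries A
        (PowerSeries.C (a + c * ((i : ℤ) : ℂ)) * PowerSeries.X)) := by
    intro i j
    have h := HasExp.linear (if i = j then (1 : A) else 0) 0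
      (if i = j then algebraMap ℂ A (a + c * ((i : ℤ) : ℂ)) else 0)
    convert h using 2 with t
    · simp only [seriesK, bdry, Matrix.map_apply, Matrix.diagonal_apply, smul_zero, zero_add]
      split_ifs
      · simp only [map_add, map_mul, map_one, scalarSeries_C, scalarSeries_X, map_intCast]
        rw [add_assoc, add_mul, mul_assoc, mul_assoc, PowerSeries.X_mul]
      · simp
    · simp [Matrix.one_apply, apply_ite PowerSeries.C]
    · rw [Matrix.diagonal_apply]
      split_ifs
      · rw [map_mul, scalarSeries_C, scalarSeries_X]
      · simp
  have h := (h1.mul hK).mul (h1.transposeNeg κ)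
  have hd := (h 1 1).sub (h (-1) (-1))
  have hθ : ∀ i, theta κ i i = 1 := by
    intro i
    cases κ
    · exact Int.units_mul_self i
    · rfl
  have ht : ∀ i j, transposeNeg κ (Matrix.scalar ℤˣ (scalarSeries A p)) i j
      = if i = j then scalarSeries A (negHom p) else 0 := by
    intro i j
    by_cases hij : i = j
    · subst hij
      simp only [transposeNeg, Matrix.of_apply, Matrix.scalar_apply, Matrix.diagonal_apply_eq,
        hθ, if_true, ← negHom_scalarSeries]
      simp [negHom]
    · simp [transposeNeg, Matrix.diagonal_apply, hij, Ne.symm hij, negU_zero]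
  have ht' : transposeNeg κ (Matrix.scalar ℤˣ (scalarSeries A p))
      = Matrix.scalar ℤˣ (scalarSeries A (negHom p)) := by
    ext1 i j
    rw [ht, Matrix.scalar_apply, Matrix.diagonal_apply]
  -- Transposition exchanges the two diagonal entries, so the difference changes sign. As it has the
  -- odd factor `u⁻¹`, the substitution `u ↦ -u` yields a second sign, and the contributions of `T`
  -- and `T^t` add up.
  have hs : ∀ i, transposeNeg κ T₁ i i = negHom (T₁ (-i) (-i)) := by
    intro i
    simp [transposeNeg, hθ, negHom]
  rw [ht'] at hd
  simp only [mul_one, Matrix.add_apply, Matrix.scalar_apply, Matrix.diagonal_mul,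
    Matrix.mul_diagonal, Matrix.diagonal_mul_diagonal, Matrix.diagonal_apply_eq, sub_self, hs,
    neg_neg] at hd
  convert hd using 1
  · rfl
  have e1 : scalarSeries A p * negHom (T₁ (-1) (-1)) +
        (scalarSeries A p * scalarSeries A
          (PowerSeries.C (a + c * (((1 : ℤˣ) : ℤ) : ℂ)) * PowerSeries.X) + T₁ 1 1) *
          scalarSeries A (negHom p) -
      (scalarSeries A p * negHom (T₁ 1 1) +
        (scalarSeries A p * scalarSeries A
          (PowerSeries.C (a + c * (((-1 : ℤˣ) : ℤ) : ℂ)) * PowerSeries.X) + T₁ (-1) (-1)) *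
          scalarSeries A (negHom p))
      = diffS T₁ * scalarSeries A (negHom p) - scalarSeries A p * negHom (diffS T₁)
        + scalarSeries A (2 * PowerSeries.C c * PowerSeries.X * evenSeries u l.toFinset) := by
    -- The part `a` of the boundary matrix is proportional to the identity and cancels in the
    -- difference; the `F₁₁`-part is counted twice.
    have e2 : 2 * PowerSeries.C c * PowerSeries.X * evenSeries u l.toFinset
        = p * (PowerSeries.C (a + c * (((1 : ℤˣ) : ℤ) : ℂ)) * PowerSeries.X) * negHom p
          - p * (PowerSeries.C (a + c * (((-1 : ℤˣ) : ℤ) : ℂ)) * PowerSeries.X) * negHom p := by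
      rw [← leadSeries_mul_negHom, ← hp]
      simp only [Units.val_one, Units.val_neg, Int.cast_one, Int.cast_neg, map_add, map_mul,
        map_neg, map_one]
      ring
    rw [e2, diffS, map_sub, map_sub]
    simp only [map_mul (scalarSeries A)]
    noncomm_ring
  rw [e1, h2, map_sum, Finset.mul_sum, Finset.sum_mul, ← Finset.sum_sub_distrib]
  congr 1
  refine Finset.sum_congr rfl fun i hi => ?_
  have e3 : 2 * PowerSeries.X * evenSeries u (l.toFinset.erase i)
      = PowerSeries.X * leadSeries u (l.toFinset.erase i) * negHom p
        - p * negHom (PowerSeries.X * leadSeries u (l.toFinset.erase i)) := by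
    rw [map_mul, negHom_X]
    linear_combination (-PowerSeries.X) * leadSeries_mul_negHom_erase u hi
  rw [e3]
  generalize PowerSeries.X * leadSeries u (l.toFinset.erase i) = q
  rw [map_sub, mul_sub, map_mul, map_mul, map_mul negHom, negHom_C, negHom_scalarSeries,
    ← mul_assoc, ← mul_assoc (scalarSeries A p), scalarSeries_comm p (PowerSeries.C _), mul_assoc
      (PowerSeries.C _) (scalarSeries A p)]

lemma coeff_evenSeries_of_lt (u : ι → ℂ) (s : Finset ι) {n : ℕ} (hn : 2 * s.card < n) :
    PowerSeries.coeff n (evenSeries u s) = 0 := by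
  induction s using Finset.induction_on generalizing n with
  | empty => simp [evenSeries, PowerSeries.coeff_one, show n ≠ 0 by simp at hn; omega]
  | insert i s hi ih =>
    rw [Finset.card_insert_of_notMem hi] at hn
    obtain ⟨m, rfl⟩ : ∃ m, n = m + 2 := ⟨n - 2, by omega⟩
    rw [evenSeries, Finset.prod_insert hi, sub_mul, one_mul, mul_assoc, map_sub,
      PowerSeries.coeff_C_mul, PowerSeries.coeff_X_pow_mul]
    have h1 := ih (n := m + 2) (by omega)
    have h2 := ih (n := m) (by omega)
    rw [evenSeries] at h1 h2
    rw [h1, h2, mul_zero, sub_zero]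

/-- The polynomial `∏ (1 - u_i² X²)` reversed as a polynomial in `X²`: substitute `X² = v⁻¹` and
multiply by `v ^ s.card`. -/
lemma sum_coeff_evenSeries (u : ι → ℂ) (s : Finset ι) (v : ℂ) :
    ∑ m ∈ Finset.range (s.card + 1), v ^ (s.card - m) * PowerSeries.coeff (2 * m) (evenSeries u s)
      = ∏ i ∈ s, (v - u i ^ 2) := by
  induction s using Finset.induction_on with
  | empty => simp [evenSeries]
  | insert i s hi ih =>
    have h0 : evenSeries u (insert i s)
        = evenSeries u s - PowerSeries.C (u i ^ 2) * (PowerSeries.X ^ 2 * evenSeries u s) := by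
      rw [evenSeries, Finset.prod_insert hi, sub_mul, one_mul, mul_assoc]
      rfl
    rw [Finset.card_insert_of_notMem hi, Finset.prod_insert hi, ← ih, sub_mul, h0]
    simp only [map_sub, mul_sub, Finset.sum_sub_distrib]
    congr 1
    · rw [Finset.sum_range_succ, coeff_evenSeries_of_lt u s (by omega), mul_zero, add_zero,
        Finset.mul_sum]
      refine Finset.sum_congr rfl fun m hm => ?_
      rw [show s.card + 1 - m = (s.card - m) + 1 by have := Finset.mem_range.1 hm; omega, pow_succ']
      ring
    · rw [Finset.sum_range_succ', Finset.mul_sum]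
      have : PowerSeries.coeff (2 * 0)
          (PowerSeries.C (u i ^ 2) * (PowerSeries.X ^ 2 * evenSeries u s)) = 0 := by
        simp
      rw [this, mul_zero, add_zero]
      refine Finset.sum_congr rfl fun m _ => ?_
      rw [PowerSeries.coeff_C_mul, show 2 * (m + 1) = 2 * m + 2 by ring,
        PowerSeries.coeff_X_pow_mul, show s.card + 1 - (m + 1) = s.card - m by omega]
      ring

/-- The elements `e₁₁ - e_{-1,-1}` of all factors are recovered from the leading coefficients of
`s₁₁(u) - s_{-1,-1}(u)`. -/
lemma diffS_mem_of_coeff_mem {R : Type*} [Ring R] [Algebra ℂ R] (B : Subalgebra ℂ R) (x : ι → R)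
    (u : ι → ℂ) (c : ℂ) {s : Finset ι} (hu : ∀ i ∈ s, ∀ j ∈ s, i ≠ j → u i ^ 2 ≠ u j ^ 2)
    (h : ∀ n, PowerSeries.coeff n (∑ i ∈ s, PowerSeries.C (x i) *
          scalarSeries R (2 * PowerSeries.X * evenSeries u (s.erase i))
        + scalarSeries R (2 * PowerSeries.C c * PowerSeries.X * evenSeries u s)) ∈ B)
    {i : ι} (hi : i ∈ s) : x i ∈ B := by
  have h2 : ∀ (q : PowerSeries ℂ) m, PowerSeries.coeff (2 * m + 1) (2 * PowerSeries.X * q)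
      = 2 * PowerSeries.coeff (2 * m) q := by
    intro q m
    rw [mul_assoc, ← map_ofNat PowerSeries.C 2, PowerSeries.coeff_C_mul,
      PowerSeries.coeff_succ_X_mul]
  -- Coefficients of odd degree suffice. The term with `c` is scalar, hence lies in `B` and can be
  -- subtracted; halving removes the factor 2.
  have hm : ∀ m, ∑ j ∈ s, PowerSeries.coeff (2 * m) (evenSeries u (s.erase j)) • x j ∈ B := by
    intro m
    have h1 := h (2 * m + 1)
    rw [map_add, map_sum, scalarSeries, PowerSeries.coeff_map] at h1
    have h3 := (B.smul_mem ((add_mem_cancel_right (B.algebraMap_mem _)).1 h1) (1 / 2 : ℂ))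
    rw [Finset.smul_sum] at h3
    convert h3 using 2 with j
    rw [PowerSeries.coeff_C_mul, PowerSeries.coeff_map, h2, ← Algebra.commutes,
      ← Algebra.smul_def, smul_smul]
    congr 1
    ring
  -- Lagrange interpolation: weighting by powers of `u_i²` evaluates the polynomial `∏_{r≠j} (v -
  -- u_r²)` at `v = u_i²`, which vanishes for every `j ≠ i`.
  have hsum : ∑ m ∈ Finset.range s.card, (u i ^ 2) ^ (s.card - 1 - m) •
      ∑ j ∈ s, PowerSeries.coeff (2 * m) (evenSeries u (s.erase j)) • x j
      = (∏ j ∈ s.erase i, (u i ^ 2 - u j ^ 2)) • x i := by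
    have hcard : ∀ j ∈ s, (s.erase j).card = s.card - 1 := fun j hj => Finset.card_erase_of_mem hj
    have hpos : 0 < s.card := Finset.card_pos.2 ⟨i, hi⟩
    simp only [Finset.smul_sum, smul_smul]
    rw [Finset.sum_comm]
    have e : ∀ j ∈ s, ∑ m ∈ Finset.range s.card, ((u i ^ 2) ^ (s.card - 1 - m) *
        PowerSeries.coeff (2 * m) (evenSeries u (s.erase j))) • x j
        = (∏ r ∈ s.erase j, (u i ^ 2 - u r ^ 2)) • x j := by
      intro j hj
      rw [← Finset.sum_smul, ← sum_coeff_evenSeries u (s.erase j), hcard j hj,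
        Nat.sub_add_cancel hpos]
    rw [Finset.sum_congr rfl e]
    refine Finset.sum_eq_single i (fun j _ hji => ?_) (fun h => absurd hi h)
    rw [Finset.prod_eq_zero (Finset.mem_erase.2 ⟨hji.symm, hi⟩) (sub_self _), zero_smul]
  have hne : ∏ j ∈ s.erase i, (u i ^ 2 - u j ^ 2) ≠ 0 :=
    Finset.prod_ne_zero_iff.2 fun j hj => sub_ne_zero.2
      (hu i hi j (Finset.mem_of_mem_erase hj) (Finset.ne_of_mem_erase hj).symm)
  have hB := B.smul_mem (hsum ▸ sum_mem fun m _ => B.smul_mem (hm m) _)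
    (∏ j ∈ s.erase i, (u i ^ 2 - u j ^ 2))⁻¹
  rwa [smul_smul, inv_mul_cancel₀ hne, one_smul] at hB

end Asymptotics

end

end TwistedBethe

namespace TwistedBethe

noncomputable section

/-! ### Compatibility of `σ₁` and `σ₂` with algebra homomorphisms -/

section Naturality

variable {A B : Type*} [Ring A] [Algebra ℂ A] [Ring B] [Algebra ℂ B]

lemma map_scalarSeries (φ : A →ₐ[ℂ] B) (f : PowerSeries ℂ) :
    PowerSeries.map (φ : A →+* B) (scalarSeries A f) = scalarSeries B f := by
  ext n
  simp [scalarSeries]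

lemma map_shiftU (φ : A →ₐ[ℂ] B) (F : PowerSeries A) :
    PowerSeries.map (φ : A →+* B) (shiftU F) = shiftU (PowerSeries.map (φ : A →+* B) F) := by
  ext n
  simp [shiftU]

lemma constMat_map {J : Type} (φ : A →ₐ[ℂ] B) (M : Matrix J J ℂ) :
    (constMat (A := A) M).map (PowerSeries.map (φ : A →+* B)) = constMat M := by
  ext i j : 2
  simp [constMat]

lemma scalarSeries_map_map {J : Type} (φ : A →ₐ[ℂ] B) (M : Matrix J J (PowerSeries ℂ)) :
    (M.map (scalarSeries A)).map (PowerSeries.map (φ : A →+* B)) = M.map (scalarSeries B) := by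
  ext i j : 2
  simp only [Matrix.map_apply, map_scalarSeries]

lemma sigmaOne_map (φ : A →ₐ[ℂ] B) (κ : Kind) (C : Matrix ℤˣ ℤˣ ℂ)
    (S : Matrix ℤˣ ℤˣ (PowerSeries A)) :
    PowerSeries.map (φ : A →+* B) (sigmaOne κ C S)
      = sigmaOne κ C (S.map (PowerSeries.map (φ : A →+* B))) := by
  have h : (S ⊗ₖ (1 : Matrix ℤˣ ℤˣ (PowerSeries A))).map (PowerSeries.map (φ : A →+* B))
      = S.map (PowerSeries.map (φ : A →+* B)) ⊗ₖ (1 : Matrix ℤˣ ℤˣ (PowerSeries B)) := by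
    ext p q : 2
    simp [Matrix.one_apply, apply_ite (PowerSeries.map (φ : A →+* B))]
  rw [sigmaOne, sigmaOne, AddMonoidHom.map_trace, Matrix.map_mul, Matrix.map_mul, Matrix.map_mul,
    constMat_map, constMat_map, scalarSeries_map_map, h]

lemma sigmaTwo_map (φ : A →ₐ[ℂ] B) (κ : Kind) (S : Matrix ℤˣ ℤˣ (PowerSeries A)) :
    PowerSeries.map (φ : A →+* B) (sigmaTwo κ S)
      = sigmaTwo κ (S.map (PowerSeries.map (φ : A →+* B))) := by
  have h : (S ⊗ₖ (1 : Matrix ℤˣ ℤˣ (PowerSeries A))).map (PowerSeries.map (φ : A →+* B))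
      = S.map (PowerSeries.map (φ : A →+* B)) ⊗ₖ (1 : Matrix ℤˣ ℤˣ (PowerSeries B)) := by
    ext p q : 2
    simp [Matrix.one_apply, apply_ite (PowerSeries.map (φ : A →+* B))]
  have h' : ((1 : Matrix ℤˣ ℤˣ (PowerSeries A)) ⊗ₖ S.map shiftU).map
        (PowerSeries.map (φ : A →+* B))
      = (1 : Matrix ℤˣ ℤˣ (PowerSeries B)) ⊗ₖ
        (S.map (PowerSeries.map (φ : A →+* B))).map shiftU := by
    ext p q : 2
    simp [Matrix.one_apply, apply_ite (PowerSeries.map (φ : A →+* B)), map_shiftU]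
  rw [sigmaTwo, sigmaTwo, AddMonoidHom.map_trace, Matrix.map_mul, Matrix.map_mul, Matrix.map_mul,
    constMat_map, scalarSeries_map_map, h, h']

lemma coeff_scalarSeries_mul_mem (𝓜 : Subalgebra ℂ A) (g : PowerSeries ℂ) {F : PowerSeries A}
    (hF : ∀ n, PowerSeries.coeff n F ∈ 𝓜) (n : ℕ) :
    PowerSeries.coeff n (scalarSeries A g * F) ∈ 𝓜 := by
  rw [PowerSeries.coeff_mul]
  refine sum_mem fun p _ => mul_mem ?_ (hF _)
  rw [scalarSeries, PowerSeries.coeff_map]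
  exact 𝓜.algebraMap_mem _

end Naturality

/-! ### Images of the Bethe subalgebra: commutativity and generators -/

section BetheImage

variable {A : Type*} [Ring A] [Algebra ℂ A] {ι : Type*}

/-- The image of the Bethe subalgebra under a homomorphism, in terms of the image of `S(u)`. -/
lemma bethe_map (κ : Kind) (φ : twistedYangian κ →ₐ[ℂ] A) {S : Matrix ℤˣ ℤˣ (PowerSeries A)}
    (hS : (twS κ).map (PowerSeries.map (φ : twistedYangian κ →+* A)) = S) :
    (bethe κ).map φ = Algebra.adjoin ℂ
      ((Set.range fun n => PowerSeries.coeff n (sigmaOne κ matF11 S)) ∪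
        Set.range fun n => PowerSeries.coeff n (sigmaTwo κ S)) := by
  rw [bethe, AlgHom.map_adjoin, Set.image_union, ← Set.range_comp, ← Set.range_comp, ← hS,
    ← sigmaOne_map, ← sigmaTwo_map]
  congr

lemma sigmaOne_smul (κ : Kind) (g : PowerSeries ℂ) (S : Matrix ℤˣ ℤˣ (PowerSeries A)) :
    sigmaOne κ matF11 (scalarSeries A g • S) = scalarSeries A (sigmaFactor κ * g) * diffS S := by
  rw [sigmaOne_eq, map_mul, mul_assoc, diffS, diffS, mul_sub (scalarSeries A g)]
  rfl

variable {κ : Kind} {a c : ℂ} {E : ι → Matrix ℤˣ ℤˣ A} {l : List ι} {g : PowerSeries ℂ}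
  {φ : twistedYangian κ →ₐ[ℂ] A}

/-- It suffices to compare generators: the coefficients of `σ₂` are central, and those of `σ₁` are
combinations of the commuting coefficients of `s₁₁ - s_{-1,-1}`. -/
lemma commute_of_mem_bethe_map (hE : IsGlFamily ℂ E) (hK : IsBdry κ a c) (hl : l.Nodup)
    (hS : (twS κ).map (PowerSeries.map (φ : twistedYangian κ →+* A))
      = scalarSeries A g • seriesS κ a c E l) {x y : A} (hx : x ∈ (bethe κ).map φ)
    (hy : y ∈ (bethe κ).map φ) : x * y = y * x := by
  rw [bethe_map κ φ hS] at hx hy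
  have h1 : ∀ m z, (∀ n, Commute (PowerSeries.coeff n (diffS (seriesS κ a c E l))) z) →
      Commute (PowerSeries.coeff m (sigmaOne κ matF11 (scalarSeries A g • seriesS κ a c E l))) z := by
    intro m z h
    rw [sigmaOne_smul, PowerSeries.coeff_mul]
    refine Commute.sum_left _ _ _ fun p _ => Commute.mul_left ?_ (h _)
    rw [scalarSeries, PowerSeries.coeff_map]
    exact Algebra.commutes _ _
  refine Algebra.adjoin_induction₂ (p := fun x y _ _ => Commute x y) ?_ ?_ ?_ ?_ ?_ ?_ ?_ ?_ hx hy
  · rintro _ _ (⟨m, rfl⟩ | ⟨m, rfl⟩) (⟨n, rfl⟩ | ⟨n, rfl⟩)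
    · exact h1 _ _ fun r => (h1 _ _ fun s => commute_coeff_diffS hE hK hl s r).symm
    · exact (commute_coeff_sigmaTwo hE hK hl g _ _).symm
    · exact commute_coeff_sigmaTwo hE hK hl g _ _
    · exact commute_coeff_sigmaTwo hE hK hl g _ _
  · exact fun r s => Algebra.commute_algebraMap_left r _
  · exact fun r x _ => Algebra.commute_algebraMap_left r x
  · exact fun r x _ => Algebra.commute_algebraMap_right r x
  · exact fun x y z _ _ _ h h' => Commute.add_left h h'
  · exact fun x y z _ _ _ h h' => Commute.add_right h h'
  · exact fun x y z _ _ _ h h' => Commute.mul_left h h'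
  · exact fun x y z _ _ _ h h' => Commute.mul_right h h'

/-- The scalar factor relating `σ₁` to `s₁₁ - s_{-1,-1}` has nonzero constant term, so it is
invertible and the relation can be inverted. -/
lemma coeff_diffS_mem_bethe_map (hg : PowerSeries.constantCoeff g ≠ 0)
    (hS : (twS κ).map (PowerSeries.map (φ : twistedYangian κ →+* A))
      = scalarSeries A g • seriesS κ a c E l) (n : ℕ) :
    PowerSeries.coeff n (diffS (seriesS κ a c E l)) ∈ (bethe κ).map φ := by
  have hf : PowerSeries.constantCoeff (sigmaFactor κ * g) ≠ 0 := by
    rw [map_mul, constantCoeff_sigmaFactor]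
    exact mul_ne_zero (by norm_num) hg
  have h : diffS (seriesS κ a c E l) = scalarSeries A (sigmaFactor κ * g)⁻¹ *
      sigmaOne κ matF11 (scalarSeries A g • seriesS κ a c E l) := by
    rw [sigmaOne_smul, ← mul_assoc, ← map_mul, PowerSeries.inv_mul_cancel _ hf, map_one, one_mul]
  rw [h, bethe_map κ φ hS]
  refine coeff_scalarSeries_mul_mem _ _ (fun m => ?_) n
  exact Algebra.subset_adjoin (Set.mem_union_left _ (Set.mem_range_self m))

end BetheImage

/-! ### The `S`-matrix in the modules `L` and `L ⊗ W(δ)` -/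

section TwistedRepresentations

variable {n : Type} [Fintype n] [DecidableEq n]

/-- The image of `S(u)` in the module `L ⊗ W`. -/
lemma twS_map_tensorCharacter (κ : Kind) (ρ : Yangian ℤˣ →ₐ[ℂ] Matrix n n ℂ)
    (w : twistedYangian κ →ₐ[ℂ] ℂ) :
    (twS κ).map (PowerSeries.map
        (tensorCharacter κ ρ w : twistedYangian κ →+* Matrix n n ℂ))
      = (matT ℤˣ).map (PowerSeries.map (ρ : Yangian ℤˣ →+* Matrix n n ℂ))
        * ((twS κ).map (PowerSeries.map (w : twistedYangian κ →+* ℂ))).map (scalarSeries _)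
        * transposeNeg κ ((matT ℤˣ).map (PowerSeries.map (ρ : Yangian ℤˣ →+* Matrix n n ℂ))) := by
  set inc : Matrix n n ℂ →+* Matrix n n (twistedYangian κ) := (algebraMap ℂ (twistedYangian κ)).mapMatrix with hinc
  set val : Matrix n n (twistedYangian κ) →+* Matrix n n (Yangian ℤˣ) := ((twistedYangian κ).val : twistedYangian κ →+* _).mapMatrix with hval
  set ω : Matrix n n (twistedYangian κ) →+* Matrix n n ℂ := (w : twistedYangian κ →+* ℂ).mapMatrix with hω
  set T := (matT ℤˣ).map (PowerSeries.map (ρ : Yangian ℤˣ →+* Matrix n n ℂ)) with hT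
  -- The character `w` is defined only on the twisted Yangian. So `T(u) S(u) T^t(-u)` is formed with
  -- coefficients there; applying `val` compares it with the coaction in `Y(2)`, and applying `ω`
  -- evaluates `w`.
  set X := T.map (PowerSeries.map inc) * (twS κ).map (PowerSeries.map (Matrix.scalar n))
    * transposeNeg κ (T.map (PowerSeries.map inc)) with hX
  have hL : (T.map (PowerSeries.map inc)).map (PowerSeries.map val) = leftT ρ := by
    ext i j m p q
    rfl
  have hR : ((twS κ).map (PowerSeries.map (Matrix.scalar n))).map (PowerSeries.map val)
      = matS κ (rightT n) := by
    ext i j m p q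
    rw [rightT, matS_map]
    simp only [Matrix.map_apply, PowerSeries.coeff_map, Matrix.scalar_apply, hval,
      RingHom.mapMatrix_apply, Matrix.diagonal_apply]
    split_ifs <;> simp [twS, twGen, genS]
  have hval' : X.map (PowerSeries.map val) = matS κ (leftT ρ * rightT n) := by
    rw [hX, Matrix.map_mul, Matrix.map_mul, ← transposeNeg_map, hL, hR, matS_mul κ fun i j k l =>
      commute_series fun r s => commute_left_right ρ r s i j k l]
  have hgen : (twS κ).map (PowerSeries.map (tensorCharacter κ ρ w : twistedYangian κ →+* Matrix n n ℂ))
      = X.map (PowerSeries.map ω) := by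
    ext i j m p q
    have h1 := congrArg (fun M : Matrix ℤˣ ℤˣ (PowerSeries (Matrix n n (Yangian ℤˣ))) =>
      (PowerSeries.coeff m (M i j) : Matrix n n (Yangian ℤˣ)) p q) hval'
    simp only [Matrix.map_apply, PowerSeries.coeff_map] at h1 ⊢
    rw [← lift_genS κ _ (isYangianMatrix_leftT_mul_rightT ρ)] at h1
    have h2 : ((PowerSeries.coeff m (twS κ i j) : twistedYangian κ) : Yangian ℤˣ)
        = genS κ m i j := by
      rw [twS, Matrix.of_apply, PowerSeries.coeff_mk]
      rfl
    exact congrArg w (Subtype.ext ((congrArg (fun y => coaction ρ y p q) h2).trans h1.symm))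
  have hTω : (T.map (PowerSeries.map inc)).map (PowerSeries.map ω) = T := by
    ext i j m p q
    simp [hinc, hω]
  rw [hgen, hX, Matrix.map_mul, Matrix.map_mul, ← transposeNeg_map, hTω]
  congr 2
  ext i j m p q
  simp only [Matrix.map_apply, PowerSeries.coeff_map, Matrix.scalar_apply, hω,
    RingHom.mapMatrix_apply, Matrix.diagonal_apply, scalarSeries, Matrix.algebraMap_matrix_apply]
  split_ifs <;> simp

/-- The image of `S(u)` in the module `W(δ)`. -/
lemma twS_map_characterW (δ : ℂ) :
    (twS Kind.plus).map (PowerSeries.map (characterW δ : twistedYangian Kind.plus →+* ℂ))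
      = (1 + PowerSeries.C (1 / 2) * PowerSeries.X : PowerSeries ℂ)⁻¹
        • seriesK (1 / 2) (δ - 1 / 2) := by
  have hw := isCharacterW_characterW δ
  ext1 i j
  -- `u + δ` and `u - δ + 1` are `(u + 1/2) ± (δ - 1/2)`; this is the source of the parameters `a =
  -- 1/2` and `c = δ - 1/2`.
  have e1 : (1 + PowerSeries.C δ * PowerSeries.X : PowerSeries ℂ)
      = 1 + PowerSeries.C (1 / 2) * PowerSeries.X
        + PowerSeries.C (δ - 1 / 2) * PowerSeries.X := by
    rw [map_sub]
    ring
  have e2 : (1 + PowerSeries.C (1 - δ) * PowerSeries.X : PowerSeries ℂ)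
      = 1 + PowerSeries.C (1 / 2) * PowerSeries.X
        - PowerSeries.C (δ - 1 / 2) * PowerSeries.X := by
    have : (1 - δ : ℂ) = 1 / 2 - (δ - 1 / 2) := by ring
    rw [this, map_sub]
    ring
  rw [Matrix.map_apply, Matrix.smul_apply, seriesK, bdry, smul_eq_mul]
  rcases units_cases i with rfl | rfl <;> rcases units_cases j with rfl | rfl
  · rw [hw.pos, e1, mul_comm]
    simp
  · rw [hw.pos_neg]
    simp
  · rw [hw.neg_pos]
    simp
  · rw [hw.neg, e2, mul_comm]
    simp [sub_eq_add_neg]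

variable {k : ℕ}

/-- The matrices of generators of `gl₂` on the factors of the tensor product. -/
def siteGl (d : Fin k → ℕ) (α β : Fin k → ℂ) (i : Fin k) : Matrix ℤˣ ℤˣ (EndTensor d) :=
  glMatrix (site d i (glA (d i) (α i) (β i))) (site d i (sl2E (d i)))
    (site d i (sl2F (d i))) (site d i (glB (d i) (α i) (β i)))

lemma tensorT_eq (d : Fin k → ℕ) (α β : Fin k → ℂ) :
    tensorT d α β = seriesT (siteGl d α β) (List.finRange k) := rfl

lemma matT_map_tensorRep (d : Fin k → ℕ) (α β : Fin k → ℂ) :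
    (matT ℤˣ).map (PowerSeries.map (tensorRep d α β : Yangian ℤˣ →+* EndTensor d))
      = tensorT d α β := by
  ext1 i j
  ext1 r
  rw [Matrix.map_apply, PowerSeries.coeff_map, matT, Matrix.of_apply, PowerSeries.coeff_mk]
  exact Yangian.lift_genT (tensorT d α β) (isYangianMatrix_tensorT d α β) r i j

lemma twS_map_minus (d : Fin k → ℕ) (α β : Fin k → ℂ) :
    (twS Kind.minus).map (PowerSeries.map (((tensorRep d α β).comp
        (twistedYangian Kind.minus).val : twistedYangian Kind.minus →ₐ[ℂ] EndTensor d) :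
          twistedYangian Kind.minus →+* EndTensor d))
      = scalarSeries (EndTensor d) 1 • seriesS Kind.minus 0 0 (siteGl d α β) (List.finRange k) := by
  have h1 : (seriesK 0 0).map (scalarSeries (EndTensor d)) = 1 := by
    rw [seriesK, map_zero, bdry_minus, Matrix.map_one _ (map_zero _) (map_one _)]
  rw [map_one, one_smul, seriesS, h1, mul_one, ← tensorT_eq]
  ext1 i j
  ext1 m
  rw [Matrix.map_apply, PowerSeries.coeff_map, twS, Matrix.of_apply, PowerSeries.coeff_mk]
  exact lift_genS Kind.minus (tensorT d α β) (isYangianMatrix_tensorT d α β) m i j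

lemma twS_map_plus (d : Fin k → ℕ) (α β : Fin k → ℂ) (δ : ℂ) :
    (twS Kind.plus).map (PowerSeries.map (tensorCharacter Kind.plus (tensorRep d α β)
        (characterW δ) : twistedYangian Kind.plus →+* EndTensor d))
      = scalarSeries (EndTensor d) (1 + PowerSeries.C (1 / 2) * PowerSeries.X : PowerSeries ℂ)⁻¹
        • seriesS Kind.plus (1 / 2) (δ - 1 / 2) (siteGl d α β) (List.finRange k) := by
  rw [twS_map_tensorCharacter, matT_map_tensorRep, twS_map_characterW, seriesS, ← tensorT_eq]
  have h : ∀ g : PowerSeries ℂ, (g • seriesK (1 / 2) (δ - 1 / 2)).map (scalarSeries (EndTensor d))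
      = scalarSeries (EndTensor d) g •
        (seriesK (1 / 2) (δ - 1 / 2)).map (scalarSeries (EndTensor d)) := by
    intro g
    ext1 i j
    simp only [Matrix.map_apply, Matrix.smul_apply, smul_eq_mul, map_mul]
  have h' : ∀ (g : PowerSeries ℂ) (M N : Matrix ℤˣ ℤˣ (PowerSeries (EndTensor d))),
      M * (scalarSeries (EndTensor d) g • N) = scalarSeries (EndTensor d) g • (M * N) := by
    intro g M N
    ext1 i j
    simp only [Matrix.mul_apply, Matrix.smul_apply, smul_eq_mul, Finset.mul_sum]
    exact Finset.sum_congr rfl fun b _ => by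
      rw [← mul_assoc, ← scalarSeries_comm, mul_assoc]
  rw [h, h', Matrix.smul_mul]

lemma site_smul_one (d : Fin k → ℕ) (i : Fin k) (c : ℂ) :
    site d i (c • (1 : Matrix (Fin (d i + 1)) (Fin (d i + 1)) ℂ)) = c • 1 := by
  rw [← site_one d i]
  ext p q
  simp only [site_apply, Matrix.smul_apply, smul_eq_mul, mul_assoc]

lemma isGlFamily_siteGl (d : Fin k → ℕ) (α β : Fin k → ℂ) : IsGlFamily ℂ (siteGl d α β) where
  isGl i a b a' b' := by
    -- The Yangian relation with `r = 0`, `s = 1` between the coefficients of `u⁻¹` is the `gl₂`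
    -- relation.
    simpa [factorT, coeff_evalMatrix, siteGl] using
      (isYangianMatrix_factorT d α β i).comm 0 1 a b a' b'
  commute i j hij a b a' b' := by
    have h : ∀ i a b, ∃ x, siteGl d α β i a b = site d i x := by
      intro i a b
      simp only [siteGl, glMatrix, Matrix.of_apply]
      split_ifs <;> exact ⟨_, rfl⟩
    obtain ⟨x, hx⟩ := h i a b
    obtain ⟨y, hy⟩ := h j a' b'
    rw [hx, hy]
    exact site_commute d hij x y
  trace i := by
    refine ⟨α i + β i, ?_⟩
    simp only [siteGl, glMatrix, Matrix.of_apply, if_true]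
    rw [if_neg (by decide), if_neg (by decide), ← site_add, glA, glB, ← site_smul_one d i]
    congr 1
    module
  casimir i := by
    -- The value on the highest weight vector, index `j = 0`, where the lowering-raising product
    -- vanishes.
    refine ⟨((α i + β i) / 2) ^ 2 - (α i + β i) / 2 - (d i : ℂ) ^ 2 / 4 - (d i : ℂ) / 2, ?_⟩
    simp only [siteGl, glMatrix, Matrix.of_apply, if_true]
    simp only [show (-1 : ℤˣ) ≠ 1 by decide, if_false]
    rw [← site_mul, ← site_mul,
      ← site_sub, ← site_sub, ← site_smul_one d i]
    congr 1
    have h1 : glA (d i) (α i) (β i) = Matrix.diagonal fun j : Fin (d i + 1) =>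
        (α i + β i) / 2 + 1 / 2 * ((d i : ℂ) - 2 * (j : ℕ)) := by
      ext p q
      simp only [glA, sl2H, Matrix.add_apply, Matrix.smul_apply, Matrix.one_apply,
        Matrix.diagonal_apply, smul_eq_mul]
      split_ifs <;> simp
    have h2 : glB (d i) (α i) (β i) = Matrix.diagonal fun j : Fin (d i + 1) =>
        (α i + β i) / 2 - 1 / 2 * ((d i : ℂ) - 2 * (j : ℕ)) := by
      ext p q
      simp only [glB, sl2H, Matrix.sub_apply, Matrix.smul_apply, Matrix.one_apply,
        Matrix.diagonal_apply, smul_eq_mul]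
      split_ifs <;> simp
    ext p q
    rw [h1, h2, Matrix.diagonal_mul_diagonal, Matrix.sub_apply, Matrix.sub_apply, sl2_fe_apply,
      Matrix.diagonal_apply, Matrix.diagonal_apply, Matrix.smul_apply, Matrix.one_apply,
      smul_eq_mul]
    split_ifs <;> ring

end TwistedRepresentations

end

end TwistedBethe

namespace TwistedBethe

noncomputable section

/-! ### The limits of the Bethe subalgebras -/

section MainTheorem

open Filter Topology

variable {k : ℕ}

lemma siteGl_shift (d : Fin k → ℕ) (α β u : Fin k → ℂ) (t : ℂ) :
    siteGl d (fun i => t * u i + α i) (fun i => t * u i + β i)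
      = fun i => (t * u i) • (1 : Matrix ℤˣ ℤˣ (EndTensor d)) + siteGl d α β i := by
  have hA : ∀ i, glA (d i) (t * u i + α i) (t * u i + β i)
      = (t * u i) • (1 : Matrix (Fin (d i + 1)) (Fin (d i + 1)) ℂ) + glA (d i) (α i) (β i) := by
    intro i
    simp only [glA]
    module
  have hB : ∀ i, glB (d i) (t * u i + α i) (t * u i + β i)
      = (t * u i) • (1 : Matrix (Fin (d i + 1)) (Fin (d i + 1)) ℂ) + glB (d i) (α i) (β i) := by
    intro i
    simp only [glB]
    module
  funext i
  ext1 a b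
  rcases units_cases a with rfl | rfl <;> rcases units_cases b with rfl | rfl <;>
    simp [siteGl, glMatrix, hA, hB, site_add, site_smul_one]

lemma diffS_siteGl (d : Fin k → ℕ) (α β : Fin k → ℂ) (i : Fin k) :
    diffS (siteGl d α β i) = cartanH d i := by
  have h : glA (d i) (α i) (β i) - glB (d i) (α i) (β i) = sl2H (d i) := by
    simp only [glA, glB]
    module
  rw [cartanH, ← h, site_sub]
  simp [diffS, siteGl, glMatrix]

lemma cartanH_eq_diagonal (d : Fin k → ℕ) (i : Fin k) :
    cartanH d i = Matrix.diagonal fun p => (d i : ℂ) - 2 * ((p i : ℕ) : ℂ) := by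
  ext p q
  rw [cartanH, site_apply, sl2H, Matrix.diagonal_apply, Matrix.diagonal_apply]
  by_cases hpq : p = q
  · subst hpq
    simp
  · rw [if_neg hpq]
    split_ifs with h
    · obtain ⟨j, hj⟩ := Function.ne_iff.1 hpq
      have hji : j ≠ i := fun e => hj (e ▸ h)
      exact mul_eq_zero_of_right _ (Finset.prod_eq_zero (i := j)
        (Finset.mem_erase.2 ⟨hji, Finset.mem_univ j⟩) (Matrix.one_apply_ne hj))
    · rw [zero_mul]

/-- The leading term of `s₁₁ - s_{-1,-1}` is zero, so the rescaled coefficients `t · t⁻ⁿ` times the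
`n`-th one stay in `B t` and converge to the first-order term. Interpolation then takes place inside
the limit subalgebra. -/
lemma cartanH_mem_limitSubalgebra (κ : Kind) (a c : ℂ) (d : Fin k → ℕ) (α β u : Fin k → ℂ)
    (hu : ∀ i j, i ≠ j → u i ^ 2 ≠ u j ^ 2) (B : ℂ → Subalgebra ℂ (EndTensor d))
    (hB : ∀ t n, PowerSeries.coeff n (diffS (seriesS κ a c
      (siteGl d (fun i => t * u i + α i) (fun i => t * u i + β i)) (List.finRange k))) ∈ B t)
    (i : Fin k) : cartanH d i ∈ limitSubalgebra B (Bornology.cobounded ℂ) := by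
  have hexp := hasExp_diffS κ a c (siteGl d α β) u (List.nodup_finRange k)
  rw [← diffS_siteGl d α β i]
  refine diffS_mem_of_coeff_mem _ (fun i => diffS (siteGl d α β i)) u c
    (s := (List.finRange k).toFinset) (fun i _ j _ => hu i j) (fun n => ?_) (by simp)
  refine mem_limitSubalgebra.2 ⟨_, fun t => ?_, hexp n⟩
  have h := hB t n
  rw [siteGl_shift] at h
  simp only [map_zero, sub_zero]
  exact Subalgebra.smul_mem _ (Subalgebra.smul_mem _ h _) _

/-- Limits of the images of the Bethe subalgebras, for both kinds of representations. -/
lemma grassmannTendsto_bethe_map {κ : Kind} {a c : ℂ} (hK : IsBdry κ a c) {g : PowerSeries ℂ}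
    (hg : PowerSeries.constantCoeff g ≠ 0) (d : Fin k → ℕ) (α β u : Fin k → ℂ)
    (hu : ∀ i j, i ≠ j → u i ^ 2 ≠ u j ^ 2) (φ : ℂ → twistedYangian κ →ₐ[ℂ] EndTensor d)
    (hφ : ∀ t, (twS κ).map (PowerSeries.map (φ t : twistedYangian κ →+* EndTensor d))
      = scalarSeries (EndTensor d) g • seriesS κ a c
        (siteGl d (fun i => t * u i + α i) (fun i => t * u i + β i)) (List.finRange k)) (z : ℂ) :
    GrassmannTendsto (fun t => Subalgebra.toSubmodule ((bethe κ).map (φ t)))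
      (Bornology.cobounded ℂ) (Subalgebra.toSubmodule (Algebra.adjoin ℂ
        (Set.range fun i => cartanH d i + z • (1 : EndTensor d)))) := by
  have hdiag : ∀ i, cartanH d i + z • (1 : EndTensor d)
      = Matrix.diagonal fun p => (d i : ℂ) - 2 * ((p i : ℕ) : ℂ) + z := by
    intro i
    rw [cartanH_eq_diagonal, Matrix.smul_one_eq_diagonal, Matrix.diagonal_add]
  -- The weight `d_i - 2 p_i` determines `p_i`, and a common shift by `z` does not affect this.
  have hsep : ∀ p q : TensorIndex d, (∀ i, (d i : ℂ) - 2 * ((p i : ℕ) : ℂ) + z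
      = (d i : ℂ) - 2 * ((q i : ℕ) : ℂ) + z) → p = q := by
    intro p q h
    funext i
    refine Fin.ext (Nat.cast_injective (R := ℂ) ?_)
    linear_combination (-1 / 2) * h i
  have hcomm : ∀ t, ∀ x ∈ (bethe κ).map (φ t), ∀ y ∈ (bethe κ).map (φ t), x * y = y * x :=
    fun t x hx y hy => commute_of_mem_bethe_map (isGlFamily_siteGl d _ _) hK
      (List.nodup_finRange k) (hφ t) hx hy
  have hlim : ∀ i, cartanH d i + z • (1 : EndTensor d)
      ∈ limitSubalgebra (fun t => (bethe κ).map (φ t)) (Bornology.cobounded ℂ) := by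
    intro i
    refine add_mem ?_ (Subalgebra.smul_mem _ (one_mem _) _)
    exact cartanH_mem_limitSubalgebra κ a c d α β u hu _
      (fun t n => coeff_diffS_mem_bethe_map hg (hφ t) n) i
  simp only [hdiag] at hlim ⊢
  exact grassmannTendsto_of_diagonal _ hsep _ _ hcomm hlim

end MainTheorem

end

end TwistedBethe
theorem mainTheorem4 (k : ℕ) (d : Fin k → ℕ) (α β u : Fin k → ℂ)
    (hd : ∀ i, α i - β i = (d i : ℂ)) (hu : ∀ i j, i ≠ j → u i ^ 2 ≠ u j ^ 2) :
    TwistedBethe.GrassmannTendsto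
        (fun t : ℂ => Subalgebra.toSubmodule (TwistedBethe.imageBetheMinus d
          (fun i => t * u i + α i) (fun i => t * u i + β i)))
        (Bornology.cobounded ℂ)
        (Subalgebra.toSubmodule (Algebra.adjoin ℂ
          (Set.range fun i => TwistedBethe.cartanH d i))) ∧
      ∀ δ : ℂ, TwistedBethe.GrassmannTendsto
        (fun t : ℂ => Subalgebra.toSubmodule (TwistedBethe.imageBethePlus d
          (fun i => t * u i + α i) (fun i => t * u i + β i) δ))
        (Bornology.cobounded ℂ)
        (Subalgebra.toSubmodule (Algebra.adjoin ℂ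
          (Set.range fun i => TwistedBethe.cartanH d i + (δ - 1 / 2) • (1 : TwistedBethe.EndTensor d)))) := by
  refine ⟨?_, fun δ => ?_⟩
  -- Symplectic case: trivial boundary matrix, prefactor 1 and no shift of the generators.
  · have h := TwistedBethe.grassmannTendsto_bethe_map (κ := TwistedBethe.Kind.minus) (g := 1)
      ⟨rfl, rfl⟩ (by simp) d α β u hu _ (fun t => TwistedBethe.twS_map_minus d _ _) 0
    simp only [zero_smul, add_zero] at h
    exact h
  -- Orthogonal case: `W(δ)` supplies the boundary matrix with `a = 1/2`, `c = δ - 1/2` and the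
  -- prefactor `(1 + u⁻¹/2)⁻¹`. The shift of the generators is chosen as `z = δ - 1/2`.
  · refine TwistedBethe.grassmannTendsto_bethe_map (κ := TwistedBethe.Kind.plus)
      (show (2 : ℂ) * (1 / 2) = 1 by norm_num) ?_ d α β u hu _
      (fun t => TwistedBethe.twS_map_plus d _ _ δ) (δ - 1 / 2)
    simp
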